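/- Let $d\ge 1$, $\mathbb T^d=\mathbb R^d/\mathbb Z^d$, $\gamma\ge 1$, $K\in\mathbb R$, and let $\mu_0,\lambda$ be real functions with $0\le \mu_0(z),\lambda(z)\le K/z$ for $z>0$, such that the maps $\mathbb R^{d\times d}\ni B\mapsto \mu_0(|B|)B$ and $\mathbb R\ni s\mapsto\lambda(|s|)s$ are monotone ($|B|$ is the Frobenius norm). For $T>0$ consider on $(0,T)\times\mathbb T^d$ the system \[ \varrho_t+\mathrm{div}(\varrho u)=0,\qquad -\mathrm{div}\big(\mu_0(|\mathbb Du|)\mathbb Du\big)-\Delta u-\nabla\big((1+\lambda(|\mathrm{div}\,u|))\,\mathrm{div}\,u\big)+\nabla\varrho^\gamma=0, \] with $\varrho\ge 0$, $\varrho|_{t=0}=\varrho_0\in L^\infty(\mathbb T^d)$ and $\int_{\mathbb T^d}u(t,x)\,dx=0$ for $t\in(0,T)$, where $\mathbb Du=\frac12(\nabla u+\nabla u^T)$. A smooth solution is a pair $\varrho\colon[0,T]\times\mathbb T^d\to[0,\infty)$, $u\colon[0,T]\times\mathbb T^d\to\mathbb R^d$ of functions that are continuous together with their first spatial derivatives,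 such that the initial condition holds almost everywhere, the zero-mean condition holds, the first equation holds pointwise, and the second holds in the sense of distributions on $\mathbb T^d$ for almost every $t\in(0,T)$ (in particular, classical solutions are included). Let $\|f\|_{BMO}=\sup_Q\frac1{|Q|}\int_Q|f-\frac1{|Q|}\int_Qf|\,dx$, the supremum being over all cubes $Q$ of side at most $1$ in $\mathbb T^d$, and let $BMO(\mathbb T^d)$ carry the norm $\|f\|_{L^1}+\|f\|_{BMO}$. Then for every $M\ge 0$ there are a constant $C$, depending only on $d,\gamma,K,M$, and constants $C(p,T)$ ($1\le p<\infty$, $T>0$), depending only on $d,\gamma,K,M,p,T$, with $C(p,T)\to\infty$ as $p\to\infty$ and as $T\to\infty$, such that for all $\mu_0,\lambda$ as above, all $T>0$ and all $\varrho_0$ with $\|\varrho_0\|_{L^\infty}\le M$, every smooth solution satisfies \[ \|\nabla u\|_{L^2((0,T)\times\mathbb T^d)}+\|\varrho\|_{L^\infty(0,T;L^\gamma)}\le C, \] \[ \|(2+\lambda(|\mathrm{div}\,u|))\,\mathrm{div}\,u-\varrho^\gamma\|_{L^\infty(0,T;BMO)}\le C, \] \[ \|\mathrm{div}\,u\|_{L^\infty(0,T;L^p)}+\|\varrho\|_{L^\infty(0,T;L^p)}\le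 C(p,T)\qquad\text{for all }1\le p<\infty. \] -/

import Mathlib

open MeasureTheory Set Filter
open scoped ENNReal NNReal

noncomputable section

namespace PowerLawStokes

variable {d : ℕ}

/-! Functions on the torus `ℝ^d / ℤ^d` are `ℤ^d`-periodic functions on `ℝ^d`, integrated over the
unit cube. The (sup) norm carried by `Fin d → ℝ` is never used as a norm below: only its topology
and Lebesgue measure are, and lengths of matrices are Frobenius norms. -/

/-- `ℤ^d`-periodicity. -/
def IsPeriodic {E : Type*} (f : (Fin d → ℝ) → E) : Prop :=
  ∀ (i : Fin d) (x : Fin d → ℝ), f (x + Pi.single i 1) = f x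

/-- The axis-parallel cube with lower corner `a` and side length `l`. -/
def cube (a : Fin d → ℝ) (l : ℝ) : Set (Fin d → ℝ) :=
  Set.univ.pi fun i => Set.Ico (a i) (a i + l)

/-- Lebesgue measure on the torus, i.e. on the fundamental domain `[0,1)^d`. -/
def torusMeasure (d : ℕ) : Measure (Fin d → ℝ) :=
  volume.restrict (cube (0 : Fin d → ℝ) 1)

/-- The partial derivative `∂_j f`. -/
def pd (j : Fin d) (f : (Fin d → ℝ) → ℝ) (x : Fin d → ℝ) : ℝ :=
  fderiv ℝ f x (Pi.single j 1)

/-- The gradient `(∇u)_{ij} = ∂_j u_i` of a vector field. -/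
def grad (u : (Fin d → ℝ) → Fin d → ℝ) (x : Fin d → ℝ) : Matrix (Fin d) (Fin d) ℝ :=
  Matrix.of fun i j => pd j (fun y => u y i) x

/-- The symmetric gradient `𝔻u`. -/
def symGrad (u : (Fin d → ℝ) → Fin d → ℝ) (x : Fin d → ℝ) : Matrix (Fin d) (Fin d) ℝ :=
  (1 / 2 : ℝ) • (grad u x + (grad u x).transpose)

/-- The divergence of a vector field. -/
def divg (u : (Fin d → ℝ) → Fin d → ℝ) (x : Fin d → ℝ) : ℝ :=
  ∑ i, pd i (fun y => u y i) x

/-- The product `A : B` of matrices. -/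
def ddot (A B : Matrix (Fin d) (Fin d) ℝ) : ℝ := ∑ i, ∑ j, A i j * B i j

/-- The Frobenius norm `|A|`. -/
def frob (A : Matrix (Fin d) (Fin d) ℝ) : ℝ := √(ddot A A)

/-- Assumptions on the viscosities: `0 ≤ μ₀(z), λ(z) ≤ K / z` for `z > 0`, and the maps
`B ↦ μ₀(|B|) B` and `s ↦ λ(|s|) s` are monotone. The values at `z = 0` are irrelevant. -/
structure IsViscosity (d : ℕ) (K : ℝ) (μ₀ lam : ℝ → ℝ) : Prop where
  shear_nonneg : ∀ z, 0 < z → 0 ≤ μ₀ z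
  shear_le : ∀ z, 0 < z → μ₀ z ≤ K / z
  bulk_nonneg : ∀ z, 0 < z → 0 ≤ lam z
  bulk_le : ∀ z, 0 < z → lam z ≤ K / z
  shear_mono : ∀ A B : Matrix (Fin d) (Fin d) ℝ,
    0 ≤ ddot (μ₀ (frob A) • A - μ₀ (frob B) • B) (A - B)
  bulk_mono : Monotone fun s : ℝ => lam |s| * s

/-- `f` is a function on `[0,T] × 𝕋^d`, continuous together with its first spatial derivatives. -/
structure IsC1InSpace (T : ℝ) (f : ℝ → (Fin d → ℝ) → ℝ) : Prop where
  periodic : ∀ t ∈ Icc 0 T, IsPeriodic (f t)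
  contDiff : ∀ t ∈ Icc 0 T, ContDiff ℝ 1 (f t)
  continuousOn : ContinuousOn (fun q : ℝ × (Fin d → ℝ) => f q.1 q.2) (Icc 0 T ×ˢ univ)
  continuousOn_pd : ∀ j,
    ContinuousOn (fun q : ℝ × (Fin d → ℝ) => pd j (f q.1) q.2) (Icc 0 T ×ˢ univ)

/-- `(ϱ, u)` is a smooth solution on `[0,T] × 𝕋^d`, with initial density `ϱ₀`, of
`ϱ_t + div (ϱ u) = 0`,
`- div (μ₀(|𝔻u|) 𝔻u) - Δu - ∇((1 + λ(|div u|)) div u) + ∇ ϱ^γ = 0`, `∫ u dx = 0`.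
The functions `ϱ ≥ 0`, `u` are continuous with continuous first derivatives in space, and the
continuity equation holds pointwise. No regularity of `μ₀`, `λ` is assumed, so the stress need not
be differentiable (nor even continuous) where `𝔻u` or `div u` vanishes; hence the momentum
equation, which has no time derivative, is understood in the sense of distributions on the torus
at almost every time. Every classical solution satisfies this. -/
structure IsSmoothSolution (γ T : ℝ) (μ₀ lam : ℝ → ℝ) (ϱ₀ : (Fin d → ℝ) → ℝ)
    (ϱ : ℝ → (Fin d → ℝ) → ℝ) (u : ℝ → (Fin d → ℝ) → Fin d → ℝ) : Prop where
  density_smooth : IsC1InSpace T ϱ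
  velocity_smooth : ∀ i, IsC1InSpace T fun t x => u t x i
  density_nonneg : ∀ t ∈ Icc 0 T, ∀ x, 0 ≤ ϱ t x
  initial : ϱ 0 =ᵐ[torusMeasure d] ϱ₀
  mean_zero : ∀ t ∈ Ioo 0 T, ∀ i, ∫ x, u t x i ∂torusMeasure d = 0
  continuity : ∀ t ∈ Ioo 0 T, ∀ x,
    HasDerivAt (fun s => ϱ s x) (-divg (fun y => ϱ t y • u t y) x) t
  momentum : ∀ᵐ t ∂volume.restrict (Ioo 0 T),
    ∀ φ : (Fin d → ℝ) → Fin d → ℝ, ContDiff ℝ ((⊤ : ℕ∞) : WithTop ℕ∞) φ → IsPeriodic φ →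
      ∫ x, (μ₀ (frob (symGrad (u t) x)) * ddot (symGrad (u t) x) (symGrad φ x)
        + ddot (grad (u t) x) (grad φ x)
        + (1 + lam |divg (u t) x|) * divg (u t) x * divg φ x
        - ϱ t x ^ γ * divg φ x) ∂torusMeasure d = 0

/-- The seminorm `‖f‖_BMO`: the supremum of the mean oscillations over all cubes of the torus,
i.e. (images of) cubes of side at most `1` with arbitrary position. -/
def bmoSeminorm (f : (Fin d → ℝ) → ℝ) : ℝ≥0∞ :=
  ⨆ (a : Fin d → ℝ) (l : ℝ) (_ : l ∈ Ioc (0 : ℝ) 1),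
    (volume (cube a l))⁻¹ * ∫⁻ x in cube a l, ‖f x - ⨍ y in cube a l, f y‖ₑ

/-- The norm `‖f‖_{L¹} + ‖f‖_BMO` of the Banach space `BMO(𝕋^d)`. -/
def bmoNorm (f : (Fin d → ℝ) → ℝ) : ℝ≥0∞ :=
  eLpNorm f 1 (torusMeasure d) + bmoSeminorm f

/-- The norm of `L^∞(0,T; L^p(𝕋^d))`. -/
def normLinftyLp (T p : ℝ) (f : ℝ → (Fin d → ℝ) → ℝ) : ℝ≥0∞ :=
  essSup (fun t => eLpNorm (f t) (ENNReal.ofReal p) (torusMeasure d)) (volume.restrict (Ioo 0 T))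

/-- The norm of `L^∞(0,T; BMO(𝕋^d))`. -/
def normLinftyBMO (T : ℝ) (f : ℝ → (Fin d → ℝ) → ℝ) : ℝ≥0∞ :=
  essSup (fun t => bmoNorm (f t)) (volume.restrict (Ioo 0 T))

/-- The norm `‖∇u‖_{L²((0,T) × 𝕋^d)}`. -/
def normGradL2 (T : ℝ) (u : ℝ → (Fin d → ℝ) → Fin d → ℝ) : ℝ≥0∞ :=
  eLpNorm (fun q : ℝ × (Fin d → ℝ) => frob (grad (u q.1) q.2)) 2
    ((volume.restrict (Ioo 0 T)).prod (torusMeasure d))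

end PowerLawStokes

end

open scoped Topology ContDiff

noncomputable section

namespace PowerLawStokes

/-! ### A compactly supported substitute for the heat kernel -/

/-! Let `F = (2 + λ(|div u|)) div u - ϱ^γ` be the effective viscous flux. The divergence of the
momentum equation reads `ΔF = -∂ᵢ∂ⱼ Sᵢⱼ` with `S = μ₀(|𝔻u|) 𝔻u`, and `|S| ≤ K`. Thus `F` is, up to
constants, a double Riesz transform of a bounded field, so its mean oscillations are controlled by
`d` and `K` alone (`IsDivFree.weakRel`, `exists_oscillation_le`, `exists_flux_bounds`). Since `div
u` has mean zero, the mean of `F` is at most `K + ∫ ϱ^γ` in absolute value.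

The BMO bound avoids singular integral theory. A radial pair `η`, `B` satisfies `ΔB = 2^{-d} η(·/2)
- η`, so sums of dilates of `B` telescope: mollifying `F` at a fine scale equals mollifying it at a
huge scale plus second derivatives of dilates of `B` convolved with `S`. On a unit cube the coarse
dilates have summable Lipschitz constants. The fine ones are treated together by `∫ |∇²w|² = ∫
|Δw|²`, their total Laplacian being a difference of two mollifiers.

The energy bound comes from testing with `u`: `∫ |∇u|² ≤ ∫ ϱ^γ div u`. By the renormalised
continuity equation the right side is `-(γ-1)⁻¹ d/dt ∫ ϱ^γ`, or `-d/dt ∫ ϱ log ϱ` when `γ = 1`, so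
its time integral is controlled by the initial density (`exists_energy_bound`).

For the `L^p` bounds, John–Nirenberg gives exponential integrability of `F`, hence all its moments,
uniformly in time. In `d/dt ∫ ϱ^p = -(p-1) ∫ ϱ^p div u` insert `2 div u = F - λ div u + ϱ^γ`. Where
`ϱ^γ` exceeds `|F| + K` the pressure damps the density; elsewhere `ϱ` is itself controlled by `|F| +
K`. So the derivative is bounded by a moment of `F`, and `∫ ϱ^p` grows at most linearly in time
(`IsSmoothSolution.integral_density_le`). The bound on `div u` is then read off from the formula for
`F`. -/

/-- The square of the Euclidean length. -/
def sq {d : ℕ} (x : Fin d → ℝ) : ℝ := ∑ i, x i ^ 2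

/-- The average `∫₀^{log 2} e^{cτ} R(q e^{-2τ}) dτ` of rescalings of a profile `R`. -/
def scaleAvg (c : ℝ) (R : ℝ → ℝ) (q : ℝ) : ℝ :=
  ∫ τ in (0 : ℝ)..Real.log 2, Real.exp (c * τ) * R (q * Real.exp (-2 * τ))

/-- Differentiation under the integral brings out a factor `e^{-2τ}`, absorbed by lowering the
weight exponent by 2. The family of averages is therefore closed under differentiation, which
reduces smoothness to an induction. -/
theorem hasDerivAt_scaleAvg (c : ℝ) {R : ℝ → ℝ} (hR : ContDiff ℝ 1 R) (q : ℝ) :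
    HasDerivAt (scaleAvg c R) (scaleAvg (c - 2) (deriv R) q) q := by
  have hR' : Continuous (deriv R) := hR.continuous_deriv le_rfl
  have hRc : Continuous R := hR.continuous
  have hcont : Continuous fun z : ℝ × ℝ =>
      Real.exp ((c - 2) * z.2) * deriv R (z.1 * Real.exp (-2 * z.2)) := by fun_prop
  obtain ⟨C, hC⟩ := ((isCompact_closedBall q 1).prod
    (isCompact_uIcc (a := (0 : ℝ)) (b := Real.log 2))).exists_bound_of_continuousOn
      hcont.continuousOn
  refine (intervalIntegral.hasDerivAt_integral_of_dominated_loc_of_deriv_le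
    (F' := fun q τ => Real.exp ((c - 2) * τ) * deriv R (q * Real.exp (-2 * τ)))
    (s := Metric.closedBall q 1) (bound := fun _ => C)
    (Metric.closedBall_mem_nhds q one_pos) ?_ ?_ ?_ ?_ ?_ ?_).2
  · exact Eventually.of_forall fun x => Continuous.aestronglyMeasurable (by fun_prop)
  · exact Continuous.intervalIntegrable (by fun_prop) _ _
  · exact Continuous.aestronglyMeasurable (by fun_prop)
  · refine Eventually.of_forall fun τ hτ x hx => hC (x, τ) ⟨hx, uIoc_subset_uIcc hτ⟩
  · exact intervalIntegrable_const
  · refine Eventually.of_forall fun τ _ x _ => ?_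
    have h1 : HasDerivAt (fun x : ℝ => x * Real.exp (-2 * τ)) (Real.exp (-2 * τ)) x := by
      simpa using (hasDerivAt_id x).mul_const (Real.exp (-2 * τ))
    have h2 : HasDerivAt R (deriv R (x * Real.exp (-2 * τ))) (x * Real.exp (-2 * τ)) :=
      (hR.differentiable one_ne_zero _).hasDerivAt
    have h3 := (h2.comp x h1).const_mul (Real.exp (c * τ))
    refine h3.congr_deriv ?_
    rw [show (c - 2) * τ = c * τ + -2 * τ by ring, Real.exp_add]; ring

theorem contDiff_scaleAvg (c : ℝ) {R : ℝ → ℝ} (hR : ContDiff ℝ ∞ R) :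
    ContDiff ℝ ∞ (scaleAvg c R) := by
  rw [contDiff_infty]
  intro m
  induction m generalizing c R with
  | zero =>
    exact contDiff_zero.2 (continuous_iff_continuousAt.2 fun q =>
      (hasDerivAt_scaleAvg c (hR.of_le (by exact_mod_cast le_top)) q).continuousAt)
  | succ m ih =>
    have h1 : ContDiff ℝ 1 R := hR.of_le (by exact_mod_cast le_top)
    have hR' : ContDiff ℝ ∞ (deriv R) := (contDiff_infty_iff_deriv.1 hR).2
    have hd : deriv (scaleAvg c R) = scaleAvg (c - 2) (deriv R) :=
      funext fun q => (hasDerivAt_scaleAvg c h1 q).deriv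
    push_cast
    rw [contDiff_succ_iff_deriv]
    refine ⟨fun q => (hasDerivAt_scaleAvg c h1 q).differentiableAt, by simp, ?_⟩
    rw [hd]
    exact ih _ hR'

variable {d : ℕ}

theorem contDiff_sq {n : WithTop ℕ∞} : ContDiff ℝ n (sq (d := d)) := by
  unfold sq; fun_prop

theorem sq_smul (c : ℝ) (x : Fin d → ℝ) : sq (c • x) = c ^ 2 * sq x := by
  simp [sq, Finset.mul_sum, mul_pow]

theorem isCompact_sq_le (r : ℝ) : IsCompact {x : Fin d → ℝ | sq x ≤ r} := by
  refine Metric.isCompact_of_isClosed_isBounded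
    (isClosed_le (contDiff_sq (n := 0)).continuous continuous_const) ?_
  refine (Metric.isBounded_closedBall (x := 0) (r := |r| + 1)).subset fun x hx => ?_
  rw [mem_closedBall_zero_iff]
  refine (pi_norm_le_iff_of_nonneg (by positivity)).2 fun i => ?_
  have h1 : x i ^ 2 ≤ sq x :=
    Finset.single_le_sum (f := fun i => x i ^ 2) (fun j _ => _root_.sq_nonneg _) (Finset.mem_univ i)
  have h2 : sq x ≤ r := hx
  rw [Real.norm_eq_abs]
  nlinarith [sq_abs (x i), abs_nonneg (x i), abs_nonneg r, le_abs_self r, sq_nonneg (|x i| - 1)]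

theorem hasCompactSupport_of_sq {f : (Fin d → ℝ) → ℝ} {r : ℝ} (h : ∀ x, r < sq x → f x = 0) :
    HasCompactSupport f :=
  HasCompactSupport.intro (isCompact_sq_le r) fun x hx => h x (not_le.1 hx)

theorem hasFDerivAt_sq (x : Fin d → ℝ) :
    HasFDerivAt sq (∑ i, (2 * x i) • ContinuousLinearMap.proj (R := ℝ) (φ := fun _ : Fin d => ℝ) i)
      x := by
  unfold sq
  refine HasFDerivAt.fun_sum fun i _ => ?_
  have := (hasFDerivAt_apply (𝕜 := ℝ) (F' := fun _ : Fin d => ℝ) i x).pow 2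
  simpa using this

theorem pd_comp_sq {a : ℝ → ℝ} {a' : ℝ} {x : Fin d → ℝ} (ha : HasDerivAt a a' (sq x))
    (i : Fin d) : pd i (fun y => a (sq y)) x = a' * (2 * x i) := by
  have h := ha.comp_hasFDerivAt x (hasFDerivAt_sq x)
  unfold pd
  rw [show (fun y => a (sq y)) = a ∘ sq from rfl, h.fderiv]
  simp [Pi.single_apply]

theorem pd_pd_comp_sq {a : ℝ → ℝ} (ha : ContDiff ℝ 2 a) (x : Fin d → ℝ) (i : Fin d) :
    pd i (pd i fun y => a (sq y)) x
      = 2 * deriv a (sq x) + 4 * x i ^ 2 * deriv (deriv a) (sq x) := by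
  have ha1 : ContDiff ℝ 1 (deriv a) := ((contDiff_succ_iff_deriv (n := 1)).1 ha).2.2
  have h1 : (pd i fun y => a (sq y)) = fun y : Fin d → ℝ => deriv a (sq y) * (2 * y i) :=
    funext fun y => pd_comp_sq (ha.differentiable two_ne_zero _).hasDerivAt i
  rw [h1]
  have h2 := (ha1.differentiable one_ne_zero (sq x)).hasDerivAt.comp_hasFDerivAt x
    (hasFDerivAt_sq x)
  have h3 := (hasFDerivAt_apply (𝕜 := ℝ) (F' := fun _ : Fin d => ℝ) i x).const_mul 2
  have h4 := h2.mul h3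
  unfold pd
  rw [show (fun y : Fin d → ℝ => deriv a (sq y) * (2 * y i))
    = (deriv a ∘ sq) * (fun y => 2 * y i) from rfl, h4.fderiv]
  simp [Pi.single_apply]
  ring

/-- The Laplacian. -/
def lap (f : (Fin d → ℝ) → ℝ) (x : Fin d → ℝ) : ℝ := ∑ i, pd i (pd i f) x

/-- For the weight exponent `2 - d` the Laplacian of the integrand is an exact `τ`-derivative, that
of `-2 e^{-dτ} R'(|x|² e^{-2τ})`. Integrating over one octave of scales leaves only the endpoint
terms. -/
theorem lap_comp_sq_scaleAvg {R : ℝ → ℝ} (hR : ContDiff ℝ ∞ R) (x : Fin d → ℝ) :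
    lap (fun y => scaleAvg (2 - d) R (sq y)) x
      = (1 / 2 : ℝ) ^ d * (-2 * deriv R (sq ((1 / 2 : ℝ) • x))) - -2 * deriv R (sq x) := by
  have hR1 : ContDiff ℝ ∞ (deriv R) := (contDiff_infty_iff_deriv.1 hR).2
  have hR2 : ContDiff ℝ ∞ (deriv (deriv R)) := (contDiff_infty_iff_deriv.1 hR1).2
  have e1 : (1 : WithTop ℕ∞) ≤ (∞ : WithTop ℕ∞) := by exact_mod_cast le_top
  have e2 : (2 : WithTop ℕ∞) ≤ (∞ : WithTop ℕ∞) := by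
    exact WithTop.coe_le_coe.2 (le_top : (2 : ℕ∞) ≤ ⊤)
  have hd1 : deriv (scaleAvg (2 - d) R) = scaleAvg (2 - d - 2) (deriv R) :=
    funext fun q => (hasDerivAt_scaleAvg _ (hR.of_le e1) q).deriv
  have hd2 : deriv (deriv (scaleAvg (2 - d) R)) = scaleAvg (2 - d - 2 - 2) (deriv (deriv R)) := by
    rw [hd1]; exact funext fun q => (hasDerivAt_scaleAvg _ (hR1.of_le e1) q).deriv
  have hc1 := hR1.continuous
  have hc2 := hR2.continuous
  unfold lap
  simp_rw [pd_pd_comp_sq ((contDiff_scaleAvg (2 - d) hR).of_le e2)]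
  rw [Finset.sum_add_distrib, hd2, hd1, ← Finset.sum_mul, ← Finset.sum_mul,
    ← Finset.mul_sum]
  simp only [Finset.sum_const, Finset.card_univ, Fintype.card_fin, nsmul_eq_mul]
  change _ + 4 * sq x * _ = _
  set q := sq x
  rw [scaleAvg, scaleAvg, ← mul_assoc, ← intervalIntegral.integral_const_mul,
    ← intervalIntegral.integral_const_mul, ← intervalIntegral.integral_add
      (Continuous.intervalIntegrable (by fun_prop) _ _)
      (Continuous.intervalIntegrable (by fun_prop) _ _)]
  have key : ∀ τ ∈ uIcc (0 : ℝ) (Real.log 2), HasDerivAt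
      (fun τ => Real.exp (-d * τ) * (-2 * deriv R (q * Real.exp (-2 * τ))))
      (d * 2 * (Real.exp ((2 - d - 2) * τ) * deriv R (q * Real.exp (-2 * τ))) +
        4 * q * (Real.exp ((2 - d - 2 - 2) * τ) * deriv (deriv R) (q * Real.exp (-2 * τ)))) τ := by
    intro τ _
    have h0 : ∀ c : ℝ, HasDerivAt (fun τ => Real.exp (c * τ)) (Real.exp (c * τ) * c) τ := fun c => by
      simpa using ((hasDerivAt_id τ).const_mul c).exp
    have h1 : HasDerivAt (fun τ => q * Real.exp (-2 * τ)) (q * (Real.exp (-2 * τ) * -2)) τ :=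
      (h0 (-2)).const_mul q
    have h2 := ((hR1.differentiable (by simp) (q * Real.exp (-2 * τ))).hasDerivAt.comp τ
      h1).const_mul (-2)
    refine ((h0 (-d)).mul h2).congr_deriv ?_
    rw [show ((2 : ℝ) - d - 2 - 2) * τ = -d * τ + -2 * τ by ring,
      show ((2 : ℝ) - d - 2) * τ = -d * τ by ring, Real.exp_add]
    simp only [Function.comp]
    ring
  rw [intervalIntegral.integral_eq_sub_of_hasDerivAt key
    (Continuous.intervalIntegrable (by fun_prop) _ _)]
  have e3 : Real.exp (-d * Real.log 2) = (1 / 2 : ℝ) ^ d := by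
    rw [show -(d : ℝ) * Real.log 2 = d * (-Real.log 2) by ring, Real.exp_nat_mul, Real.exp_neg,
      Real.exp_log two_pos]
    norm_num
  have e4 : Real.exp (-2 * Real.log 2) = (1 / 2 : ℝ) ^ 2 := by
    rw [show (-2 : ℝ) * Real.log 2 = (2 : ℕ) * (-Real.log 2) by push_cast; ring, Real.exp_nat_mul,
      Real.exp_neg, Real.exp_log two_pos]
    norm_num
  rw [e3, e4, sq_smul, mul_comm q]
  simp only [mul_zero, Real.exp_zero, one_mul, mul_one, q]
  ring

/-- There are a smooth compactly supported mollifier `η` and a smooth compactly supported `B` whose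
Laplacian is the difference of two consecutive dyadic rescalings of `η`. -/
theorem exists_kernel (hd : 0 < d) : ∃ η B : (Fin d → ℝ) → ℝ,
    ContDiff ℝ ∞ η ∧ ContDiff ℝ ∞ B ∧ HasCompactSupport η ∧ HasCompactSupport B ∧ ∫ x, η x = 1 ∧
      ∀ x, lap B x = (1 / 2 : ℝ) ^ d * η ((1 / 2 : ℝ) • x) - η x := by
  -- `R` decreases from 1 on `q ≤ 1` to 0 on `q ≥ 2`, so `-2 R'(|x|²)` is nonnegative and compactly
  -- supported.
  set R : ℝ → ℝ := fun q => Real.smoothTransition (2 - q) with hRdef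
  have hR : ContDiff ℝ ∞ R := Real.smoothTransition.contDiff.comp (contDiff_const.sub contDiff_id)
  have hR1 : ContDiff ℝ ∞ (deriv R) := (contDiff_infty_iff_deriv.1 hR).2
  have hR0 : ∀ q, 2 ≤ q → R q = 0 := fun q hq =>
    Real.smoothTransition.zero_of_nonpos (by linarith)
  have hanti : Antitone R := fun a b hab => Real.smoothTransition.monotone (by linarith)
  set η₀ : (Fin d → ℝ) → ℝ := fun x => -2 * deriv R (sq x) with hη₀
  set B₀ : (Fin d → ℝ) → ℝ := fun x => scaleAvg (2 - d) R (sq x) with hB₀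
  have hη : ContDiff ℝ ∞ η₀ := contDiff_const.mul (hR1.comp contDiff_sq)
  have hB : ContDiff ℝ ∞ B₀ := (contDiff_scaleAvg _ hR).comp contDiff_sq
  have hηs : HasCompactSupport η₀ := by
    refine hasCompactSupport_of_sq (r := 2) fun x hx => ?_
    have : R =ᶠ[𝓝 (sq x)] fun _ => 0 := by
      filter_upwards [lt_mem_nhds hx] with q hq using hR0 q hq.le
    simp [hη₀, this.deriv_eq]
  have hBs : HasCompactSupport B₀ := by
    -- For `τ ≤ log 2` the argument of `R` is at least `sq x / 4`, and `R` vanishes from 2 onwards.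
    refine hasCompactSupport_of_sq (r := 8) fun x hx => ?_
    rw [hB₀]
    refine (intervalIntegral.integral_congr fun τ hτ => ?_).trans intervalIntegral.integral_zero
    have hl : 0 ≤ Real.log 2 := Real.log_nonneg one_le_two
    rw [uIcc_of_le hl] at hτ
    have h1 : Real.exp (-2 * Real.log 2) ≤ Real.exp (-2 * τ) :=
      Real.exp_le_exp.2 (by linarith [hτ.2])
    have e4 : Real.exp (-2 * Real.log 2) = (1 / 2 : ℝ) ^ 2 := by
      rw [show (-2 : ℝ) * Real.log 2 = (2 : ℕ) * (-Real.log 2) by push_cast; ring,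
        Real.exp_nat_mul, Real.exp_neg, Real.exp_log two_pos]
      norm_num
    change Real.exp _ * R _ = 0
    rw [hR0, mul_zero]
    nlinarith
  have hη_nonneg : ∀ x, 0 ≤ η₀ x := fun x => by
    have : deriv R (sq x) ≤ 0 := hanti.deriv_nonpos
    simp only [hη₀]; linarith
  -- The derivative cannot vanish on all of `[0, 2]` since `R 0 = 1` and `R 2 = 0`. As `d > 0`, such
  -- a `q` is attained by `sq`, so the unnormalised mollifier is not zero.
  obtain ⟨q, hq, hq'⟩ : ∃ q : ℝ, 0 ≤ q ∧ deriv R q ≠ 0 := by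
    by_contra! h
    have : R 0 = R 2 := by
      have := (convex_Icc (0 : ℝ) 2).is_const_of_fderivWithin_eq_zero (𝕜 := ℝ) (f := R)
        (hR.differentiable (by simp)).differentiableOn (fun x hx => ?_)
        (left_mem_Icc.2 zero_le_two) (right_mem_Icc.2 zero_le_two)
      · exact this
      · rw [fderivWithin_eq_fderiv (uniqueDiffOn_Icc two_pos x hx)
          (hR.differentiable (by simp) x)]
        ext; simp [h x hx.1]
    rw [hR0 2 le_rfl] at this
    simp [hRdef, Real.smoothTransition.one_of_one_le one_le_two] at this
  have hne : η₀ ≠ 0 := by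
    intro h
    have h1 := congrFun h (Pi.single ⟨0, hd⟩ (√q))
    have h2 : sq (Pi.single ⟨0, hd⟩ (√q) : Fin d → ℝ) = q := by
      rw [sq, Finset.sum_eq_single ⟨0, hd⟩]
      · simp [Real.sq_sqrt hq]
      · intro j _ hj; simp [Pi.single_eq_of_ne hj]
      · simp
    simp only [hη₀, h2, Pi.zero_apply] at h1
    exact hq' (by linarith)
  obtain ⟨x₀, hx₀⟩ := Function.ne_iff.1 hne
  have hpos : 0 < ∫ x, η₀ x := hη.continuous.integral_pos_of_hasCompactSupport_nonneg_nonzero hηs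
    hη_nonneg hx₀
  set c := ∫ x, η₀ x
  refine ⟨fun x => c⁻¹ * η₀ x, fun x => c⁻¹ * B₀ x, contDiff_const.mul hη, contDiff_const.mul hB,
    hηs.mul_left, hBs.mul_left, ?_, fun x => ?_⟩
  · rw [integral_const_mul, inv_mul_cancel₀ hpos.ne']
  · have hpd : ∀ (f : (Fin d → ℝ) → ℝ), Differentiable ℝ f → ∀ i,
        pd i (fun x => c⁻¹ * f x) = fun x => c⁻¹ * pd i f x := fun f hf i => by
      funext y; simp [pd, fderiv_const_mul (hf y)]
    have hdiff : ∀ i, Differentiable ℝ (pd i B₀) := fun i =>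
      ((hB.fderiv_right (m := ∞) (by simp)).clm_apply contDiff_const).differentiable (by simp)
    have : lap (fun x => c⁻¹ * B₀ x) x = c⁻¹ * lap B₀ x := by
      simp only [lap, Finset.mul_sum]
      refine Finset.sum_congr rfl fun i _ => ?_
      rw [hpd _ (hB.differentiable (by simp)), hpd _ (hdiff i)]
    rw [this, lap_comp_sq_scaleAvg hR]
    simp only [hη₀]; ring

end PowerLawStokes

end

noncomputable section

namespace PowerLawStokes

variable {d : ℕ}

/-! ### Test functions and convolution -/

/-- Smooth compactly supported functions. -/
structure IsTest (A : (Fin d → ℝ) → ℝ) : Prop where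
  smooth : ContDiff ℝ ∞ A
  compact : HasCompactSupport A

/-- Measurable functions bounded by `b`. -/
structure IsBdd (b : ℝ) (f : (Fin d → ℝ) → ℝ) : Prop where
  meas : Measurable f
  le : ∀ x, |f x| ≤ b

theorem IsBdd.nonneg {b : ℝ} {f : (Fin d → ℝ) → ℝ} (hf : IsBdd b f) : 0 ≤ b :=
  (abs_nonneg _).trans (hf.le 0)

theorem IsBdd.locallyIntegrable {b : ℝ} {f : (Fin d → ℝ) → ℝ} (hf : IsBdd b f) :
    LocallyIntegrable f := by
  intro x
  refine ⟨Metric.ball x 1, Metric.ball_mem_nhds x one_pos, ?_⟩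
  exact Measure.integrableOn_of_bounded (M := b) measure_ball_lt_top.ne
    hf.meas.aestronglyMeasurable (Eventually.of_forall fun x => hf.le x)

theorem IsBdd.comp {b : ℝ} {f : (Fin d → ℝ) → ℝ} (hf : IsBdd b f)
    {φ : (Fin d → ℝ) → Fin d → ℝ} (hφ : Measurable φ) : IsBdd b fun x => f (φ x) :=
  ⟨hf.meas.comp hφ, fun _ => hf.le _⟩

theorem contDiff_pd {f : (Fin d → ℝ) → ℝ} (hf : ContDiff ℝ ∞ f) (i : Fin d) :
    ContDiff ℝ ∞ (pd i f) :=
  (hf.fderiv_right (m := ∞) (by simp)).clm_apply contDiff_const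

theorem continuous_pd {f : (Fin d → ℝ) → ℝ} (hf : ContDiff ℝ 1 f) (i : Fin d) :
    Continuous (pd i f) :=
  (hf.continuous_fderiv one_ne_zero).clm_apply continuous_const

theorem hasCompactSupport_pd {f : (Fin d → ℝ) → ℝ} (hf : HasCompactSupport f) (i : Fin d) :
    HasCompactSupport (pd i f) :=
  hf.fderiv_apply ℝ _

theorem IsTest.pd {A : (Fin d → ℝ) → ℝ} (hA : IsTest A) (i : Fin d) : IsTest (pd i A) :=
  ⟨contDiff_pd hA.smooth i, hasCompactSupport_pd hA.compact i⟩

theorem IsTest.differentiable {A : (Fin d → ℝ) → ℝ} (hA : IsTest A) : Differentiable ℝ A :=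
  hA.smooth.differentiable (by simp)

theorem IsTest.continuous {A : (Fin d → ℝ) → ℝ} (hA : IsTest A) : Continuous A :=
  hA.smooth.continuous

theorem IsTest.integrable {A : (Fin d → ℝ) → ℝ} (hA : IsTest A) : Integrable A :=
  hA.continuous.integrable_of_hasCompactSupport hA.compact

theorem IsTest.const_mul {A : (Fin d → ℝ) → ℝ} (hA : IsTest A) (c : ℝ) :
    IsTest fun x => c * A x :=
  ⟨contDiff_const.mul hA.smooth, hA.compact.mul_left⟩

theorem IsTest.add {A B : (Fin d → ℝ) → ℝ} (hA : IsTest A) (hB : IsTest B) :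
    IsTest fun x => A x + B x :=
  ⟨hA.smooth.add hB.smooth, hA.compact.add hB.compact⟩

theorem IsTest.sum {ι : Type*} (s : Finset ι) {A : ι → (Fin d → ℝ) → ℝ}
    (hA : ∀ k, IsTest (A k)) : IsTest fun x => ∑ k ∈ s, A k x := by
  classical
  induction s using Finset.induction_on with
  | empty => exact ⟨by simpa using contDiff_const, .of_support_subset_isCompact isCompact_empty (by simp)⟩
  | insert k s hk ih =>
    simp_rw [Finset.sum_insert hk]
    exact (hA k).add ih

theorem IsTest.comp_affine {A : (Fin d → ℝ) → ℝ} (hA : IsTest A) {c : ℝ} (hc : c ≠ 0)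
    (x₀ : Fin d → ℝ) : IsTest fun z => A (c • z + x₀) :=
  ⟨hA.smooth.comp (by fun_prop),
    hA.compact.comp_homeomorph ((Homeomorph.smulOfNeZero c hc).trans (Homeomorph.addRight x₀))⟩

theorem pd_const_mul {f : (Fin d → ℝ) → ℝ} (hf : Differentiable ℝ f) (c : ℝ) (i : Fin d) :
    (pd i fun x => c * f x) = fun x => c * pd i f x := by
  funext y; simp [pd, fderiv_const_mul (hf y)]

theorem pd_sum {ι : Type*} (s : Finset ι) {f : ι → (Fin d → ℝ) → ℝ}
    (hf : ∀ k, Differentiable ℝ (f k)) (i : Fin d) :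
    (pd i fun x => ∑ k ∈ s, f k x) = fun x => ∑ k ∈ s, pd i (f k) x := by
  funext y
  simp only [pd]
  rw [fderiv_fun_sum fun k _ => hf k y]
  simp

theorem pd_comp_affine {f : (Fin d → ℝ) → ℝ} (hf : Differentiable ℝ f) (c : ℝ)
    (x₀ : Fin d → ℝ) (i : Fin d) :
    (pd i fun z => f (c • z + x₀)) = fun z => c * pd i f (c • z + x₀) := by
  funext z
  have h1 : HasFDerivAt (fun z : Fin d → ℝ => c • z + x₀)
      (c • ContinuousLinearMap.id ℝ (Fin d → ℝ)) z :=
    ((hasFDerivAt_id z).const_smul c).add_const x₀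
  have h2 := (hf (c • z + x₀)).hasFDerivAt.comp z h1
  unfold pd
  rw [show (fun z => f (c • z + x₀)) = f ∘ fun z => c • z + x₀ from rfl, h2.fderiv]
  simp

theorem pd_pd_comp_affine {f : (Fin d → ℝ) → ℝ} (hf : IsTest f) (c : ℝ)
    (x₀ : Fin d → ℝ) (i j : Fin d) :
    (pd i (pd j fun z => f (c • z + x₀))) = fun z => c ^ 2 * pd i (pd j f) (c • z + x₀) := by
  rw [pd_comp_affine hf.differentiable]
  have h := (hf.pd j).differentiable
  rw [pd_const_mul (f := fun z => pd j f (c • z + x₀)) (h.comp (by fun_prop)),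
    pd_comp_affine h]
  funext z; ring

theorem pd_comm {f : (Fin d → ℝ) → ℝ} (hf : ContDiff ℝ ∞ f) (i j : Fin d) :
    pd i (pd j f) = pd j (pd i f) := by
  funext x
  have h2 : ContDiffAt ℝ 2 f x := (hf.of_le (WithTop.coe_le_coe.2 (le_top : (2 : ℕ∞) ≤ ⊤))).contDiffAt
  have hs := h2.isSymmSndFDerivAt (by simp)
  have hd : DifferentiableAt ℝ (fderiv ℝ f) x :=
    (hf.fderiv_right (m := ∞) (by simp)).differentiable (by simp) x
  have key : ∀ i j : Fin d, pd i (pd j f) x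
      = fderiv ℝ (fderiv ℝ f) x (Pi.single i 1) (Pi.single j 1) := fun i j => by
    unfold pd
    rw [fderiv_clm_apply hd (differentiableAt_const _)]
    simp
  rw [key, key]
  exact hs _ _

theorem integrable_mul_of_compact {f g : (Fin d → ℝ) → ℝ} (hf : LocallyIntegrable f)
    (hg : Continuous g) (hgs : HasCompactSupport g) : Integrable fun x => f x * g x := by
  simpa [mul_comm] using hf.integrable_smul_left_of_hasCompactSupport hg hgs

theorem integral_mul_pd {f g : (Fin d → ℝ) → ℝ} (hf : ContDiff ℝ 1 f) (hg : ContDiff ℝ 1 g)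
    (hgs : HasCompactSupport g) (i : Fin d) :
    ∫ x, f x * pd i g x = -∫ x, pd i f x * g x := by
  refine integral_mul_fderiv_eq_neg_fderiv_mul_of_integrable ?_ ?_ ?_
    (fun x _ => hf.differentiable one_ne_zero x) (fun x _ => hg.differentiable one_ne_zero x)
  · exact integrable_mul_of_compact (continuous_pd hf i).locallyIntegrable hg.continuous hgs
  · exact integrable_mul_of_compact hf.continuous.locallyIntegrable (continuous_pd hg i)
      (hasCompactSupport_pd hgs i)
  · exact integrable_mul_of_compact hf.continuous.locallyIntegrable hg.continuous hgs

theorem one_le_infty : (1 : WithTop ℕ∞) ≤ (∞ : WithTop ℕ∞) := by exact_mod_cast le_top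

theorem IsTest.contDiff_one {A : (Fin d → ℝ) → ℝ} (hA : IsTest A) : ContDiff ℝ 1 A :=
  hA.smooth.of_le one_le_infty

/-- The convolution of `f` with the kernel `g`. -/
def conv (g f : (Fin d → ℝ) → ℝ) (x : Fin d → ℝ) : ℝ := ∫ z, f z * g (x - z)

theorem conv_eq (g f : (Fin d → ℝ) → ℝ) :
    conv g f = convolution f g (ContinuousLinearMap.mul ℝ ℝ) volume := rfl

theorem contDiff_conv {g f : (Fin d → ℝ) → ℝ} (hg : IsTest g) (hf : LocallyIntegrable f) :
    ContDiff ℝ ∞ (conv g f) :=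
  hg.compact.contDiff_convolution_right (ContinuousLinearMap.mul ℝ ℝ) hf hg.smooth

theorem pd_conv {g f : (Fin d → ℝ) → ℝ} (hg : IsTest g) (hf : LocallyIntegrable f) (i : Fin d) :
    pd i (conv g f) = conv (pd i g) f := by
  funext x
  have h := hg.compact.hasFDerivAt_convolution_right (ContinuousLinearMap.mul ℝ ℝ) hf
    hg.contDiff_one x
  unfold pd
  rw [conv_eq, h.fderiv, convolution_precompR_apply _ hf (hg.compact.fderiv ℝ)
    (hg.contDiff_one.continuous_fderiv one_ne_zero)]
  rfl

theorem integrable_conv {g f : (Fin d → ℝ) → ℝ} (hg : IsTest g) (hf : LocallyIntegrable f)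
    (x : Fin d → ℝ) : Integrable fun z => f z * g (x - z) :=
  hg.compact.convolutionExists_right (ContinuousLinearMap.mul ℝ ℝ) hf hg.continuous x

theorem isTest_conv {g f : (Fin d → ℝ) → ℝ} (hg : IsTest g) (hf : LocallyIntegrable f)
    (hfs : HasCompactSupport f) : IsTest (conv g f) :=
  ⟨contDiff_conv hg hf, hfs.convolution (ContinuousLinearMap.mul ℝ ℝ) hg.compact⟩

theorem conv_sum {ι : Type*} (s : Finset ι) {g : ι → (Fin d → ℝ) → ℝ} {f : (Fin d → ℝ) → ℝ}
    (hg : ∀ k, IsTest (g k)) (hf : LocallyIntegrable f) (x : Fin d → ℝ) :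
    conv (fun z => ∑ k ∈ s, g k z) f x = ∑ k ∈ s, conv (g k) f x := by
  simp only [conv, Finset.mul_sum]
  exact integral_finsetSum _ fun k _ => integrable_conv (hg k) hf x

theorem conv_sub {g h f : (Fin d → ℝ) → ℝ} (hg : IsTest g) (hh : IsTest h)
    (hf : LocallyIntegrable f) (x : Fin d → ℝ) :
    conv (fun z => g z - h z) f x = conv g f x - conv h f x := by
  simp only [conv, mul_sub]
  exact integral_sub (integrable_conv hg hf x) (integrable_conv hh hf x)

theorem abs_conv_le {g f : (Fin d → ℝ) → ℝ} {b : ℝ} (hg : IsTest g) (hf : IsBdd b f)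
    (x : Fin d → ℝ) : |conv g f x| ≤ b * ∫ z, |g z| := by
  have h1 : |conv g f x| ≤ ∫ z, b * |g (x - z)| := by
    refine (abs_integral_le_integral_abs (f := fun z => f z * g (x - z))).trans
      (integral_mono_of_nonneg (Eventually.of_forall fun z => abs_nonneg _) ?_
        (Eventually.of_forall fun z => ?_))
    · exact ((hg.integrable.comp_sub_left x).abs).const_mul b
    · simp only [abs_mul]
      exact mul_le_mul_of_nonneg_right (hf.le z) (abs_nonneg _)
  rwa [integral_const_mul, integral_sub_left_eq_self (fun z => |g z|)] at h1

/-- All derivatives fall on the kernel, so `∑ᵢ ‖∂ᵢg‖_{L¹}` works and only the supremum of `f`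
enters. -/
theorem exists_lipschitz_conv {g : (Fin d → ℝ) → ℝ} (hg : IsTest g) : ∃ C : ℝ, 0 ≤ C ∧
    ∀ (b : ℝ) (f : (Fin d → ℝ) → ℝ), IsBdd b f → ∀ x y,
      |conv g f x - conv g f y| ≤ C * b * ‖x - y‖ := by
  have hc : ∀ i, IsTest (pd i g) := hg.pd
  refine ⟨∑ i, ∫ z, |pd i g z|, Finset.sum_nonneg fun i _ => integral_nonneg fun _ => abs_nonneg _,
    fun b f hf x y => ?_⟩
  have hs := contDiff_conv hg hf.locallyIntegrable
  have := Convex.norm_image_sub_le_of_norm_fderiv_le (𝕜 := ℝ) (f := conv g f) (s := univ)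
    (C := (∑ i, ∫ z, |pd i g z|) * b) (fun z _ => hs.differentiable (by simp) z) (fun z _ => ?_)
    convex_univ (mem_univ y) (mem_univ x)
  · simpa [Real.norm_eq_abs] using this
  · refine ContinuousLinearMap.opNorm_le_bound _
      (mul_nonneg (Finset.sum_nonneg fun i _ => integral_nonneg fun _ => abs_nonneg _) hf.nonneg)
      fun v => ?_
    have hv : v = ∑ i, v i • (Pi.single i 1 : Fin d → ℝ) := by
      funext j; simp [Finset.sum_apply, Pi.single_apply]
    conv_lhs => rw [hv]
    rw [map_sum, Finset.sum_mul, Finset.sum_mul]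
    refine (norm_sum_le _ _).trans (Finset.sum_le_sum fun i _ => ?_)
    rw [map_smul, norm_smul]
    have h1 : ‖fderiv ℝ (conv g f) z (Pi.single i 1)‖ ≤ b * ∫ z, |pd i g z| := by
      have := abs_conv_le (hc i) hf z
      rwa [← pd_conv hg hf.locallyIntegrable] at this
    have h2 : ‖v i‖ ≤ ‖v‖ := norm_le_pi_norm v i
    calc ‖v i‖ * _ ≤ ‖v‖ * (b * ∫ z, |pd i g z|) :=
          mul_le_mul h2 h1 (norm_nonneg _) (norm_nonneg _)
      _ = _ := by ring

/-! ### Dilations and approximate identities -/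

/-- The `L¹`-normalised dilation of `g`. -/
def dil (c : ℝ) (g : (Fin d → ℝ) → ℝ) (z : Fin d → ℝ) : ℝ := c ^ d * g (c • z)

theorem IsTest.dil {g : (Fin d → ℝ) → ℝ} (hg : IsTest g) {c : ℝ} (hc : c ≠ 0) :
    IsTest (dil c g) := by
  have h := (hg.comp_affine hc 0).const_mul (c ^ d)
  simp only [add_zero] at h
  exact h

theorem dil_one (g : (Fin d → ℝ) → ℝ) : dil 1 g = g := by funext z; simp [dil]

theorem integral_dil (g : (Fin d → ℝ) → ℝ) {c : ℝ} (hc : 0 < c) :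
    ∫ z, dil c g z = ∫ z, g z := by
  simp only [dil]
  rw [integral_const_mul, Measure.integral_comp_smul]
  simp only [Module.finrank_fintype_fun_eq_card, Fintype.card_fin, smul_eq_mul]
  rw [abs_of_pos (by positivity), ← mul_assoc, mul_inv_cancel₀ (by positivity), one_mul]

/-- Rescaling a bounded function keeps its bound, so this identity carries unit-scale estimates to
every scale. -/
theorem conv_dil (g f : (Fin d → ℝ) → ℝ) {c : ℝ} (hc : 0 < c) (x : Fin d → ℝ) :
    conv (dil c g) f x = conv g (fun w => f (c⁻¹ • w)) (c • x) := by
  have h := integral_dil (fun w => f (c⁻¹ • w) * g (c • x - w)) hc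
  unfold conv
  rw [← h]
  congr 1
  funext z
  simp only [dil]
  rw [smul_smul, inv_mul_cancel₀ hc.ne', one_smul, ← smul_sub]
  ring

theorem abs_dil (g : (Fin d → ℝ) → ℝ) {c : ℝ} (hc : 0 < c) (z : Fin d → ℝ) :
    |dil c g z| = dil c (fun z => |g z|) z := by
  simp [dil, abs_mul, abs_of_pos hc]

/-- `L²` identity for second derivatives. -/
theorem sum_integral_pd_pd_sq {w : (Fin d → ℝ) → ℝ} (hw : IsTest w) :
    ∑ i, ∑ j, ∫ x, pd i (pd j w) x ^ 2 = ∫ x, lap w x ^ 2 := by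
  have hint : ∀ i j, Integrable fun x => pd i (pd i w) x * pd j (pd j w) x := fun i j =>
    integrable_mul_of_compact ((hw.pd i).pd i).continuous.locallyIntegrable
      ((hw.pd j).pd j).continuous ((hw.pd j).pd j).compact
  have key : ∀ i j, ∫ x, pd i (pd j w) x ^ 2 = ∫ x, pd i (pd i w) x * pd j (pd j w) x := by
    intro i j
    -- One integration by parts on each side leads to the same integral of a third derivative of `w`
    -- against `∂ⱼw`.
    have e1 := integral_mul_pd ((hw.pd j).pd i).contDiff_one (hw.pd j).contDiff_one
      (hw.pd j).compact i
    have e2 := integral_mul_pd ((hw.pd i).pd i).contDiff_one (hw.pd j).contDiff_one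
      (hw.pd j).compact j
    have e3 : pd i (pd i (pd j w)) = pd j (pd i (pd i w)) := by
      rw [pd_comm hw.smooth i j, pd_comm (hw.pd i).smooth i j]
    rw [e3] at e1
    simp_rw [pow_two]
    rw [e1, e2]
  simp_rw [key]
  simp_rw [← integral_finsetSum _ fun j _ => hint _ j]
  rw [← integral_finsetSum _ fun i _ => integrable_finsetSum _ fun j _ => hint i j]
  congr 1
  funext x
  rw [lap, pow_two, Finset.sum_mul_sum]

/-- At a Lebesgue point: the dilated kernel is at most a constant times `2^{Nd}` and lives in a ball
of radius `r 2^{-N}`, so the error is at most a constant times the mean of `|f - f x|` over that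
ball. -/
theorem ae_tendsto_conv_dil {η f : (Fin d → ℝ) → ℝ} (hη : IsTest η) (h1 : ∫ z, η z = 1)
    (hf : LocallyIntegrable f) :
    ∀ᵐ x, Tendsto (fun N : ℕ => conv (dil (2 ^ N) η) f x) atTop (𝓝 (f x)) := by
  obtain ⟨r, hr, hsupp⟩ : ∃ r : ℝ, 0 < r ∧ ∀ z, η z ≠ 0 → ‖z‖ ≤ r := by
    obtain ⟨r, hr⟩ := hη.compact.isCompact.isBounded.subset_closedBall 0
    refine ⟨|r| + 1, by positivity, fun z hz => ?_⟩
    have := hr (subset_tsupport _ hz)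
    rw [mem_closedBall_zero_iff] at this
    linarith [le_abs_self r]
  obtain ⟨C, hC⟩ := hη.continuous.bounded_above_of_compact_support hη.compact
  have hC0 : 0 ≤ C := (norm_nonneg _).trans (hC 0)
  filter_upwards [IsUnifLocDoublingMeasure.ae_tendsto_average_norm_sub volume hf 1] with x hx
  have hδ : Tendsto (fun N : ℕ => r / 2 ^ N) atTop (𝓝[>] 0) := by
    refine tendsto_nhdsWithin_iff.2 ⟨?_, Eventually.of_forall fun N => by simp; positivity⟩
    exact tendsto_const_nhds.div_atTop (tendsto_pow_atTop_atTop_of_one_lt one_lt_two)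
  have hlim := hx (fun _ : ℕ => x) (fun N : ℕ => r / 2 ^ N) hδ
    (Eventually.of_forall fun N => Metric.mem_closedBall_self (by positivity))
  rw [tendsto_iff_norm_sub_tendsto_zero]
  refine squeeze_zero (g := fun N : ℕ => C * (2 * r) ^ d *
    ⨍ y in Metric.closedBall x (r / 2 ^ N), ‖f y - f x‖) (fun _ => norm_nonneg _) (fun N => ?_)
    (by simpa only [mul_zero] using hlim.const_mul (C * (2 * r) ^ d))
  have hc : (0 : ℝ) < 2 ^ N := by positivity
  set c : ℝ := 2 ^ N
  have hk := hη.dil hc.ne'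
  have e0 : ∫ z, dil c η (x - z) = 1 := by
    rw [integral_sub_left_eq_self (dil c η), integral_dil _ hc, h1]
  have e1 : conv (dil c η) f x - f x = ∫ z, (f z - f x) * dil c η (x - z) := by
    simp_rw [sub_mul]
    rw [integral_sub (integrable_conv hk hf x) ((hk.integrable.comp_sub_left x).const_mul _),
      integral_const_mul, e0, mul_one]
    rfl
  have hvol : volume.real (Metric.closedBall x (r / c)) = (2 * (r / c)) ^ d := by
    rw [measureReal_def, Real.volume_pi_closedBall _ (by positivity),
      ENNReal.toReal_ofReal (by positivity), Fintype.card_fin]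
  have hint : IntegrableOn (fun z => ‖f z - f x‖) (Metric.closedBall x (r / c)) :=
    ((hf.integrableOn_isCompact (isCompact_closedBall _ _)).sub
      (integrableOn_const (isCompact_closedBall _ _).measure_ne_top)).norm
  rw [e1]
  calc ‖∫ z, (f z - f x) * dil c η (x - z)‖
      = ‖∫ z in Metric.closedBall x (r / c), (f z - f x) * dil c η (x - z)‖ := by
        rw [setIntegral_eq_integral_of_forall_compl_eq_zero]
        intro z hz
        have : η (c • (x - z)) = 0 := by
          by_contra h
          have := hsupp _ h
          rw [norm_smul, Real.norm_eq_abs, abs_of_pos hc] at this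
          apply hz
          rw [Metric.mem_closedBall, dist_comm, dist_eq_norm, le_div_iff₀ hc, mul_comm]
          exact this
        simp [dil, this]
    _ ≤ ∫ z in Metric.closedBall x (r / c), c ^ d * C * ‖f z - f x‖ := by
        refine norm_integral_le_of_norm_le (hint.const_mul _) (Eventually.of_forall fun z => ?_)
        rw [norm_mul, mul_comm, dil, norm_mul, Real.norm_of_nonneg (by positivity : 0 ≤ c ^ d)]
        gcongr
        exact hC _
    _ = _ := by
        rw [integral_const_mul, setAverage_eq, smul_eq_mul, hvol,
          show (2 * (r / c)) ^ d = (2 * r) ^ d / c ^ d by rw [← div_pow]; ring, inv_div]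
        field_simp

end PowerLawStokes

end

noncomputable section

namespace PowerLawStokes

variable {d : ℕ}

/-! ### Cubes -/

theorem measurableSet_cube (a : Fin d → ℝ) (l : ℝ) : MeasurableSet (cube a l) :=
  MeasurableSet.univ_pi fun _ => measurableSet_Ico

theorem volume_cube (a : Fin d → ℝ) (l : ℝ) : volume (cube a l) = ENNReal.ofReal l ^ d := by
  rw [cube, volume_pi_pi]; simp

theorem volume_real_cube (a : Fin d → ℝ) {l : ℝ} (hl : 0 ≤ l) :
    volume.real (cube a l) = l ^ d := by
  rw [measureReal_def, volume_cube, ENNReal.toReal_pow, ENNReal.toReal_ofReal hl]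

theorem volume_cube_ne_top (a : Fin d → ℝ) (l : ℝ) : volume (cube a l) ≠ ⊤ := by
  rw [volume_cube]; exact ENNReal.pow_ne_top ENNReal.ofReal_ne_top

theorem IsBdd.integrableOn_cube {b : ℝ} {f : (Fin d → ℝ) → ℝ} (hf : IsBdd b f)
    (a : Fin d → ℝ) (l : ℝ) : IntegrableOn f (cube a l) :=
  Measure.integrableOn_of_bounded (M := b) (volume_cube_ne_top a l)
    hf.meas.aestronglyMeasurable (Eventually.of_forall fun x => hf.le x)

theorem integrableOn_cube_of_continuous {f : (Fin d → ℝ) → ℝ} (hf : Continuous f)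
    (a : Fin d → ℝ) (l : ℝ) : IntegrableOn f (cube a l) := by
  refine (hf.continuousOn.integrableOn_compact (K := univ.pi fun i => Icc (a i) (a i + l))
    (isCompact_univ_pi fun _ => isCompact_Icc)).mono_set ?_
  exact pi_mono fun i _ => Ico_subset_Icc_self

theorem integrableOn_cube_const (c : ℝ) (a : Fin d → ℝ) (l : ℝ) :
    IntegrableOn (fun _ => c) (cube a l) :=
  integrableOn_const (volume_cube_ne_top a l)

theorem norm_sub_le_of_mem_cube {x y : Fin d → ℝ} (hx : x ∈ cube (0 : Fin d → ℝ) 1)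
    (hy : y ∈ cube (0 : Fin d → ℝ) 1) : ‖x - y‖ ≤ 1 := by
  refine (pi_norm_le_iff_of_nonneg zero_le_one).2 fun i => ?_
  have h1 := hx i (mem_univ i)
  have h2 := hy i (mem_univ i)
  simp only [Pi.zero_apply, zero_add, mem_Ico] at h1 h2
  rw [Pi.sub_apply, Real.norm_eq_abs, abs_le]
  constructor <;> linarith [h1.1, h1.2, h2.1, h2.2]

theorem zero_mem_cube : (0 : Fin d → ℝ) ∈ cube (0 : Fin d → ℝ) 1 := fun i _ => by simp

/-! ### Bounded mean oscillation of `F` when `ΔF = -∂ᵢ∂ⱼ Sᵢⱼ` with bounded `S` -/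

/-- `ΔF = -∂ᵢ∂ⱼ Sᵢⱼ` in the sense of distributions. -/
def WeakRel (F : (Fin d → ℝ) → ℝ) (S : Fin d → Fin d → (Fin d → ℝ) → ℝ) : Prop :=
  ∀ A, IsTest A → ∫ x, F x * lap A x = -∑ i, ∑ j, ∫ x, S i j x * pd i (pd j A) x

theorem isTest_lap {A : (Fin d → ℝ) → ℝ} (hA : IsTest A) : IsTest (lap A) :=
  IsTest.sum _ fun i => (hA.pd i).pd i

/-- The test function is `z ↦ A (x - z)`; the two signs from the reflection cancel in second
derivatives. -/
theorem WeakRel.conv {F : (Fin d → ℝ) → ℝ} {S : Fin d → Fin d → (Fin d → ℝ) → ℝ}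
    (H : WeakRel F S) {A : (Fin d → ℝ) → ℝ} (hA : IsTest A) (x : Fin d → ℝ) :
    conv (lap A) F x = -∑ i, ∑ j, conv (pd i (pd j A)) (S i j) x := by
  have h := H _ (hA.comp_affine (neg_ne_zero.2 one_ne_zero : (-1 : ℝ) ≠ 0) x)
  simp only [lap, pd_pd_comp_affine hA] at h
  have e : ∀ z, (-1 : ℝ) • z + x = x - z := fun z => by rw [neg_one_smul]; abel
  simp only [e, neg_one_sq, one_mul] at h
  exact h

/-- The dilation of `g` for which second derivatives are `L¹`-normalised. -/
def sdil (c : ℝ) (g : (Fin d → ℝ) → ℝ) (z : Fin d → ℝ) : ℝ := (c ^ d * (c ^ 2)⁻¹) * g (c • z + 0)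

theorem IsTest.sdil {g : (Fin d → ℝ) → ℝ} (hg : IsTest g) {c : ℝ} (hc : c ≠ 0) :
    IsTest (sdil c g) :=
  (hg.comp_affine hc 0).const_mul _

theorem pd_pd_sdil {g : (Fin d → ℝ) → ℝ} (hg : IsTest g) {c : ℝ} (hc : c ≠ 0) (i j : Fin d) :
    pd i (pd j (sdil c g)) = dil c (pd i (pd j g)) := by
  have h := hg.comp_affine hc 0
  unfold sdil
  rw [pd_const_mul h.differentiable, pd_const_mul (h.pd j).differentiable,
    pd_pd_comp_affine hg]
  funext z
  simp only [dil, add_zero]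
  field_simp

/-- The properties of the pair of kernels provided by `exists_kernel`. -/
structure IsKernel (η B : (Fin d → ℝ) → ℝ) : Prop where
  test_left : IsTest η
  test_right : IsTest B
  lap_eq : ∀ x, lap B x = (1 / 2 : ℝ) ^ d * η ((1 / 2 : ℝ) • x) - η x

theorem IsKernel.lap_sdil {η B : (Fin d → ℝ) → ℝ} (h : IsKernel η B) {c : ℝ} (hc : c ≠ 0)
    (z : Fin d → ℝ) : lap (sdil c B) z = dil (c / 2) η z - dil c η z := by
  have : lap (sdil c B) z = dil c (lap B) z := by
    simp only [lap, pd_pd_sdil h.test_right hc, dil, Finset.mul_sum]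
  rw [this, dil, h.lap_eq, smul_smul, dil, dil, mul_comm (1 / 2 : ℝ) c, ← div_eq_mul_one_div]
  simp only [div_pow, one_pow]
  ring

theorem pd_pd_sum {ι : Type*} (s : Finset ι) {f : ι → (Fin d → ℝ) → ℝ}
    (hf : ∀ k, IsTest (f k)) (i j : Fin d) :
    (pd i (pd j fun x => ∑ k ∈ s, f k x)) = fun x => ∑ k ∈ s, pd i (pd j (f k)) x := by
  rw [pd_sum s (fun k => (hf k).differentiable), pd_sum s fun k => ((hf k).pd j).differentiable]

theorem lap_sum {ι : Type*} (s : Finset ι) {f : ι → (Fin d → ℝ) → ℝ}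
    (hf : ∀ k, IsTest (f k)) (x : Fin d → ℝ) :
    lap (fun x => ∑ k ∈ s, f k x) x = ∑ k ∈ s, lap (f k) x := by
  simp only [lap, pd_pd_sum s hf]
  exact Finset.sum_comm

theorem exists_lipschitz_conv_dil {g : (Fin d → ℝ) → ℝ} (hg : IsTest g) : ∃ C : ℝ, 0 ≤ C ∧
    ∀ (b : ℝ) (f : (Fin d → ℝ) → ℝ), IsBdd b f → ∀ c : ℝ, 0 < c → ∀ x y,
      |conv (dil c g) f x - conv (dil c g) f y| ≤ C * b * c * ‖x - y‖ := by
  obtain ⟨C, hC, h⟩ := exists_lipschitz_conv hg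
  refine ⟨C, hC, fun b f hf c hc x y => ?_⟩
  rw [conv_dil _ _ hc, conv_dil _ _ hc]
  refine (h b _ (hf.comp (measurable_const_smul c⁻¹)) _ _).trans_eq ?_
  rw [← smul_sub, norm_smul, Real.norm_eq_abs, abs_of_pos hc]
  ring

theorem tsupport_pd_subset (f : (Fin d → ℝ) → ℝ) (i : Fin d) : tsupport (pd i f) ⊆ tsupport f :=
  tsupport_fderiv_apply_subset ℝ _

/-- The `L²` half of Calderón–Zygmund theory, localised. The kernel `A` enters only through the
radius of its support and the bound `L` for its Laplacian, so the estimate does not see how many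
scales `A` is made of. The bound `L` is required for all admissible `f` because it is used for a
truncation. -/
theorem integral_abs_conv_pd_pd_le {A : (Fin d → ℝ) → ℝ} (hA : IsTest A) {r K L : ℝ}
    (hr : 0 ≤ r) (hs : tsupport A ⊆ Metric.closedBall 0 r)
    (hL : ∀ f, IsBdd K f → ∀ x, |conv (lap A) f x| ≤ L) {f : (Fin d → ℝ) → ℝ} (hf : IsBdd K f)
    (i j : Fin d) :
    ∫ x in cube (0 : Fin d → ℝ) 1, |conv (pd i (pd j A)) f x| ≤ 1 + L ^ 2 * (2 * (2 * r + 1)) ^ d := by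
  -- The truncation gives `conv A f₁` compact support, so that the `L²` identity applies. For `x` in
  -- the unit cube the kernel reaches only `‖z‖ ≤ r + 1`, so nothing changes there.
  set f₁ : (Fin d → ℝ) → ℝ := (Metric.closedBall 0 (r + 1)).indicator f with hf₁
  have hf₁b : IsBdd K f₁ := by
    refine ⟨hf.meas.indicator measurableSet_closedBall, fun x => ?_⟩
    by_cases hx : x ∈ Metric.closedBall (0 : Fin d → ℝ) (r + 1)
    · simpa [hf₁, indicator_of_mem hx] using hf.le x
    · simpa [hf₁, indicator_of_notMem hx] using hf.nonneg
  have hf₁s : HasCompactSupport f₁ :=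
    HasCompactSupport.intro (isCompact_closedBall 0 (r + 1)) fun x hx => indicator_of_notMem hx _
  have hloc := hf₁b.locallyIntegrable
  set w := conv A f₁ with hw
  have hwt : IsTest w := isTest_conv hA hloc hf₁s
  have hpd : ∀ i j, pd i (pd j w) = conv (pd i (pd j A)) f₁ := fun i j => by
    rw [hw, pd_conv hA hloc, pd_conv (hA.pd j) hloc]
  have hlap : ∀ x, lap w x = conv (lap A) f₁ x := fun x => by
    simp only [lap, hpd]
    exact (conv_sum Finset.univ (fun i => (hA.pd i).pd i) hloc x).symm
  have hzero : ∀ z, r < ‖z‖ → ∀ i j, pd i (pd j A) z = 0 := fun z hz i j => by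
    by_contra h
    have := hs (tsupport_pd_subset _ _ (tsupport_pd_subset _ _ (subset_tsupport _ h)))
    rw [mem_closedBall_zero_iff] at this
    linarith
  have hlap0 : ∀ x ∉ Metric.closedBall (0 : Fin d → ℝ) (2 * r + 1), lap w x ^ 2 = 0 := by
    intro x hx
    rw [mem_closedBall_zero_iff, not_le] at hx
    rw [hlap, PowerLawStokes.conv, integral_eq_zero_of_ae, zero_pow two_ne_zero]
    refine Eventually.of_forall fun z => ?_
    by_cases hz : z ∈ Metric.closedBall (0 : Fin d → ℝ) (r + 1)
    · rw [mem_closedBall_zero_iff] at hz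
      have h1 : r < ‖x - z‖ := by linarith [norm_sub_norm_le x z]
      simp [lap, hzero _ h1]
    · simp [hf₁, indicator_of_notMem hz]
  have hL2 : ∫ x, lap w x ^ 2 ≤ L ^ 2 * (2 * (2 * r + 1)) ^ d := by
    rw [← setIntegral_eq_integral_of_forall_compl_eq_zero hlap0]
    have hvol : volume.real (Metric.closedBall (0 : Fin d → ℝ) (2 * r + 1))
        = (2 * (2 * r + 1)) ^ d := by
      rw [measureReal_def, Real.volume_pi_closedBall _ (by positivity),
        ENNReal.toReal_ofReal (by positivity), Fintype.card_fin]
    calc _ ≤ ∫ x in Metric.closedBall (0 : Fin d → ℝ) (2 * r + 1), L ^ 2 := by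
          refine setIntegral_mono ?_ (integrableOn_const (isCompact_closedBall _ _).measure_ne_top)
            fun x => ?_
          · exact ((isTest_lap hwt).continuous.pow 2).continuousOn.integrableOn_compact
              (isCompact_closedBall _ _)
          · simp only [hlap]
            exact sq_le_sq' (abs_le.1 (hL f₁ hf₁b x)).1 (abs_le.1 (hL f₁ hf₁b x)).2
      _ = _ := by rw [setIntegral_const, hvol, smul_eq_mul, mul_comm]
  have hint : ∀ i j, Integrable fun x => pd i (pd j w) x ^ 2 := fun i j => by
    simp_rw [pow_two]
    exact integrable_mul_of_compact ((hwt.pd j).pd i).continuous.locallyIntegrable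
      ((hwt.pd j).pd i).continuous ((hwt.pd j).pd i).compact
  have hij : ∫ x, pd i (pd j w) x ^ 2 ≤ L ^ 2 * (2 * (2 * r + 1)) ^ d := by
    rw [← sum_integral_pd_pd_sq hwt] at hL2
    refine le_trans ?_ hL2
    have h0 : ∀ i j, 0 ≤ ∫ x, pd i (pd j w) x ^ 2 := fun i j =>
      integral_nonneg fun _ => sq_nonneg _
    exact (Finset.single_le_sum (f := fun j => ∫ x, pd i (pd j w) x ^ 2) (fun j _ => h0 i j)
      (Finset.mem_univ j)).trans (Finset.single_le_sum
        (f := fun i => ∑ j, ∫ x, pd i (pd j w) x ^ 2)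
        (fun i _ => Finset.sum_nonneg fun j _ => h0 i j) (Finset.mem_univ i))
  have heq : ∀ x ∈ cube (0 : Fin d → ℝ) 1, conv (pd i (pd j A)) f x = pd i (pd j w) x := by
    intro x hx
    rw [hpd]
    simp only [PowerLawStokes.conv]
    congr 1
    funext z
    by_cases hz : z ∈ Metric.closedBall (0 : Fin d → ℝ) (r + 1)
    · simp [hf₁, indicator_of_mem hz]
    · rw [mem_closedBall_zero_iff, not_le] at hz
      have h1 : ‖x‖ ≤ 1 := by simpa using norm_sub_le_of_mem_cube hx zero_mem_cube
      have h2 : r < ‖x - z‖ := by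
        have := norm_sub_norm_le z x
        rw [norm_sub_rev] at this
        linarith
      rw [hzero _ h2]; simp
  calc ∫ x in cube (0 : Fin d → ℝ) 1, |conv (pd i (pd j A)) f x|
      = ∫ x in cube (0 : Fin d → ℝ) 1, |pd i (pd j w) x| :=
        setIntegral_congr_fun (measurableSet_cube _ _) fun x hx => by simp only [heq x hx]
    _ ≤ ∫ x in cube (0 : Fin d → ℝ) 1, (1 + pd i (pd j w) x ^ 2) := by
        refine setIntegral_mono ?_ ?_ fun x => ?_
        · exact integrableOn_cube_of_continuous ((hwt.pd j).pd i).continuous.abs _ _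
        · exact (integrableOn_cube_const 1 _ _).add (hint i j).integrableOn
        · nlinarith [sq_abs (pd i (pd j w) x), sq_nonneg (|pd i (pd j w) x| - 1),
            abs_nonneg (pd i (pd j w) x)]
    _ = 1 + ∫ x in cube (0 : Fin d → ℝ) 1, pd i (pd j w) x ^ 2 := by
        rw [integral_add (integrableOn_cube_const 1 _ _) (hint i j).integrableOn,
          setIntegral_const, volume_real_cube _ zero_le_one]
        simp
    _ ≤ 1 + ∫ x, pd i (pd j w) x ^ 2 := by
        have := setIntegral_le_integral (s := cube (0 : Fin d → ℝ) 1) (hint i j)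
          (Eventually.of_forall fun _ => sq_nonneg _)
        linarith
    _ ≤ _ := by gcongr

/-- The point is that `C` is independent of the bound `b` on `F`. That bound only decides how many
coarse scales `M` are used, and the geometric decay of their Lipschitz constants makes `M` harmless.
-/
theorem exists_unit_oscillation_le (hd : 0 < d) (K : ℝ) : ∃ C : ℝ, 0 ≤ C ∧
    ∀ (b : ℝ) (F : (Fin d → ℝ) → ℝ) (S : Fin d → Fin d → (Fin d → ℝ) → ℝ),
      IsBdd b F → (∀ i j, IsBdd K (S i j)) → WeakRel F S →
        ∃ c, ∫ x in cube (0 : Fin d → ℝ) 1, |F x - c| ≤ C := by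
  obtain ⟨η, B, h1, h2, h3, h4, h5, h6⟩ := exists_kernel hd
  have hk : IsKernel η B := ⟨⟨h1, h3⟩, ⟨h2, h4⟩, h6⟩
  have hη := hk.test_left
  have hB := hk.test_right
  obtain ⟨Cη, hCη, hlipη⟩ := exists_lipschitz_conv_dil hη
  choose CB hCB hlipB using fun i j => exists_lipschitz_conv_dil ((hB.pd j).pd i)
  obtain ⟨r, hr, hsupp⟩ : ∃ r : ℝ, 0 ≤ r ∧ tsupport B ⊆ Metric.closedBall 0 r := by
    obtain ⟨r, hr⟩ := hB.compact.isCompact.isBounded.subset_closedBall 0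
    exact ⟨|r|, abs_nonneg _, hr.trans (Metric.closedBall_subset_closedBall (le_abs_self r))⟩
  set I := ∫ z, |η z| with hI
  have hI0 : 0 ≤ I := integral_nonneg fun _ => abs_nonneg _
  set D : ℝ := 1 + (2 * (|K| * I)) ^ 2 * (2 * (2 * r + 1)) ^ d with hD
  have hD0 : 0 ≤ D := by positivity
  refine ⟨1 + (∑ i, ∑ j, 2 * (CB i j * |K|)) + ∑ _i : Fin d, ∑ _j : Fin d, D, ?_, ?_⟩
  · have : 0 ≤ ∑ i, ∑ j, 2 * (CB i j * |K|) := Finset.sum_nonneg fun i _ => Finset.sum_nonneg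
      fun j _ => mul_nonneg zero_le_two (mul_nonneg (hCB i j) (abs_nonneg K))
    have : 0 ≤ ∑ _i : Fin d, ∑ _j : Fin d, D := Finset.sum_nonneg fun i _ => Finset.sum_nonneg
      fun j _ => hD0
    positivity
  intro b F S hF hS hrel
  have hFl := hF.locallyIntegrable
  -- At scale `2^M` the mollified `F` varies by at most 1 over the unit cube.
  obtain ⟨M, hM⟩ : ∃ M : ℕ, Cη * b * (1 / 2 : ℝ) ^ M ≤ 1 := by
    have : Tendsto (fun M : ℕ => Cη * b * (1 / 2 : ℝ) ^ M) atTop (𝓝 0) := by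
      simpa using (tendsto_pow_atTop_nhds_zero_of_lt_one (by norm_num : (0 : ℝ) ≤ 1 / 2)
        (by norm_num)).const_mul (Cη * b)
    exact ((this.eventually (ge_mem_nhds one_pos))).exists
  -- Nonnegativity of `K` comes from the bound on an entry of `S`, so it needs an index pair.
  have hK : ∀ i j : Fin d, K = |K| := fun i j => (abs_of_nonneg (hS i j).nonneg).symm
  -- the kernels of large and of small scale
  set P : (Fin d → ℝ) → ℝ := fun z => ∑ k ∈ Finset.range M, sdil ((1 / 2 : ℝ) ^ k) B z with hP
  set Q : ℕ → (Fin d → ℝ) → ℝ := fun N z => ∑ k ∈ Finset.range N, sdil ((2 : ℝ) ^ (k + 1)) B z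
    with hQ
  have hPk : ∀ k : ℕ, IsTest (sdil ((1 / 2 : ℝ) ^ k) B) := fun k => hB.sdil (by positivity)
  have hQk : ∀ k : ℕ, IsTest (sdil ((2 : ℝ) ^ (k + 1)) B) := fun k => hB.sdil (by positivity)
  have hPt : IsTest P := IsTest.sum _ hPk
  have hQt : ∀ N, IsTest (Q N) := fun N => IsTest.sum _ hQk
  have hPl : lap P = fun z => dil ((1 / 2 : ℝ) ^ M) η z - η z := by
    funext z
    rw [hP, lap_sum _ hPk, Finset.sum_congr rfl fun k _ => hk.lap_sdil (by positivity) z]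
    have := Finset.sum_range_sub (fun k : ℕ => dil ((1 / 2 : ℝ) ^ k) η z) M
    simp only [pow_zero, dil_one] at this
    rw [← this]
    refine Finset.sum_congr rfl fun k _ => ?_
    rw [show ((1 / 2 : ℝ) ^ k) / 2 = (1 / 2) ^ (k + 1) by rw [pow_succ]; ring]
  have hQl : ∀ N, lap (Q N) = fun z => η z - dil ((2 : ℝ) ^ N) η z := by
    intro N
    funext z
    rw [hQ, lap_sum _ hQk, Finset.sum_congr rfl fun k _ => hk.lap_sdil (by positivity) z]
    have := Finset.sum_range_sub' (fun k : ℕ => dil ((2 : ℝ) ^ k) η z) N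
    simp only [pow_zero, dil_one] at this
    rw [← this]
    refine Finset.sum_congr rfl fun k _ => ?_
    rw [show ((2 : ℝ) ^ (k + 1)) / 2 = 2 ^ k by rw [pow_succ]; ring]
  have hdη : ∀ c : ℝ, 0 < c → IsTest (dil c η) := fun c hc => hη.dil hc.ne'
  -- Both telescoping sums are tested in the weak relation; the unit-scale term `conv η F` cancels
  -- between them.
  have hid : ∀ N x, conv (dil ((2 : ℝ) ^ N) η) F x = conv (dil ((1 / 2 : ℝ) ^ M) η) F x
      + ∑ i, ∑ j, conv (pd i (pd j P)) (S i j) x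
      + ∑ i, ∑ j, conv (pd i (pd j (Q N))) (S i j) x := by
    intro N x
    have e1 := hrel.conv hPt x
    have e2 := hrel.conv (hQt N) x
    rw [hPl, conv_sub (hdη _ (by positivity)) hη hFl] at e1
    rw [hQl, conv_sub hη (hdη _ (by positivity)) hFl] at e2
    linarith
  have hPosc : ∀ i j, ∀ x ∈ cube (0 : Fin d → ℝ) 1,
      |conv (pd i (pd j P)) (S i j) x - conv (pd i (pd j P)) (S i j) 0| ≤ 2 * (CB i j * |K|) := by
    intro i j x hx
    have hx1 : ‖x - 0‖ ≤ 1 := norm_sub_le_of_mem_cube hx zero_mem_cube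
    have e : pd i (pd j P) = fun z => ∑ k ∈ Finset.range M, dil ((1 / 2 : ℝ) ^ k) (pd i (pd j B)) z := by
      rw [hP, pd_pd_sum _ hPk]
      funext z
      exact Finset.sum_congr rfl fun k _ => by rw [pd_pd_sdil hB (by positivity)]
    have ht : ∀ k : ℕ, IsTest (dil ((1 / 2 : ℝ) ^ k) (pd i (pd j B))) := fun k =>
      ((hB.pd j).pd i).dil (by positivity)
    rw [e, conv_sum _ ht (hS i j).locallyIntegrable, conv_sum _ ht (hS i j).locallyIntegrable,
      ← Finset.sum_sub_distrib]
    calc _ ≤ ∑ k ∈ Finset.range M, CB i j * |K| * (1 / 2 : ℝ) ^ k := by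
          refine (Finset.abs_sum_le_sum_abs _ _).trans (Finset.sum_le_sum fun k _ => ?_)
          refine (hlipB i j K _ (hS i j) _ (by positivity) x 0).trans ?_
          rw [← hK i j]
          exact mul_le_of_le_one_right (mul_nonneg (mul_nonneg (hCB i j) (hS i j).nonneg)
            (by positivity)) hx1
      _ = CB i j * |K| * ∑ k ∈ Finset.range M, (1 / 2 : ℝ) ^ k := by rw [Finset.mul_sum]
      _ ≤ CB i j * |K| * 2 := by
          gcongr
          · exact mul_nonneg (hCB i j) (abs_nonneg K)
          · exact sum_geometric_two_le M
      _ = _ := by ring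
  -- Dilation factors at least 1 keep all supports in the ball of radius `r`. The Laplacian of `Q N`
  -- is a difference of two kernels of `L¹` norm `I`, so `L = 2 |K| I` serves for every `N`.
  have hQint : ∀ N i j, ∫ x in cube (0 : Fin d → ℝ) 1, |conv (pd i (pd j (Q N))) (S i j) x| ≤ D := by
    intro N i j
    refine integral_abs_conv_pd_pd_le (hQt N) hr ?_ (fun f hf x => ?_) (hS i j) i j
    · refine closure_minimal (fun z hz => ?_) Metric.isClosed_closedBall
      obtain ⟨k, -, hk'⟩ := Finset.exists_ne_zero_of_sum_ne_zero hz
      have hB0 : B ((2 : ℝ) ^ (k + 1) • z + 0) ≠ 0 := fun h => hk' (by simp only [sdil, h, mul_zero])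
      have := hsupp (subset_tsupport _ hB0)
      rw [add_zero, mem_closedBall_zero_iff, norm_smul, Real.norm_eq_abs,
        abs_of_pos (by positivity)] at this
      rw [mem_closedBall_zero_iff]
      have h1 : (1 : ℝ) ≤ 2 ^ (k + 1) := one_le_pow₀ one_le_two
      nlinarith [norm_nonneg z]
    · rw [hQl, conv_sub hη (hdη _ (by positivity)) hf.locallyIntegrable]
      have e1 := abs_conv_le hη hf x
      have e2 := abs_conv_le (hdη ((2 : ℝ) ^ N) (by positivity)) hf x
      simp_rw [abs_dil η (show (0 : ℝ) < 2 ^ N by positivity)] at e2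
      rw [integral_dil (fun z => |η z|) (by positivity)] at e2
      rw [← hK i j]
      exact (abs_sub _ _).trans (by linarith)
  set c₀ := conv (dil ((1 / 2 : ℝ) ^ M) η) F 0 + ∑ i, ∑ j, conv (pd i (pd j P)) (S i j) 0 with hc₀
  have hpt : ∀ N, ∀ x ∈ cube (0 : Fin d → ℝ) 1, |conv (dil ((2 : ℝ) ^ N) η) F x - c₀|
      ≤ 1 + (∑ i, ∑ j, 2 * (CB i j * |K|))
        + ∑ i, ∑ j, |conv (pd i (pd j (Q N))) (S i j) x| := by
    intro N x hx
    have hx1 : ‖x - 0‖ ≤ 1 := norm_sub_le_of_mem_cube hx zero_mem_cube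
    have e1 : |conv (dil ((1 / 2 : ℝ) ^ M) η) F x - conv (dil ((1 / 2 : ℝ) ^ M) η) F 0| ≤ 1 := by
      refine (hlipη b F hF _ (by positivity) x 0).trans (le_trans ?_ hM)
      exact mul_le_of_le_one_right (mul_nonneg (mul_nonneg hCη hF.nonneg) (by positivity)) hx1
    have e2 : |∑ i, ∑ j, conv (pd i (pd j P)) (S i j) x
        - ∑ i, ∑ j, conv (pd i (pd j P)) (S i j) 0| ≤ ∑ i, ∑ j, 2 * (CB i j * |K|) := by
      simp_rw [← Finset.sum_sub_distrib]
      refine (Finset.abs_sum_le_sum_abs _ _).trans (Finset.sum_le_sum fun i _ => ?_)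
      exact (Finset.abs_sum_le_sum_abs _ _).trans (Finset.sum_le_sum fun j _ => hPosc i j x hx)
    have e3 : |∑ i, ∑ j, conv (pd i (pd j (Q N))) (S i j) x|
        ≤ ∑ i, ∑ j, |conv (pd i (pd j (Q N))) (S i j) x| :=
      (Finset.abs_sum_le_sum_abs _ _).trans
        (Finset.sum_le_sum fun i _ => Finset.abs_sum_le_sum_abs _ _)
    rw [hid, hc₀]
    rw [abs_le] at e1 e2 e3 ⊢
    constructor <;> linarith [e1.1, e1.2, e2.1, e2.2, e3.1, e3.2]
  have hcI : ∀ N i j, IntegrableOn (fun x => |conv (pd i (pd j (Q N))) (S i j) x|)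
      (cube (0 : Fin d → ℝ) 1) := fun N i j => integrableOn_cube_of_continuous
    (contDiff_conv (((hQt N).pd j).pd i) (hS i j).locallyIntegrable).continuous.abs _ _
  have hbound : ∀ N, ∫ x in cube (0 : Fin d → ℝ) 1, |conv (dil ((2 : ℝ) ^ N) η) F x - c₀|
      ≤ 1 + (∑ i, ∑ j, 2 * (CB i j * |K|)) + ∑ _i : Fin d, ∑ _j : Fin d, D := by
    intro N
    refine (setIntegral_mono_on (integrableOn_cube_of_continuous
      ((contDiff_conv (hdη _ (by positivity)) hFl).continuous.sub continuous_const).abs _ _)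
      ((integrableOn_cube_const _ _ _).add (integrable_finsetSum _ fun i _ =>
        integrable_finsetSum _ fun j _ => hcI N i j)) (measurableSet_cube _ _) (hpt N)).trans ?_
    rw [integral_add' (integrableOn_cube_const _ _ _) (integrable_finsetSum _ fun i _ =>
        integrable_finsetSum _ fun j _ => hcI N i j), setIntegral_const,
      volume_real_cube _ zero_le_one, one_pow, one_smul,
      integral_finsetSum _ fun i _ => integrable_finsetSum _ fun j _ => hcI N i j]
    gcongr with i
    rw [integral_finsetSum _ fun j _ => hcI N i j]
    gcongr with j
    exact hQint N i j
  refine ⟨c₀, ?_⟩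
  -- The mollifications converge almost everywhere and are dominated with the help of `b`; the bound
  -- `b` does not survive in the limit inequality.
  have hlim : Tendsto (fun N : ℕ => ∫ x in cube (0 : Fin d → ℝ) 1,
      |conv (dil ((2 : ℝ) ^ N) η) F x - c₀|) atTop
      (𝓝 (∫ x in cube (0 : Fin d → ℝ) 1, |F x - c₀|)) := by
    refine tendsto_integral_of_dominated_convergence (fun _ => b * I + |c₀|) (fun N => ?_)
      (integrableOn_cube_const _ _ _) (fun N => Eventually.of_forall fun x => ?_) ?_
    · exact ((contDiff_conv (hdη _ (by positivity)) hFl).continuous.sub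
        continuous_const).abs.aestronglyMeasurable
    · have e2 := abs_conv_le (hdη ((2 : ℝ) ^ N) (by positivity)) hF x
      simp_rw [abs_dil η (show (0 : ℝ) < 2 ^ N by positivity)] at e2
      rw [integral_dil (fun z => |η z|) (by positivity)] at e2
      rw [Real.norm_eq_abs, abs_abs]
      exact (abs_sub _ _).trans (by linarith)
    · filter_upwards [ae_restrict_of_ae (ae_tendsto_conv_dil hη h5 hFl)] with x hx
      exact (hx.sub_const c₀).abs
  exact le_of_tendsto' hlim hbound

/-- If `ΔF = -∂ᵢ∂ⱼ Sᵢⱼ` with `S` bounded by `K` then the mean oscillations of the bounded function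
`F` are controlled by `d` and `K` only. -/
theorem exists_oscillation_le (hd : 0 < d) (K : ℝ) : ∃ C : ℝ, 0 ≤ C ∧
    ∀ (b : ℝ) (F : (Fin d → ℝ) → ℝ) (S : Fin d → Fin d → (Fin d → ℝ) → ℝ),
      IsBdd b F → (∀ i j, IsBdd K (S i j)) → WeakRel F S → ∀ (a : Fin d → ℝ) (l : ℝ), 0 < l →
        ∃ c, ∫ x in cube a l, |F x - c| ≤ C * l ^ d := by
  obtain ⟨C, hC, h⟩ := exists_unit_oscillation_le hd K
  refine ⟨C, hC, fun b F S hF hS hrel a l hl => ?_⟩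
  have hφ : Measurable fun x : Fin d → ℝ => l • x + a :=
    (measurable_const_smul l).add_const a
  have hchange : ∀ g : (Fin d → ℝ) → ℝ, ∫ x, g (l • x + a) = (l ^ d)⁻¹ * ∫ x, g x := fun g => by
    have e := Measure.integral_comp_smul volume (fun x : Fin d → ℝ => g (x + a)) l
    rw [e, integral_add_right_eq_self (fun x => g x)]
    simp only [Module.finrank_fintype_fun_eq_card, Fintype.card_fin, smul_eq_mul]
    rw [abs_of_pos (by positivity)]
  -- The weak relation has two derivatives on each side, so it is invariant under `x ↦ l x + a`, as
  -- are the bounds on `F` and `S`. This reduces an arbitrary cube to the unit cube.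
  obtain ⟨c, hc⟩ := h b (fun x => F (l • x + a)) (fun i j x => S i j (l • x + a)) (hF.comp hφ)
    (fun i j => (hS i j).comp hφ) fun A hA => by
      have h1 := hrel _ (hA.comp_affine (inv_ne_zero hl.ne') (-(l⁻¹ • a)))
      have e : ∀ x : Fin d → ℝ, x = l⁻¹ • (l • x + a) + -(l⁻¹ • a) := fun x => by
        rw [smul_add, smul_smul, inv_mul_cancel₀ hl.ne', one_smul]; abel
      simp only [lap, pd_pd_comp_affine hA] at h1
      have e1 : ∫ x, F (l • x + a) * lap A x = (l ^ d)⁻¹ * (l ^ 2 *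
          ∫ x, F x * ∑ i, (l⁻¹) ^ 2 * pd i (pd i A) (l⁻¹ • x + -(l⁻¹ • a))) := by
        rw [← integral_const_mul, ← hchange]
        congr 1; funext x
        rw [← e, ← Finset.mul_sum, lap]; field_simp
      have e2 : ∀ i j, ∫ x, S i j (l • x + a) * pd i (pd j A) x = (l ^ d)⁻¹ * (l ^ 2 *
          ∫ x, S i j x * ((l⁻¹) ^ 2 * pd i (pd j A) (l⁻¹ • x + -(l⁻¹ • a)))) := fun i j => by
        rw [← integral_const_mul, ← hchange]
        congr 1; funext x
        rw [← e]; field_simp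
      rw [e1, h1]
      simp only [e2, ← Finset.mul_sum, mul_neg]
  refine ⟨c, ?_⟩
  have e3 := hchange ((cube a l).indicator fun x => |F x - c|)
  rw [integral_indicator (measurableSet_cube _ _)] at e3
  have e4 : (fun x => (cube a l).indicator (fun x => |F x - c|) (l • x + a))
      = (cube (0 : Fin d → ℝ) 1).indicator fun x => |F (l • x + a) - c| := by
    have hmem : ∀ x : Fin d → ℝ, l • x + a ∈ cube a l ↔ x ∈ cube (0 : Fin d → ℝ) 1 := fun x => by
      simp only [cube, mem_univ_pi, mem_Ico, Pi.add_apply, Pi.smul_apply, smul_eq_mul,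
        Pi.zero_apply, zero_add]
      refine forall_congr' fun i => and_congr ?_ ?_
      · rw [le_add_iff_nonneg_left, mul_nonneg_iff_of_pos_left hl]
      · rw [add_comm, add_lt_add_iff_left, mul_lt_iff_lt_one_right hl]
    funext x
    by_cases hx : x ∈ cube (0 : Fin d → ℝ) 1
    · rw [indicator_of_mem hx, indicator_of_mem ((hmem x).2 hx)]
    · rw [indicator_of_notMem hx, indicator_of_notMem (mt (hmem x).1 hx)]
  rw [e4, integral_indicator (measurableSet_cube _ _)] at e3
  rw [e3, inv_mul_le_iff₀ (by positivity)] at hc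
  linarith

end PowerLawStokes

end

noncomputable section

namespace PowerLawStokes

variable {d : ℕ}

/-! ### The John–Nirenberg inequality -/

/-- The lower corner of the dyadic child with index `e` of the cube `cube a l`. -/
def child (a : Fin d → ℝ) (l : ℝ) (e : Fin d → Fin 2) : Fin d → ℝ :=
  fun i => a i + ((e i : ℕ) : ℝ) * (l / 2)

theorem cube_eq_iUnion_child (a : Fin d → ℝ) (l : ℝ) (hl : 0 < l) :
    cube a l = ⋃ e, cube (child a l e) (l / 2) := by
  ext x
  simp only [cube, mem_iUnion, mem_univ_pi, mem_Ico, child]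
  constructor
  · intro h
    refine ⟨fun i => if x i < a i + l / 2 then 0 else 1, fun i => ?_⟩
    have := h i
    dsimp only
    split_ifs with hi
    · simp only [Fin.coe_ofNat_eq_mod, Nat.zero_mod, Nat.cast_zero, zero_mul, add_zero]
      exact ⟨this.1, hi⟩
    · simp only [Fin.coe_ofNat_eq_mod, Nat.one_mod, Nat.cast_one, one_mul]
      constructor <;> linarith [this.2]
  · rintro ⟨e, he⟩ i
    have := he i
    have h2 : ((e i : ℕ) : ℝ) ≤ 1 := by exact_mod_cast Nat.lt_succ_iff.1 (e i).2
    have h0 : (0 : ℝ) ≤ ((e i : ℕ) : ℝ) := Nat.cast_nonneg _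
    constructor <;> nlinarith [this.1, this.2]

theorem disjoint_child (a : Fin d → ℝ) (l : ℝ) :
    Pairwise (Function.onFun Disjoint fun e => cube (child a l e) (l / 2)) := by
  intro e e' hne
  refine Set.disjoint_left.2 fun x hx hx' => hne (funext fun i => ?_)
  have h1 := hx i (mem_univ i)
  have h2 := hx' i (mem_univ i)
  simp only [child, mem_Ico] at h1 h2
  have key : ∀ p q : Fin 2, a i + ((p : ℕ) : ℝ) * (l / 2) ≤ x i →
      x i < a i + ((p : ℕ) : ℝ) * (l / 2) + l / 2 → a i + ((q : ℕ) : ℝ) * (l / 2) ≤ x i →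
      x i < a i + ((q : ℕ) : ℝ) * (l / 2) + l / 2 → p = q := by
    intro p q h1 h2 h3 h4
    fin_cases p <;> fin_cases q <;> simp_all <;> linarith
  exact key _ _ h1.1 h1.2 h2.1 h2.2

theorem setIntegral_cube_eq_sum_child (a : Fin d → ℝ) {l : ℝ} (hl : 0 < l)
    {g : (Fin d → ℝ) → ℝ} (hg : IntegrableOn g (cube a l)) :
    ∫ x in cube a l, g x = ∑ e, ∫ x in cube (child a l e) (l / 2), g x := by
  rw [cube_eq_iUnion_child a l hl] at hg ⊢
  exact integral_iUnion_fintype (fun e => measurableSet_cube _ _) (disjoint_child a l)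
    fun e => hg.mono_set (subset_iUnion (fun e => cube (child a l e) (l / 2)) e)

theorem child_subset (a : Fin d → ℝ) {l : ℝ} (hl : 0 < l) (e : Fin d → Fin 2) :
    cube (child a l e) (l / 2) ⊆ cube a l := by
  rw [cube_eq_iUnion_child a l hl]; exact subset_iUnion (fun e => cube (child a l e) (l / 2)) e

/-- The mean of `f` over a cube. -/
def avg (f : (Fin d → ℝ) → ℝ) (a : Fin d → ℝ) (l : ℝ) : ℝ := ⨍ x in cube a l, f x

theorem avg_eq (f : (Fin d → ℝ) → ℝ) (a : Fin d → ℝ) {l : ℝ} (hl : 0 ≤ l) :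
    avg f a l = (l ^ d)⁻¹ * ∫ x in cube a l, f x := by
  rw [avg, setAverage_eq, volume_real_cube _ hl, smul_eq_mul]

theorem pow_mul_abs_avg_sub_le {f : (Fin d → ℝ) → ℝ} {a : Fin d → ℝ} {l : ℝ} (hl : 0 < l)
    (hf : IntegrableOn f (cube a l)) (c : ℝ) :
    l ^ d * |avg f a l - c| ≤ ∫ x in cube a l, |f x - c| := by
  have h1 : ∫ x in cube a l, (f x - c) = l ^ d * (avg f a l - c) := by
    rw [integral_sub hf (integrableOn_cube_const _ _ _), setIntegral_const,
      volume_real_cube _ hl.le, avg_eq f a hl.le, smul_eq_mul]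
    field_simp
  have h2 := abs_integral_le_integral_abs (f := fun x => f x - c) (μ := volume.restrict (cube a l))
  rwa [h1, abs_mul, abs_of_pos (by positivity : 0 < l ^ d)] at h2

theorem IsBdd.abs_avg_le {b : ℝ} {f : (Fin d → ℝ) → ℝ} (hf : IsBdd b f) (a : Fin d → ℝ) {l : ℝ}
    (hl : 0 < l) : |avg f a l| ≤ b := by
  have h1 := pow_mul_abs_avg_sub_le hl (hf.integrableOn_cube a l) 0
  have h2 : ∫ x in cube a l, |f x - 0| ≤ ∫ x in cube a l, b := by
    refine setIntegral_mono ?_ (integrableOn_cube_const _ _ _) fun x => by simpa using hf.le x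
    simp only [sub_zero]
    exact (hf.integrableOn_cube a l).abs
  rw [setIntegral_const, volume_real_cube _ hl.le, smul_eq_mul] at h2
  have := h1.trans h2
  rw [sub_zero] at this
  exact le_of_mul_le_mul_left this (by positivity)

/-! ### Dyadic conditional expectations and the exponential estimate -/

/-- The `N`-th dyadic conditional expectation of `f` on the cube `cube a l`. -/
def dyadicAvg (f : (Fin d → ℝ) → ℝ) : ℕ → (Fin d → ℝ) → ℝ → (Fin d → ℝ) → ℝ
  | 0, a, l => fun _ => avg f a l
  | N + 1, a, l => fun x => ∑ e, (cube (child a l e) (l / 2)).indicator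
      (dyadicAvg f N (child a l e) (l / 2)) x

theorem measurable_dyadicAvg (f : (Fin d → ℝ) → ℝ) (N : ℕ) (a : Fin d → ℝ) (l : ℝ) :
    Measurable (dyadicAvg f N a l) := by
  induction N generalizing a l with
  | zero => exact measurable_const
  | succ N ih =>
    exact Finset.measurable_sum _ fun e _ => (ih _ _).indicator (measurableSet_cube _ _)

theorem dyadicAvg_succ_of_mem (f : (Fin d → ℝ) → ℝ) (N : ℕ) (a : Fin d → ℝ) (l : ℝ)
    {e : Fin d → Fin 2} {x : Fin d → ℝ} (hx : x ∈ cube (child a l e) (l / 2)) :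
    dyadicAvg f (N + 1) a l x = dyadicAvg f N (child a l e) (l / 2) x := by
  rw [dyadicAvg]
  dsimp only
  rw [Finset.sum_eq_single e, indicator_of_mem hx]
  · intro e' _ hne
    exact indicator_of_notMem (fun h => Set.disjoint_left.1 (disjoint_child a l hne) h hx) _
  · simp

theorem exists_dyadicAvg_eq (f : (Fin d → ℝ) → ℝ) (N : ℕ) (a : Fin d → ℝ) {l : ℝ} (hl : 0 < l)
    {x : Fin d → ℝ} (hx : x ∈ cube a l) :
    ∃ a', x ∈ cube a' (l / 2 ^ N) ∧ dyadicAvg f N a l x = avg f a' (l / 2 ^ N) := by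
  induction N generalizing a l with
  | zero => exact ⟨a, by simpa using hx, by simp [dyadicAvg]⟩
  | succ N ih =>
    rw [cube_eq_iUnion_child a l hl, mem_iUnion] at hx
    obtain ⟨e, he⟩ := hx
    obtain ⟨a', h1, h2⟩ := ih (child a l e) (by positivity) he
    have e1 : l / 2 / 2 ^ N = l / 2 ^ (N + 1) := by rw [pow_succ, div_div, mul_comm]
    rw [e1] at h1 h2
    exact ⟨a', h1, by rw [dyadicAvg_succ_of_mem f N a l he, h2]⟩

theorem IsBdd.abs_dyadicAvg_le {b : ℝ} {f : (Fin d → ℝ) → ℝ} (hf : IsBdd b f) (N : ℕ)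
    (a : Fin d → ℝ) {l : ℝ} (hl : 0 < l) {x : Fin d → ℝ} (hx : x ∈ cube a l) :
    |dyadicAvg f N a l x| ≤ b := by
  obtain ⟨a', -, h⟩ := exists_dyadicAvg_eq f N a hl hx
  rw [h]; exact hf.abs_avg_le _ (by positivity)

/-- The ambient norm is the sup norm, so closed balls are closed cubes, which differ from half-open
ones by a null set. Differentiation of averages over balls thereby applies to dyadic cubes. -/
theorem avg_eq_average_closedBall (f : (Fin d → ℝ) → ℝ) (a : Fin d → ℝ) {l : ℝ} (hl : 0 < l) :
    avg f a l = ⨍ x in Metric.closedBall (fun i => a i + l / 2) (l / 2), f x := by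
  have h : Metric.closedBall (fun i => a i + l / 2) (l / 2) = Icc a fun i => a i + l := by
    rw [closedBall_pi _ (by positivity), ← pi_univ_Icc]
    congr 1; funext i
    rw [Real.closedBall_eq_Icc]; congr 1 <;> ring
  rw [avg, h]
  exact setAverage_congr Measure.univ_pi_Ico_ae_eq_Icc

theorem ae_tendsto_dyadicAvg {f : (Fin d → ℝ) → ℝ} (hf : LocallyIntegrable f) (a : Fin d → ℝ)
    {l : ℝ} (hl : 0 < l) :
    ∀ᵐ x, x ∈ cube a l → Tendsto (fun N => dyadicAvg f N a l x) atTop (𝓝 (f x)) := by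
  filter_upwards [IsUnifLocDoublingMeasure.ae_tendsto_average volume hf 1] with x hx hxa
  choose a' ha' h using fun N => exists_dyadicAvg_eq f N a hl hxa
  simp_rw [h, avg_eq_average_closedBall f _ (show 0 < l / 2 ^ _ by positivity)]
  refine hx (fun N i => a' N i + l / 2 ^ N / 2) (fun N : ℕ => l / 2 ^ N / 2) ?_
    (Eventually.of_forall fun N => ?_)
  · refine tendsto_nhdsWithin_iff.2 ⟨?_, Eventually.of_forall fun N => by simp; positivity⟩
    have : Tendsto (fun N : ℕ => l / (2 : ℝ) ^ N) atTop (𝓝 0) :=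
      tendsto_const_nhds.div_atTop (tendsto_pow_atTop_atTop_of_one_lt one_lt_two)
    simpa using this.div_const 2
  · have hp : 0 < l / 2 ^ N := by positivity
    rw [one_mul, closedBall_pi _ (by positivity)]
    intro i hi
    have := ha' N i hi
    dsimp only
    rw [Real.closedBall_eq_Icc]
    constructor <;> linarith [this.1, this.2]

theorem IsBdd.integrableOn_exp_dyadicAvg {b : ℝ} {f : (Fin d → ℝ) → ℝ} (hf : IsBdd b f)
    {θ : ℝ} (hθ : 0 ≤ θ) (c : ℝ) (N : ℕ) (a : Fin d → ℝ) {l : ℝ} (hl : 0 < l) :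
    IntegrableOn (fun x => Real.exp (θ * |dyadicAvg f N a l x - c|)) (cube a l) := by
  refine Measure.integrableOn_of_bounded (M := Real.exp (θ * (b + |c|))) (volume_cube_ne_top a l)
    ?_ ?_
  · have := measurable_dyadicAvg f N a l
    exact Measurable.aestronglyMeasurable (by fun_prop)
  · refine (ae_restrict_iff' (measurableSet_cube _ _)).2 (Eventually.of_forall fun x hx => ?_)
    rw [Real.norm_eq_abs, Real.abs_exp]
    gcongr
    exact (abs_sub _ _).trans (by gcongr; exact hf.abs_dyadicAvg_le N a hl hx)

/-- The Calderón–Zygmund stopping argument, run as an induction on the number of generations, which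
makes it finite. Starting from a centre `c`, one descends until a cube has mean farther than `2B`
from `c`, then recentres there at the cost of a factor `3/2` and uses the estimate for fewer
generations. -/
theorem integral_exp_dyadicAvg_le {b B θ : ℝ} {f : (Fin d → ℝ) → ℝ} (hf : IsBdd b f) (hB : 0 < B)
    (hosc : ∀ a l, 0 < l → ∫ x in cube a l, |f x - avg f a l| ≤ B * l ^ d)
    (hθ : 0 ≤ θ) (hexp : Real.exp (θ * (2 * B + 2 ^ d * B)) ≤ 3 / 2) (N : ℕ) :
    ∀ (a : Fin d → ℝ) (l : ℝ), 0 < l →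
      ∫ x in cube a l, Real.exp (θ * |dyadicAvg f N a l x - avg f a l|) ≤ 6 * l ^ d := by
  have hexp' : Real.exp (θ * (2 * B)) ≤ 3 / 2 :=
    (Real.exp_le_exp.2 (by gcongr; linarith [show 0 ≤ 2 ^ d * B by positivity])).trans hexp
  have hint : ∀ c a l, IntegrableOn (fun x => |f x - c|) (cube a l) := fun c a l =>
    ((hf.integrableOn_cube a l).sub (integrableOn_cube_const c a l)).abs
  induction N using Nat.strong_induction_on with
  | _ N ihN =>
  -- The centre `c` stays fixed during the descent. The first term pays for cubes never stopped, the
  -- second for the stopped ones, through Chebyshev's inequality.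
  have key : ∀ k ≤ N, ∀ (a : Fin d → ℝ) (l : ℝ), 0 < l → ∀ c, |avg f a l - c| ≤ 2 * B →
      ∫ x in cube a l, Real.exp (θ * |dyadicAvg f k a l x - c|)
        ≤ 3 / 2 * l ^ d + 9 / (2 * B) * ∫ x in cube a l, |f x - c| := by
    intro k
    induction k with
    | zero =>
      intro _ a l hl c hc
      simp only [dyadicAvg]
      rw [setIntegral_const, volume_real_cube _ hl.le, smul_eq_mul]
      have h1 : Real.exp (θ * |avg f a l - c|) ≤ 3 / 2 :=
        (Real.exp_le_exp.2 (by gcongr)).trans hexp'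
      have h2 : 0 ≤ ∫ x in cube a l, |f x - c| := integral_nonneg fun _ => abs_nonneg _
      have h3 : 0 ≤ 9 / (2 * B) * ∫ x in cube a l, |f x - c| := by positivity
      have h4 : 0 < l ^ d := by positivity
      nlinarith
    | succ k ih =>
      intro hk a l hl c hc
      have hl2 : 0 < l / 2 := by positivity
      rw [setIntegral_cube_eq_sum_child a hl (hf.integrableOn_exp_dyadicAvg hθ c (k + 1) a hl),
        setIntegral_cube_eq_sum_child a hl (hint c a l)]
      have hpow : l ^ d = ∑ _e : Fin d → Fin 2, (l / 2) ^ d := by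
        simp only [Finset.sum_const, Finset.card_univ, Fintype.card_fun, Fintype.card_fin,
          nsmul_eq_mul, Nat.cast_pow, Nat.cast_ofNat]
        rw [← mul_pow]; congr 1; ring
      rw [hpow, Finset.mul_sum, Finset.mul_sum, ← Finset.sum_add_distrib]
      refine Finset.sum_le_sum fun e _ => ?_
      rw [setIntegral_congr_fun (g := fun x =>
        Real.exp (θ * |dyadicAvg f k (child a l e) (l / 2) x - c|)) (measurableSet_cube _ _)
        fun x hx => by simp only [dyadicAvg_succ_of_mem f k a l hx]]
      by_cases hst : |avg f (child a l e) (l / 2) - c| ≤ 2 * B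
      · exact ih (by omega) _ _ hl2 c hst
      -- A stopped child. Its parent's mean is within `2B` of `c`, and passing to a child moves the
      -- mean by at most `2^d B`; this is why `hexp` contains `2B + 2^d B`.
      · push Not at hst
        set a' := child a l e
        have h1 := pow_mul_abs_avg_sub_le hl2 (hf.integrableOn_cube a' (l / 2)) c
        have h2 : |avg f a' (l / 2) - avg f a l| ≤ 2 ^ d * B := by
          have h3 := pow_mul_abs_avg_sub_le hl2 (hf.integrableOn_cube a' (l / 2)) (avg f a l)
          have h4 : ∫ x in cube a' (l / 2), |f x - avg f a l| ≤ ∫ x in cube a l, |f x - avg f a l| :=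
            setIntegral_mono_set (hint _ _ _) (Eventually.of_forall fun _ => abs_nonneg _)
              (LE.le.eventuallyLE (child_subset a hl e))
          have h5 := (h3.trans h4).trans (hosc a l hl)
          rw [show B * l ^ d = (l / 2) ^ d * (2 ^ d * B) by rw [div_pow]; field_simp] at h5
          exact le_of_mul_le_mul_left h5 (by positivity)
        have h6 : |avg f a' (l / 2) - c| ≤ 2 * B + 2 ^ d * B := by
          have := abs_sub_le (avg f a' (l / 2)) (avg f a l) c
          linarith
        have h7 : ∫ x in cube a' (l / 2), Real.exp (θ * |dyadicAvg f k a' (l / 2) x - c|)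
            ≤ ∫ x in cube a' (l / 2), 3 / 2 *
              Real.exp (θ * |dyadicAvg f k a' (l / 2) x - avg f a' (l / 2)|) := by
          refine setIntegral_mono (hf.integrableOn_exp_dyadicAvg hθ _ _ _ hl2)
            ((hf.integrableOn_exp_dyadicAvg hθ _ _ _ hl2).const_mul _) fun x => ?_
          refine le_trans ?_ (mul_le_mul_of_nonneg_right hexp (Real.exp_nonneg _))
          rw [← Real.exp_add, ← mul_add]
          gcongr
          have := abs_sub_le (dyadicAvg f k a' (l / 2) x) (avg f a' (l / 2)) c
          linarith
        have h8 := ihN k (by omega) a' (l / 2) hl2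
        rw [integral_const_mul] at h7
        have h9 : (l / 2) ^ d * (2 * B) ≤ ∫ x in cube a' (l / 2), |f x - c| :=
          le_trans (by gcongr) h1
        -- The 9 is `3/2 · 6`: recentring factor times the bound from the outer induction.
        have h10 : 9 * (l / 2) ^ d ≤ 9 / (2 * B) * ∫ x in cube a' (l / 2), |f x - c| := by
          rw [div_mul_eq_mul_div, le_div_iff₀ (by positivity)]
          linarith
        have h11 : 0 ≤ (l / 2) ^ d := by positivity
        linarith
  intro a l hl
  -- With the mean as centre the two terms add up to `3/2 + 9/2 = 6`, so the induction closes with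
  -- the same constant.
  refine (key N le_rfl a l hl (avg f a l) (by simp; positivity)).trans ?_
  have h1 := hosc a l hl
  have h2 : 9 / (2 * B) * ∫ x in cube a l, |f x - avg f a l| ≤ 9 / (2 * B) * (B * l ^ d) := by
    gcongr
  have h3 : 9 / (2 * B) * (B * l ^ d) = 9 / 2 * l ^ d := by field_simp
  linarith

/-- **John–Nirenberg inequality**. -/
theorem integral_exp_oscillation_le {b B θ : ℝ} {f : (Fin d → ℝ) → ℝ} (hf : IsBdd b f)
    (hB : 0 < B) (hosc : ∀ a l, 0 < l → ∫ x in cube a l, |f x - avg f a l| ≤ B * l ^ d)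
    (hθ : 0 ≤ θ) (hexp : Real.exp (θ * (2 * B + 2 ^ d * B)) ≤ 3 / 2)
    (a : Fin d → ℝ) {l : ℝ} (hl : 0 < l) :
    ∫ x in cube a l, Real.exp (θ * |f x - avg f a l|) ≤ 6 * l ^ d := by
  refine le_of_tendsto' (tendsto_integral_of_dominated_convergence
    (fun _ => Real.exp (θ * (b + |avg f a l|))) (fun N => ?_) (integrableOn_cube_const _ _ _)
    (fun N => ?_) ?_) fun N => integral_exp_dyadicAvg_le hf hB hosc hθ hexp N a l hl
  · exact (hf.integrableOn_exp_dyadicAvg hθ _ N a hl).aestronglyMeasurable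
  · refine (ae_restrict_iff' (measurableSet_cube _ _)).2 (Eventually.of_forall fun x hx => ?_)
    rw [Real.norm_eq_abs, Real.abs_exp]
    gcongr
    exact (abs_sub _ _).trans (by gcongr; exact hf.abs_dyadicAvg_le N a hl hx)
  · refine (ae_restrict_iff' (measurableSet_cube _ _)).2 ?_
    filter_upwards [ae_tendsto_dyadicAvg hf.locallyIntegrable a hl] with x hx hxa
    exact (Real.continuous_exp.tendsto _).comp (((hx hxa).sub_const _).abs.const_mul θ)

end PowerLawStokes

end

noncomputable section

namespace PowerLawStokes

variable {d : ℕ}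

/-! ### Periodic functions -/

/-- The lattice `ℤ^d`. -/
abbrev lattice (d : ℕ) : Submodule ℤ (Fin d → ℝ) :=
  Submodule.span ℤ (range (Pi.basisFun ℝ (Fin d)))

theorem single_mem_lattice (i : Fin d) : (Pi.single i 1 : Fin d → ℝ) ∈ lattice d :=
  Submodule.subset_span ⟨i, by simp⟩

theorem IsPeriodic.add_lattice {E : Type*} {f : (Fin d → ℝ) → E} (hf : IsPeriodic f)
    {g : Fin d → ℝ} (hg : g ∈ lattice d) (x : Fin d → ℝ) : f (x + g) = f x := by
  induction hg using Submodule.span_induction generalizing x with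
  | mem y hy =>
    obtain ⟨i, rfl⟩ := hy
    simpa using hf i x
  | zero => simp
  | add y z _ _ h1 h2 => rw [← add_assoc, h2, h1]
  | smul n y _ h =>
    induction n using Int.induction_on generalizing x with
    | zero => simp
    | succ n ih => rw [add_smul, one_smul, ← add_assoc, h, ih]
    | pred n ih => rw [sub_smul, one_smul, ← h, ← add_sub_assoc, sub_add_cancel, ih]

theorem cube_eq_fundamentalDomain :
    cube (0 : Fin d → ℝ) 1 = ZSpan.fundamentalDomain (Pi.basisFun ℝ (Fin d)) := by
  rw [ZSpan.fundamentalDomain_pi_basisFun, cube]; simp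

theorem exists_add_lattice_mem_cube (x : Fin d → ℝ) :
    ∃ g ∈ lattice d, x + g ∈ cube (0 : Fin d → ℝ) 1 := by
  obtain ⟨v, hv, -⟩ := ZSpan.exist_unique_vadd_mem_fundamentalDomain (Pi.basisFun ℝ (Fin d)) x
  refine ⟨v, v.2, ?_⟩
  rw [cube_eq_fundamentalDomain, add_comm]
  exact hv

theorem IsPeriodic.pd {f : (Fin d → ℝ) → ℝ} (hf : IsPeriodic f) (j : Fin d) :
    IsPeriodic (pd j f) := fun i x => by
  have h : (fun y => f (y + Pi.single i 1)) = f := funext fun y => hf i y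
  unfold PowerLawStokes.pd
  rw [← fderiv_comp_add_right, h]

theorem exists_isBdd_of_periodic {f : (Fin d → ℝ) → ℝ} (hf : IsPeriodic f) (hc : Continuous f) :
    ∃ b, IsBdd b f := by
  obtain ⟨b, hb⟩ := (isCompact_univ_pi fun _ : Fin d => isCompact_Icc (a := (0 : ℝ))
    (b := 1)).exists_bound_of_continuousOn hc.continuousOn
  refine ⟨b, hc.measurable, fun x => ?_⟩
  obtain ⟨g, hg, hx⟩ := exists_add_lattice_mem_cube x
  rw [← hf.add_lattice hg]
  refine hb _ fun i hi => ?_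
  have := hx i hi
  simp only [Pi.zero_apply, zero_add] at this
  exact Ico_subset_Icc_self this

theorem norm_le_of_mem_cube {x : Fin d → ℝ} (hx : x ∈ cube (0 : Fin d → ℝ) 1) : ‖x‖ ≤ 1 := by
  simpa using norm_sub_le_of_mem_cube hx zero_mem_cube

/-- The periodization of a function. -/
def perio (A : (Fin d → ℝ) → ℝ) (y : Fin d → ℝ) : ℝ := ∑' g : lattice d, A (y + g)

/-- The finite set depends on the radii only, so it serves a function and its partial derivatives at
once; periodizations are then locally finite sums. -/
theorem exists_finset_lattice (r R : ℝ) : ∃ I : Finset (lattice d),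
    ∀ A : (Fin d → ℝ) → ℝ, tsupport A ⊆ Metric.closedBall 0 r → ∀ y : Fin d → ℝ, ‖y‖ ≤ R →
      ∀ g ∉ I, A (y + (g : Fin d → ℝ)) = 0 := by
  have hfin := ZSpan.setFinite_inter (Pi.basisFun ℝ (Fin d))
    (Metric.isBounded_closedBall (x := (0 : Fin d → ℝ)) (r := r + R))
  have hfin' : {g : lattice d | ‖(g : Fin d → ℝ)‖ ≤ r + R}.Finite := by
    refine Set.Finite.of_finite_image (f := Subtype.val) (hfin.subset ?_)
      Subtype.val_injective.injOn
    rintro _ ⟨g, hg, rfl⟩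
    exact ⟨by simpa using hg, g.2⟩
  refine ⟨hfin'.toFinset, fun A hA y hy g hg => ?_⟩
  by_contra h
  apply hg
  have h1 := hA (subset_tsupport _ h)
  rw [mem_closedBall_zero_iff] at h1
  rw [Finite.mem_toFinset]
  change ‖(g : Fin d → ℝ)‖ ≤ r + R
  have h2 : ‖(g : Fin d → ℝ)‖ ≤ ‖y + g‖ + ‖y‖ := by
    simpa using norm_sub_le (y + (g : Fin d → ℝ)) y
  linarith

theorem IsTest.exists_tsupport_subset {A : (Fin d → ℝ) → ℝ} (hA : IsTest A) :
    ∃ r, tsupport A ⊆ Metric.closedBall 0 r :=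
  hA.compact.isCompact.isBounded.subset_closedBall 0

theorem perio_eventuallyEq {A : (Fin d → ℝ) → ℝ} {I : Finset (lattice d)} {x : Fin d → ℝ}
    (hI : ∀ y : Fin d → ℝ, ‖y‖ ≤ ‖x‖ + 1 → ∀ g ∉ I, A (y + (g : Fin d → ℝ)) = 0) :
    perio A =ᶠ[𝓝 x] fun y => ∑ g ∈ I, A (y + (g : Fin d → ℝ)) := by
  filter_upwards [Metric.ball_mem_nhds x one_pos] with y hy
  refine tsum_eq_sum fun g hg => hI y ?_ g hg
  rw [Metric.mem_ball, dist_eq_norm] at hy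
  have : ‖y‖ ≤ ‖y - x‖ + ‖x‖ := by simpa using norm_add_le (y - x) x
  linarith

theorem contDiff_perio {A : (Fin d → ℝ) → ℝ} (hA : IsTest A) : ContDiff ℝ ∞ (perio A) := by
  rw [contDiff_iff_contDiffAt]
  intro x
  obtain ⟨r, hr⟩ := hA.exists_tsupport_subset
  obtain ⟨I, hI⟩ := exists_finset_lattice (d := d) r (‖x‖ + 1)
  refine ContDiffAt.congr_of_eventuallyEq ?_ (perio_eventuallyEq (hI A hr))
  exact (ContDiff.sum fun g _ => hA.smooth.comp (contDiff_id.add contDiff_const)).contDiffAt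

theorem pd_perio {A : (Fin d → ℝ) → ℝ} (hA : IsTest A) (j : Fin d) :
    pd j (perio A) = perio (pd j A) := by
  funext x
  obtain ⟨r, hr⟩ := hA.exists_tsupport_subset
  obtain ⟨I, hI⟩ := exists_finset_lattice (d := d) r (‖x‖ + 1)
  rw [(perio_eventuallyEq (hI (pd j A) ((tsupport_pd_subset A j).trans hr))).eq_of_nhds]
  unfold pd
  have hdiff : ∀ g ∈ I, DifferentiableAt ℝ (fun y => A (y + (g : Fin d → ℝ))) x := fun g _ =>
    (hA.differentiable _).comp x (differentiableAt_id.add_const _)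
  rw [(perio_eventuallyEq (hI A hr)).fderiv_eq, fderiv_fun_sum hdiff]
  simp [fderiv_comp_add_right]

theorem isPeriodic_perio (A : (Fin d → ℝ) → ℝ) : IsPeriodic (perio A) := fun i x => by
  unfold perio
  rw [← (Equiv.addLeft (⟨_, single_mem_lattice i⟩ : lattice d)).tsum_eq fun g : lattice d =>
    A (x + (g : Fin d → ℝ))]
  simp [add_assoc]

/-- Unfolding: the integral over `ℝ^d` is split into lattice translates of the unit cube, and
periodicity of `G` moves the translations onto `A`. This passes from periodic test functions to
compactly supported ones. -/
theorem integral_mul_perio {A : (Fin d → ℝ) → ℝ} (hA : IsTest A) {b : ℝ} {G : (Fin d → ℝ) → ℝ}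
    (hG : IsBdd b G) (hGp : IsPeriodic G) :
    ∫ x, G x * perio A x ∂torusMeasure d = ∫ x, G x * A x := by
  obtain ⟨r, hr⟩ := hA.exists_tsupport_subset
  obtain ⟨I, hI⟩ := exists_finset_lattice (d := d) r 1
  have : VAddInvariantMeasure (lattice d) (Fin d → ℝ) volume :=
    ⟨fun g s _ => measure_preimage_add volume (g : Fin d → ℝ) s⟩
  have hfd := ZSpan.isAddFundamentalDomain (Pi.basisFun ℝ (Fin d)) volume
  rw [hfd.integral_eq_tsum'' _ (integrable_mul_of_compact hG.locallyIntegrable hA.continuous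
    hA.compact), ← cube_eq_fundamentalDomain, torusMeasure]
  have h1 : ∀ g : lattice d, ∫ x in cube (0 : Fin d → ℝ) 1, G (g +ᵥ x) * A (g +ᵥ x)
      = ∫ x in cube (0 : Fin d → ℝ) 1, G x * A (x + g) := fun g => by
    congr 1; funext x
    rw [Submodule.vadd_def, vadd_eq_add, add_comm, hGp.add_lattice g.2]
  simp_rw [h1]
  rw [tsum_eq_sum (s := I)]
  · rw [← integral_finsetSum]
    · refine setIntegral_congr_fun (measurableSet_cube _ _) fun x hx => ?_
      rw [perio, tsum_eq_sum (s := I) fun g hg => hI A hr x (norm_le_of_mem_cube hx) g hg,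
        Finset.mul_sum]
    · intro g _
      obtain ⟨b', hb'⟩ := (hA.comp_affine one_ne_zero (g : Fin d → ℝ)).continuous.bounded_above_of_compact_support
        (hA.comp_affine one_ne_zero (g : Fin d → ℝ)).compact
      refine IntegrableOn.integrable ?_
      refine Measure.integrableOn_of_bounded (M := b * b') (volume_cube_ne_top _ _) ?_ ?_
      · exact (hG.meas.mul (hA.continuous.measurable.comp
          (measurable_id.add_const _))).aestronglyMeasurable
      · refine Eventually.of_forall fun x => ?_
        rw [norm_mul]
        have h2 := hb' x
        rw [one_smul] at h2
        exact mul_le_mul (hG.le x) h2 (norm_nonneg _) hG.nonneg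
  · intro g hg
    rw [setIntegral_congr_fun (g := fun _ => (0 : ℝ)) (measurableSet_cube _ _) fun x hx => by
      simp only [hI A hr x (norm_le_of_mem_cube hx) g hg, mul_zero]]
    simp

theorem setIntegral_Icc_eq_torus (f : (Fin d → ℝ) → ℝ) :
    ∫ x in Icc (0 : Fin d → ℝ) 1, f x = ∫ x, f x ∂torusMeasure d := by
  rw [torusMeasure]
  refine (setIntegral_congr_set ?_).symm
  have := Measure.univ_pi_Ico_ae_eq_Icc (μ := fun _ : Fin d => (volume : Measure ℝ))
    (f := (0 : Fin d → ℝ)) (g := 1)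
  simpa [cube] using! this

/-- The divergence theorem on the unit cube for a field with a single nonzero component; the two
opposite faces cancel by periodicity. -/
theorem integral_pd_eq_zero {f : (Fin d → ℝ) → ℝ} (hf : ContDiff ℝ 1 f) (hp : IsPeriodic f)
    (i : Fin d) : ∫ x, pd i f x ∂torusMeasure d = 0 := by
  obtain ⟨n, rfl⟩ : ∃ n, d = n + 1 := ⟨d - 1, by have := i.pos; omega⟩
  rw [← setIntegral_Icc_eq_torus]
  have h := integral_divergence_of_hasFDerivAt_off_countable' (0 : Fin (n + 1) → ℝ) 1
    zero_le_one (fun j => if j = i then f else 0) (fun j x => if j = i then fderiv ℝ f x else 0)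
    ∅ countable_empty (fun j => by split_ifs; exacts [hf.continuous.continuousOn, continuousOn_const])
    (fun x _ j => by
      split_ifs
      exacts [(hf.differentiable one_ne_zero x).hasFDerivAt, hasFDerivAt_const _ _]) ?_
  · have e : ∀ x, (∑ j, (if j = i then fderiv ℝ f x else 0) (Pi.single j 1)) = pd i f x := by
      intro x
      rw [Finset.sum_eq_single i (fun j _ hj => by simp [hj]) (by simp)]
      simp [pd]
    simp only [e] at h
    rw [h, Finset.sum_eq_single i (fun j _ hj => by simp [hj]) (by simp), sub_eq_zero]
    congr 1; funext x
    simp only [if_true, Pi.one_apply, Pi.zero_apply]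
    rw [← hp i (i.insertNth 0 x)]
    congr 1
    funext k
    refine Fin.succAboveCases i ?_ (fun k => ?_) k <;> simp
  · have e : ∀ x, (∑ j, (if j = i then fderiv ℝ f x else 0) (Pi.single j 1)) = pd i f x := by
      intro x
      rw [Finset.sum_eq_single i (fun j _ hj => by simp [hj]) (by simp)]
      simp [pd]
    simp only [e]
    exact (continuous_pd hf i).continuousOn.integrableOn_compact isCompact_Icc

instance : IsProbabilityMeasure (torusMeasure d) :=
  ⟨by rw [torusMeasure, Measure.restrict_apply_univ, volume_cube]; simp⟩

theorem IsBdd.integrable_torus {b : ℝ} {f : (Fin d → ℝ) → ℝ} (hf : IsBdd b f) :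
    Integrable f (torusMeasure d) := hf.integrableOn_cube 0 1

theorem integrable_torus_of_continuous {f : (Fin d → ℝ) → ℝ} (hf : Continuous f) :
    Integrable f (torusMeasure d) := integrableOn_cube_of_continuous hf 0 1

/-! ### Periodic bounded stresses without divergence -/

/-- `W` is a bounded periodic matrix field with vanishing distributional divergence. -/
structure IsDivFree (W : Fin d → Fin d → (Fin d → ℝ) → ℝ) : Prop where
  bdd : ∃ b, ∀ i j, IsBdd b (W i j)
  periodic : ∀ i j, IsPeriodic (W i j)
  weak : ∀ φ : (Fin d → ℝ) → Fin d → ℝ, ContDiff ℝ ∞ φ → IsPeriodic φ →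
    ∫ x, ∑ i, ∑ j, W i j x * pd j (fun y => φ y i) x ∂torusMeasure d = 0

theorem IsBdd.mul {a b : ℝ} {f g : (Fin d → ℝ) → ℝ} (hf : IsBdd a f) (hg : IsBdd b g) :
    IsBdd (a * b) fun x => f x * g x :=
  ⟨hf.meas.mul hg.meas, fun x => by
    rw [abs_mul]; exact mul_le_mul (hf.le x) (hg.le x) (abs_nonneg _) hf.nonneg⟩

theorem IsBdd.add {a b : ℝ} {f g : (Fin d → ℝ) → ℝ} (hf : IsBdd a f) (hg : IsBdd b g) :
    IsBdd (a + b) fun x => f x + g x :=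
  ⟨hf.meas.add hg.meas, fun x => (abs_add_le _ _).trans (add_le_add (hf.le x) (hg.le x))⟩

theorem IsBdd.mono {a b : ℝ} {f : (Fin d → ℝ) → ℝ} (hf : IsBdd a f) (h : a ≤ b) : IsBdd b f :=
  ⟨hf.meas, fun x => (hf.le x).trans h⟩

/-- The test field is the gradient of the periodization of `A`: this is the step of taking the
divergence of the momentum equation. -/
theorem IsDivFree.integral_hessian {W : Fin d → Fin d → (Fin d → ℝ) → ℝ} (hW : IsDivFree W)
    {A : (Fin d → ℝ) → ℝ} (hA : IsTest A) : ∑ i, ∑ j, ∫ x, W i j x * pd i (pd j A) x = 0 := by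
  obtain ⟨b, hb⟩ := hW.bdd
  have h := hW.weak (fun x i => pd i (perio A) x)
    (contDiff_pi.2 fun i => contDiff_pd (contDiff_perio hA) i)
    (fun i x => funext fun j => (isPeriodic_perio A).pd j i x)
  have e : ∀ i j, (pd j fun x => pd i (perio A) x) = perio (pd i (pd j A)) := fun i j => by
    change pd j (pd i (perio A)) = _
    rw [pd_perio hA, pd_perio (hA.pd i), pd_comm hA.smooth]
  simp only [e] at h
  have hint : ∀ i j, Integrable (fun x => W i j x * perio (pd i (pd j A)) x) (torusMeasure d) := by
    intro i j
    obtain ⟨b', hb'⟩ := exists_isBdd_of_periodic (isPeriodic_perio (pd i (pd j A)))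
      (contDiff_perio ((hA.pd j).pd i)).continuous
    exact ((hb i j).mul hb').integrable_torus
  rw [integral_finsetSum _ fun i _ => integrable_finsetSum _ fun j _ => hint i j] at h
  rw [← h]
  refine Finset.sum_congr rfl fun i _ => ?_
  rw [integral_finsetSum _ fun j _ => hint i j]
  exact Finset.sum_congr rfl fun j _ =>
    (integral_mul_perio ((hA.pd j).pd i) (hb i j) (hW.periodic i j)).symm

theorem pd_conv' {g f : (Fin d → ℝ) → ℝ} (hg : IsTest g) (hf : ContDiff ℝ 1 f) (i : Fin d) :
    pd i (conv g f) = conv g (pd i f) := by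
  rw [pd_conv hg hf.continuous.locallyIntegrable]
  funext x
  have ht := hg.comp_affine (neg_ne_zero.2 one_ne_zero : (-1 : ℝ) ≠ 0) x
  have h := integral_mul_pd hf ht.contDiff_one ht.compact i
  rw [pd_comp_affine hg.differentiable] at h
  have e : ∀ z, (-1 : ℝ) • z + x = x - z := fun z => by rw [neg_one_smul]; abel
  simp only [e, neg_one_mul, mul_neg, integral_neg, neg_inj] at h
  exact h

theorem isPeriodic_conv {g f : (Fin d → ℝ) → ℝ} (hf : IsPeriodic f) :
    IsPeriodic (conv g f) := fun i x => by
  unfold conv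
  rw [← integral_add_right_eq_self _ (Pi.single i 1 : Fin d → ℝ)]
  congr 1; funext z
  rw [hf i z, add_sub_add_right_eq_sub]

/-- Smooth periodic fields may be replaced by `C¹` ones in the definition of `IsDivFree`. -/
theorem IsDivFree.integral_grad (hd : 0 < d) {W : Fin d → Fin d → (Fin d → ℝ) → ℝ}
    (hW : IsDivFree W) {u : (Fin d → ℝ) → Fin d → ℝ} (hu : ∀ i, ContDiff ℝ 1 fun x => u x i)
    (hup : ∀ i, IsPeriodic fun x => u x i) :
    ∫ x, ∑ i, ∑ j, W i j x * pd j (fun y => u y i) x ∂torusMeasure d = 0 := by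
  obtain ⟨b, hb⟩ := hW.bdd
  obtain ⟨η, -, h1, -, h3, -, h5, -⟩ := exists_kernel hd
  have hη : IsTest η := ⟨h1, h3⟩
  have hk : ∀ N : ℕ, IsTest (dil ((2 : ℝ) ^ N) η) := fun N => hη.dil (by positivity)
  choose v hv using fun i j => exists_isBdd_of_periodic ((hup i).pd j) (continuous_pd (hu i) j)
  have hpd : ∀ (N : ℕ) i j, pd j (conv (dil ((2 : ℝ) ^ N) η) fun y => u y i)
      = conv (dil ((2 : ℝ) ^ N) η) (pd j fun y => u y i) := fun N i j => pd_conv' (hk N) (hu i) j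
  have hbd : ∀ (N : ℕ) i j x, |conv (dil ((2 : ℝ) ^ N) η) (pd j fun y => u y i) x|
      ≤ v i j * ∫ z, |η z| := fun N i j x => by
    have e2 := abs_conv_le (hk N) (hv i j) x
    simp_rw [abs_dil η (show (0 : ℝ) < 2 ^ N by positivity)] at e2
    rwa [integral_dil (fun z => |η z|) (by positivity)] at e2
  -- The mollified field is smooth and periodic, hence admissible. Its gradient is the mollified
  -- gradient, which is uniformly bounded and converges almost everywhere.
  have hzero : ∀ N : ℕ, ∫ x, ∑ i, ∑ j, W i j x *
      conv (dil ((2 : ℝ) ^ N) η) (pd j fun y => u y i) x ∂torusMeasure d = 0 := fun N => by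
    have h := hW.weak (fun x i => conv (dil ((2 : ℝ) ^ N) η) (fun y => u y i) x)
      (contDiff_pi.2 fun i => contDiff_conv (hk N) (hu i).continuous.locallyIntegrable)
      (fun i x => funext fun j => isPeriodic_conv (hup j) i x)
    simpa only [hpd] using h
  have hlim : Tendsto (fun N : ℕ => ∫ x, ∑ i, ∑ j, W i j x *
      conv (dil ((2 : ℝ) ^ N) η) (pd j fun y => u y i) x ∂torusMeasure d) atTop
      (𝓝 (∫ x, ∑ i, ∑ j, W i j x * pd j (fun y => u y i) x ∂torusMeasure d)) := by
    refine tendsto_integral_of_dominated_convergence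
      (fun _ => ∑ i, ∑ j, b * (v i j * ∫ z, |η z|)) (fun N => ?_) (integrable_const _)
      (fun N => Eventually.of_forall fun x => ?_) ?_
    · refine Measurable.aestronglyMeasurable (Finset.measurable_sum _ fun i _ =>
        Finset.measurable_sum _ fun j _ => (hb i j).meas.mul ?_)
      exact (contDiff_conv (hk N)
        (continuous_pd (hu i) j).locallyIntegrable).continuous.measurable
    · refine (norm_sum_le _ _).trans (Finset.sum_le_sum fun i _ => (norm_sum_le _ _).trans
        (Finset.sum_le_sum fun j _ => ?_))
      rw [norm_mul]
      exact mul_le_mul ((hb i j).le x) (hbd N i j x) (norm_nonneg _) (hb i j).nonneg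
    · have hae : ∀ᵐ x, ∀ i j, Tendsto (fun N : ℕ =>
          conv (dil ((2 : ℝ) ^ N) η) (pd j fun y => u y i) x) atTop
          (𝓝 (pd j (fun y => u y i) x)) := by
        simp only [ae_all_iff]
        exact fun i j => ae_tendsto_conv_dil hη h5 (continuous_pd (hu i) j).locallyIntegrable
      filter_upwards [ae_restrict_of_ae hae] with x hx
      exact tendsto_finsetSum _ fun i _ => tendsto_finsetSum _ fun j _ => (hx i j).const_mul _
  simp only [hzero] at hlim
  exact (tendsto_nhds_unique hlim tendsto_const_nhds)

/-- A divergence-free stress of the form `S + ∇u + G I` gives `Δ(div u + G) = -∂ᵢ∂ⱼ Sᵢⱼ`. -/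
theorem IsDivFree.weakRel {S : Fin d → Fin d → (Fin d → ℝ) → ℝ} {G : (Fin d → ℝ) → ℝ}
    {u : (Fin d → ℝ) → Fin d → ℝ} {s g : ℝ} (hS : ∀ i j, IsBdd s (S i j)) (hG : IsBdd g G)
    (hu : ∀ i, ContDiff ℝ 1 fun x => u x i)
    (hW : IsDivFree fun i j x => S i j x + pd j (fun y => u y i) x + if i = j then G x else 0) :
    WeakRel (fun x => divg u x + G x) S := by
  intro A hA
  have h := hW.integral_hessian hA
  have hA2 : ∀ i j, IsTest (pd i (pd j A)) := fun i j => (hA.pd j).pd i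
  have iS : ∀ i j, Integrable fun x => S i j x * pd i (pd j A) x := fun i j =>
    integrable_mul_of_compact (hS i j).locallyIntegrable (hA2 i j).continuous (hA2 i j).compact
  have iG : ∀ i j, Integrable fun x => G x * pd i (pd j A) x := fun i j =>
    integrable_mul_of_compact hG.locallyIntegrable (hA2 i j).continuous (hA2 i j).compact
  have iu : ∀ k l i j, Integrable fun x => pd l (fun y => u y k) x * pd i (pd j A) x :=
    fun k l i j => integrable_mul_of_compact (continuous_pd (hu k) l).locallyIntegrable
      (hA2 i j).continuous (hA2 i j).compact
  -- Two integrations by parts exchange the derivatives, so that `∇u : ∇²A` integrates to the same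
  -- value as `div u ΔA`.
  have hparts : ∀ i j, ∫ x, pd j (fun y => u y i) x * pd i (pd j A) x
      = ∫ x, pd i (fun y => u y i) x * pd j (pd j A) x := fun i j => by
    have e1 := integral_mul_pd (hu i) (hA2 i j).contDiff_one (hA2 i j).compact j
    have e2 := integral_mul_pd (hu i) (hA2 j j).contDiff_one (hA2 j j).compact i
    rw [pd_comm hA.smooth i j, pd_comm (hA.pd i).smooth j j] at e1
    rw [pd_comm (hA.pd j).smooth i j, pd_comm hA.smooth i j] at e2
    rw [pd_comm hA.smooth i j]
    linarith
  have e1 : ∀ i j, ∫ x, (S i j x + pd j (fun y => u y i) x + if i = j then G x else 0)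
      * pd i (pd j A) x = (∫ x, S i j x * pd i (pd j A) x)
        + (∫ x, pd i (fun y => u y i) x * pd j (pd j A) x)
        + if i = j then ∫ x, G x * pd i (pd i A) x else 0 := fun i j => by
    rw [← hparts]
    by_cases hij : i = j
    · subst hij
      simp only [if_true, add_mul]
      have i1 : Integrable fun x => S i i x * pd i (pd i A) x
          + pd i (fun y => u y i) x * pd i (pd i A) x := (iS i i).add (iu i i i i)
      rw [integral_add i1 (iG i i), integral_add (iS i i) (iu i i i i)]
    · simp only [hij, if_false, add_mul, add_zero]
      rw [integral_add (iS i j) (iu i j i j)]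
  simp only [e1, Finset.sum_add_distrib, Finset.sum_ite_eq, Finset.mem_univ, if_true] at h
  have e2 : ∫ x, (divg u x + G x) * lap A x
      = (∑ i, ∑ j, ∫ x, pd i (fun y => u y i) x * pd j (pd j A) x)
        + ∑ i, ∫ x, G x * pd i (pd i A) x := by
    simp_rw [← integral_finsetSum _ fun j _ => iu _ _ j j]
    rw [← integral_finsetSum _ fun i _ => integrable_finsetSum _ fun j _ => iu i i j j,
      ← integral_finsetSum _ fun i _ => iG i i, ← integral_add
        (integrable_finsetSum _ fun i _ => integrable_finsetSum _ fun j _ => iu i i j j)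
        (integrable_finsetSum _ fun i _ => iG i i)]
    congr 1; funext x
    rw [divg, lap, add_mul, Finset.sum_mul_sum, Finset.mul_sum]
  rw [e2]
  linarith

end PowerLawStokes

end

noncomputable section

namespace PowerLawStokes

variable {d : ℕ}

/-! ### Viscosities -/

theorem ddot_self_nonneg (A : Matrix (Fin d) (Fin d) ℝ) : 0 ≤ ddot A A :=
  Finset.sum_nonneg fun _ _ => Finset.sum_nonneg fun _ _ => mul_self_nonneg _

theorem abs_apply_le_frob (A : Matrix (Fin d) (Fin d) ℝ) (i j : Fin d) : |A i j| ≤ frob A := by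
  refine Real.abs_le_sqrt ?_
  rw [pow_two]
  exact (Finset.single_le_sum (f := fun j => A i j * A i j) (fun _ _ => mul_self_nonneg _)
    (Finset.mem_univ j)).trans (Finset.single_le_sum (f := fun i => ∑ j, A i j * A i j)
      (fun _ _ => Finset.sum_nonneg fun _ _ => mul_self_nonneg _) (Finset.mem_univ i))

theorem frob_nonneg (A : Matrix (Fin d) (Fin d) ℝ) : 0 ≤ frob A := Real.sqrt_nonneg _

variable {K : ℝ} {μ₀ lam : ℝ → ℝ}

theorem IsViscosity.nonneg (hv : IsViscosity d K μ₀ lam) : 0 ≤ K := by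
  have := (hv.shear_nonneg 1 one_pos).trans (hv.shear_le 1 one_pos)
  simpa using this

theorem IsViscosity.abs_shear_mul_le (hv : IsViscosity d K μ₀ lam)
    (A : Matrix (Fin d) (Fin d) ℝ) (i j : Fin d) : |μ₀ (frob A) * A i j| ≤ K := by
  have h := abs_apply_le_frob A i j
  rcases (frob_nonneg A).eq_or_lt with h0 | h0
  · rw [← h0] at h
    rw [abs_eq_zero.1 (le_antisymm h (abs_nonneg _)), mul_zero, abs_zero]
    exact hv.nonneg
  · rw [abs_mul, abs_of_nonneg (hv.shear_nonneg _ h0)]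
    calc μ₀ (frob A) * |A i j| ≤ K / frob A * frob A :=
          mul_le_mul (hv.shear_le _ h0) h (abs_nonneg _) (div_nonneg hv.nonneg h0.le)
      _ = K := div_mul_cancel₀ _ h0.ne'

/-- The sign of `μ₀ 0` is not prescribed, but there it multiplies zero. -/
theorem IsViscosity.shear_mul_ddot_nonneg (hv : IsViscosity d K μ₀ lam)
    (A : Matrix (Fin d) (Fin d) ℝ) : 0 ≤ μ₀ (frob A) * ddot A A := by
  rcases (frob_nonneg A).eq_or_lt with h0 | h0
  · have : ddot A A = 0 := (Real.sqrt_eq_zero (ddot_self_nonneg A)).1 h0.symm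
    rw [this, mul_zero]
  · exact mul_nonneg (hv.shear_nonneg _ h0) (ddot_self_nonneg A)

theorem IsViscosity.abs_bulk_mul_le (hv : IsViscosity d K μ₀ lam) (s : ℝ) : |lam |s| * s| ≤ K := by
  rcases eq_or_ne s 0 with rfl | hs
  · simpa using hv.nonneg
  · have h0 := abs_pos.2 hs
    rw [abs_mul, abs_of_nonneg (hv.bulk_nonneg _ h0)]
    calc lam |s| * |s| ≤ K / |s| * |s| :=
          mul_le_mul_of_nonneg_right (hv.bulk_le _ h0) (abs_nonneg _)
      _ = K := div_mul_cancel₀ _ h0.ne'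

theorem IsViscosity.bulk_mul_sq_nonneg (hv : IsViscosity d K μ₀ lam) (s : ℝ) :
    0 ≤ lam |s| * s * s := by
  rcases eq_or_ne s 0 with rfl | hs
  · simp
  · rw [mul_assoc]
    exact mul_nonneg (hv.bulk_nonneg _ (abs_pos.2 hs)) (mul_self_nonneg s)

/-- Matrix monotonicity restricted to the multiples of one matrix unit. It serves to obtain
measurability, since a monotone real function is measurable. -/
theorem IsViscosity.monotone_shear (hd : 0 < d) (hv : IsViscosity d K μ₀ lam) :
    Monotone fun z : ℝ => μ₀ |z| * z := by
  set i₀ : Fin d := ⟨0, hd⟩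
  have hdd : ∀ p q : ℝ, ddot (Matrix.single i₀ i₀ p) (Matrix.single i₀ i₀ q) = p * q := by
    intro p q
    rw [ddot, Finset.sum_eq_single i₀, Finset.sum_eq_single i₀]
    · simp
    · intro j _ hj; simp [Matrix.single_apply_of_ne, hj.symm]
    · simp
    · intro i _ hi
      exact Finset.sum_eq_zero fun j _ => by simp [Matrix.single_apply_of_ne, hi.symm]
    · simp
  have hfrob : ∀ p : ℝ, frob (Matrix.single i₀ i₀ p) = |p| := fun p => by
    rw [frob, hdd, Real.sqrt_mul_self_eq_abs]
  intro z w hzw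
  have h := hv.shear_mono (Matrix.single i₀ i₀ w) (Matrix.single i₀ i₀ z)
  have hsub : ∀ p q : ℝ, Matrix.single i₀ i₀ p - Matrix.single i₀ i₀ q
      = Matrix.single i₀ i₀ (p - q) := fun p q =>
    (map_sub (Matrix.singleAddMonoidHom i₀ i₀) p q).symm
  rw [hfrob, hfrob, Matrix.smul_single, Matrix.smul_single, hsub, hsub, hdd] at h
  simp only [smul_eq_mul] at h
  rcases hzw.eq_or_lt with rfl | hlt
  · exact le_rfl
  · have := nonneg_of_mul_nonneg_left h (sub_pos.2 hlt)
    simp only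
    linarith

/-- The right side is built from the measurable function `z ↦ μ₀ |z| * z`. When `frob A = 0` both
sides vanish because `A i j = 0`. -/
theorem IsViscosity.shear_mul_eq (A : Matrix (Fin d) (Fin d) ℝ) (i j : Fin d) :
    μ₀ (frob A) * A i j = μ₀ |frob A| * frob A / frob A * A i j := by
  rcases (frob_nonneg A).eq_or_lt with h0 | h0
  · have h := abs_apply_le_frob A i j
    rw [← h0] at h
    rw [abs_eq_zero.1 (le_antisymm h (abs_nonneg _)), mul_zero, mul_zero]
  · rw [abs_of_pos h0, mul_div_assoc, div_self h0.ne', mul_one]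

/-! ### The momentum equation at a fixed time -/

/-- A density and a velocity field that satisfy the momentum equation at a fixed time. -/
structure IsSlice (γ : ℝ) (μ₀ lam : ℝ → ℝ) (ϱ : (Fin d → ℝ) → ℝ) (u : (Fin d → ℝ) → Fin d → ℝ) :
    Prop where
  density_cont : Continuous ϱ
  density_per : IsPeriodic ϱ
  density_nonneg : ∀ x, 0 ≤ ϱ x
  vel_smooth : ∀ i, ContDiff ℝ 1 fun x => u x i
  vel_per : ∀ i, IsPeriodic fun x => u x i
  momentum : ∀ φ : (Fin d → ℝ) → Fin d → ℝ, ContDiff ℝ ∞ φ → IsPeriodic φ →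
      ∫ x, (μ₀ (frob (symGrad u x)) * ddot (symGrad u x) (symGrad φ x)
        + ddot (grad u x) (grad φ x)
        + (1 + lam |divg u x|) * divg u x * divg φ x
        - ϱ x ^ γ * divg φ x) ∂torusMeasure d = 0

/-- The effective viscous flux. -/
def flux (γ : ℝ) (lam : ℝ → ℝ) (ϱ : (Fin d → ℝ) → ℝ) (u : (Fin d → ℝ) → Fin d → ℝ)
    (x : Fin d → ℝ) : ℝ := (2 + lam |divg u x|) * divg u x - ϱ x ^ γ

/-- The stress without the part `∇u`. -/
def shear (μ₀ : ℝ → ℝ) (u : (Fin d → ℝ) → Fin d → ℝ) (i j : Fin d) (x : Fin d → ℝ) : ℝ :=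
  μ₀ (frob (symGrad u x)) * symGrad u x i j

/-- The spherical part of the stress. -/
def sphere (γ : ℝ) (lam : ℝ → ℝ) (ϱ : (Fin d → ℝ) → ℝ) (u : (Fin d → ℝ) → Fin d → ℝ)
    (x : Fin d → ℝ) : ℝ := (1 + lam |divg u x|) * divg u x - ϱ x ^ γ

theorem symGrad_apply (u : (Fin d → ℝ) → Fin d → ℝ) (x : Fin d → ℝ) (i j : Fin d) :
    symGrad u x i j = 1 / 2 * (pd j (fun y => u y i) x + pd i (fun y => u y j) x) := by
  simp [symGrad, grad]

theorem symGrad_symm (u : (Fin d → ℝ) → Fin d → ℝ) (x : Fin d → ℝ) (i j : Fin d) :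
    symGrad u x i j = symGrad u x j i := by
  rw [symGrad_apply, symGrad_apply, add_comm]

theorem ddot_symGrad (u φ : (Fin d → ℝ) → Fin d → ℝ) (x : Fin d → ℝ) :
    ddot (symGrad u x) (symGrad φ x) = ∑ i, ∑ j, symGrad u x i j * pd j (fun y => φ y i) x := by
  have e : ddot (symGrad u x) (symGrad φ x)
      = 1 / 2 * (∑ i, ∑ j, symGrad u x i j * pd j (fun y => φ y i) x)
        + 1 / 2 * ∑ i, ∑ j, symGrad u x i j * pd i (fun y => φ y j) x := by
    simp only [ddot, symGrad_apply φ, Finset.mul_sum, ← Finset.sum_add_distrib]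
    refine Finset.sum_congr rfl fun i _ => Finset.sum_congr rfl fun j _ => ?_
    ring
  rw [e, Finset.sum_comm (f := fun i j => symGrad u x i j * pd i (fun y => φ y j) x)]
  simp_rw [fun i j => symGrad_symm u x j i]
  rw [← add_mul]; norm_num

/-- The power expended by the stress. -/
theorem sum_stress_mul (γ : ℝ) (μ₀ lam : ℝ → ℝ) (ϱ : (Fin d → ℝ) → ℝ)
    (u φ : (Fin d → ℝ) → Fin d → ℝ) (x : Fin d → ℝ) :
    ∑ i, ∑ j, (shear μ₀ u i j x + pd j (fun y => u y i) x
        + if i = j then sphere γ lam ϱ u x else 0) * pd j (fun y => φ y i) x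
      = μ₀ (frob (symGrad u x)) * ddot (symGrad u x) (symGrad φ x)
        + ddot (grad u x) (grad φ x)
        + (1 + lam |divg u x|) * divg u x * divg φ x
        - ϱ x ^ γ * divg φ x := by
  rw [ddot_symGrad, show divg φ x = ∑ i, pd i (fun y => φ y i) x from rfl]
  simp only [add_mul, Finset.sum_add_distrib, ite_mul, zero_mul, Finset.sum_ite_eq,
    Finset.mem_univ, if_true, shear, mul_assoc, ← Finset.mul_sum]
  simp only [ddot, grad, Matrix.of_apply, sphere]
  ring

section Slice

variable {γ : ℝ} {ϱ : (Fin d → ℝ) → ℝ} {u : (Fin d → ℝ) → Fin d → ℝ}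

theorem IsSlice.continuous_pd (h : IsSlice γ μ₀ lam ϱ u) (i j : Fin d) :
    Continuous (pd j fun y => u y i) := PowerLawStokes.continuous_pd (h.vel_smooth i) j

theorem IsSlice.continuous_divg (h : IsSlice γ μ₀ lam ϱ u) : Continuous (divg u) :=
  continuous_finsetSum _ fun i _ => h.continuous_pd i i

theorem IsSlice.periodic_divg (h : IsSlice γ μ₀ lam ϱ u) : IsPeriodic (divg u) := fun i x =>
  Finset.sum_congr rfl fun j _ => (h.vel_per j).pd j i x

theorem IsSlice.periodic_symGrad (h : IsSlice γ μ₀ lam ϱ u) : IsPeriodic (symGrad u) :=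
  fun i x => by
    ext k l
    rw [symGrad_apply, symGrad_apply, (h.vel_per k).pd l i x, (h.vel_per l).pd k i x]

theorem IsSlice.continuous_symGrad (h : IsSlice γ μ₀ lam ϱ u) (i j : Fin d) :
    Continuous fun x => symGrad u x i j := by
  simp only [symGrad_apply]
  exact continuous_const.mul ((h.continuous_pd i j).add (h.continuous_pd j i))

theorem IsSlice.continuous_rpow (h : IsSlice γ μ₀ lam ϱ u) (hγ : 1 ≤ γ) :
    Continuous fun x => ϱ x ^ γ :=
  h.density_cont.rpow_const fun _ => Or.inr (by linarith)

theorem IsSlice.isBdd_shear (hd : 0 < d) (hv : IsViscosity d K μ₀ lam)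
    (h : IsSlice γ μ₀ lam ϱ u) (i j : Fin d) : IsBdd K (shear μ₀ u i j) := by
  refine ⟨?_, fun x => hv.abs_shear_mul_le _ i j⟩
  have hf : Measurable fun x => frob (symGrad u x) := by
    unfold frob ddot
    exact (Continuous.sqrt (continuous_finsetSum _ fun i _ => continuous_finsetSum _ fun j _ =>
      (h.continuous_symGrad i j).mul (h.continuous_symGrad i j))).measurable
  have hm := (hv.monotone_shear hd).measurable
  unfold shear
  simp_rw [fun x => IsViscosity.shear_mul_eq (μ₀ := μ₀) (symGrad u x) i j]
  exact ((hm.comp hf).div hf).mul (h.continuous_symGrad i j).measurable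

theorem IsSlice.isBdd_bulk (hv : IsViscosity d K μ₀ lam) (h : IsSlice γ μ₀ lam ϱ u) :
    IsBdd K fun x => lam |divg u x| * divg u x :=
  ⟨hv.bulk_mono.measurable.comp h.continuous_divg.measurable, fun _ => hv.abs_bulk_mul_le _⟩

theorem IsSlice.exists_isBdd_sphere (hγ : 1 ≤ γ) (hv : IsViscosity d K μ₀ lam)
    (h : IsSlice γ μ₀ lam ϱ u) : ∃ b, IsBdd b (sphere γ lam ϱ u) := by
  obtain ⟨b₁, h₁⟩ := exists_isBdd_of_periodic h.periodic_divg h.continuous_divg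
  obtain ⟨b₂, h₂⟩ := exists_isBdd_of_periodic (f := fun x => -ϱ x ^ γ)
    (fun i x => by simp only [h.density_per i x]) (h.continuous_rpow hγ).neg
  refine ⟨b₁ + K + b₂, ?_⟩
  have := (h₁.add (h.isBdd_bulk hv)).add h₂
  convert this using 2 with x
  simp only [sphere]; ring

theorem flux_eq (γ : ℝ) (lam : ℝ → ℝ) (ϱ : (Fin d → ℝ) → ℝ) (u : (Fin d → ℝ) → Fin d → ℝ) :
    flux γ lam ϱ u = fun x => divg u x + sphere γ lam ϱ u x := by
  funext x; simp only [flux, sphere]; ring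

theorem IsSlice.exists_isBdd_flux (hγ : 1 ≤ γ) (hv : IsViscosity d K μ₀ lam)
    (h : IsSlice γ μ₀ lam ϱ u) : ∃ b, IsBdd b (flux γ lam ϱ u) := by
  obtain ⟨b₁, h₁⟩ := exists_isBdd_of_periodic h.periodic_divg h.continuous_divg
  obtain ⟨b₂, h₂⟩ := h.exists_isBdd_sphere hγ hv
  rw [flux_eq]
  exact ⟨_, h₁.add h₂⟩

theorem IsSlice.isDivFree (hd : 0 < d) (hγ : 1 ≤ γ) (hv : IsViscosity d K μ₀ lam)
    (h : IsSlice γ μ₀ lam ϱ u) :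
    IsDivFree fun i j x => shear μ₀ u i j x + pd j (fun y => u y i) x
      + if i = j then sphere γ lam ϱ u x else 0 := by
  obtain ⟨b, hb⟩ := h.exists_isBdd_sphere hγ hv
  choose v hv' using fun i j => exists_isBdd_of_periodic ((h.vel_per i).pd j) (h.continuous_pd i j)
  refine ⟨⟨K + ∑ i, ∑ j, v i j + b, fun i j => ?_⟩, fun i j k x => ?_, fun φ hφ hφp => ?_⟩
  · have h1 : IsBdd b fun x => if i = j then sphere γ lam ϱ u x else 0 := by
      split_ifs
      · exact hb
      · exact ⟨measurable_const, fun x => by simpa using hb.nonneg⟩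
    have h2 : v i j ≤ ∑ i, ∑ j, v i j :=
      (Finset.single_le_sum (f := fun j => v i j) (fun j _ => (hv' i j).nonneg)
        (Finset.mem_univ j)).trans (Finset.single_le_sum (f := fun i => ∑ j, v i j)
          (fun i _ => Finset.sum_nonneg fun j _ => (hv' i j).nonneg) (Finset.mem_univ i))
    exact (((h.isBdd_shear hd hv i j).add (hv' i j)).add h1).mono (by linarith)
  · simp only [shear, sphere, h.periodic_symGrad k x, (h.vel_per i).pd j k x,
      h.periodic_divg k x, h.density_per k x]
  · refine Eq.trans ?_ (h.momentum φ hφ hφp)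
    congr 1; funext x
    exact sum_stress_mul γ μ₀ lam ϱ u φ x

/-- The energy inequality. -/
theorem IsSlice.energy (hd : 0 < d) (hγ : 1 ≤ γ) (hv : IsViscosity d K μ₀ lam)
    (h : IsSlice γ μ₀ lam ϱ u) :
    ∫ x, ddot (grad u x) (grad u x) ∂torusMeasure d ≤ ∫ x, ϱ x ^ γ * divg u x ∂torusMeasure d := by
  have hW := h.isDivFree hd hγ hv
  have h0 := hW.integral_grad hd h.vel_smooth h.vel_per
  obtain ⟨b, hb⟩ := hW.bdd
  choose v hv' using fun i j => exists_isBdd_of_periodic ((h.vel_per i).pd j) (h.continuous_pd i j)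
  have i0 : Integrable (fun x => ∑ i, ∑ j, (shear μ₀ u i j x + pd j (fun y => u y i) x
      + if i = j then sphere γ lam ϱ u x else 0) * pd j (fun y => u y i) x) (torusMeasure d) :=
    integrable_finsetSum _ fun i _ => integrable_finsetSum _ fun j _ =>
      ((hb i j).mul (hv' i j)).integrable_torus
  have i1 : Integrable (fun x => ddot (grad u x) (grad u x)) (torusMeasure d) :=
    integrable_torus_of_continuous (continuous_finsetSum _ fun i _ => continuous_finsetSum _
      fun j _ => (h.continuous_pd i j).mul (h.continuous_pd i j))
  have i2 : Integrable (fun x => ϱ x ^ γ * divg u x) (torusMeasure d) :=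
    integrable_torus_of_continuous ((h.continuous_rpow hγ).mul h.continuous_divg)
  -- The shear term, the bulk term and `(div u)²` are nonnegative and are dropped.
  have h1 : ∫ x, (ddot (grad u x) (grad u x) - ϱ x ^ γ * divg u x) ∂torusMeasure d ≤ 0 := by
    rw [← h0]
    refine integral_mono (i1.sub i2) i0 fun x => ?_
    simp only [sum_stress_mul γ μ₀ lam ϱ u u x]
    have e1 := hv.shear_mul_ddot_nonneg (symGrad u x)
    have e2 := hv.bulk_mul_sq_nonneg (divg u x)
    have e3 := mul_self_nonneg (divg u x)
    nlinarith
  rw [integral_sub i1 i2] at h1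
  linarith

theorem IsSlice.integral_divg (h : IsSlice γ μ₀ lam ϱ u) :
    ∫ x, divg u x ∂torusMeasure d = 0 := by
  unfold divg
  rw [integral_finsetSum _ fun i _ => integrable_torus_of_continuous (h.continuous_pd i i)]
  exact Finset.sum_eq_zero fun i _ => integral_pd_eq_zero (h.vel_smooth i) (h.vel_per i) i

/-- The linear part of the flux has mean zero by periodicity, leaving the bounded bulk term and the
pressure. -/
theorem IsSlice.abs_avg_flux_le (hγ : 1 ≤ γ) (hv : IsViscosity d K μ₀ lam)
    (h : IsSlice γ μ₀ lam ϱ u) :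
    |avg (flux γ lam ϱ u) 0 1| ≤ K + ∫ x, ϱ x ^ γ ∂torusMeasure d := by
  have i1 := (integrable_torus_of_continuous h.continuous_divg).const_mul 2
  have i2 := (h.isBdd_bulk hv).integrable_torus
  have i3 := integrable_torus_of_continuous (h.continuous_rpow hγ)
  have e : ∫ x, flux γ lam ϱ u x ∂torusMeasure d
      = ∫ x, lam |divg u x| * divg u x ∂torusMeasure d - ∫ x, ϱ x ^ γ ∂torusMeasure d := by
    have : flux γ lam ϱ u = fun x => 2 * divg u x + (lam |divg u x| * divg u x - ϱ x ^ γ) := by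
      funext x; simp only [flux]; ring
    have i4 : Integrable (fun x => lam |divg u x| * divg u x - ϱ x ^ γ) (torusMeasure d) :=
      i2.sub i3
    rw [this, integral_add i1 i4, integral_const_mul, h.integral_divg, integral_sub i2 i3]
    ring
  have h1 : |∫ x, lam |divg u x| * divg u x ∂torusMeasure d| ≤ K := by
    refine abs_integral_le_integral_abs.trans ?_
    calc _ ≤ ∫ _x, K ∂torusMeasure d := integral_mono i2.abs (integrable_const _)
          fun x => (h.isBdd_bulk hv).le x
      _ = K := by simp
  have h2 : 0 ≤ ∫ x, ϱ x ^ γ ∂torusMeasure d :=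
    integral_nonneg fun x => Real.rpow_nonneg (h.density_nonneg x) _
  have e2 : avg (flux γ lam ϱ u) 0 1 = ∫ x, flux γ lam ϱ u x ∂torusMeasure d := by
    rw [avg_eq _ _ zero_le_one, one_pow, inv_one, one_mul, torusMeasure]
  rw [e2, e]
  refine (abs_sub _ _).trans ?_
  rw [abs_of_nonneg h2]
  linarith

end Slice

/-! ### Oscillation and exponential integrability of the flux -/

/-- Bounds for the effective viscous flux that depend only on `d` and `K`. -/
theorem exists_flux_bounds (hd : 0 < d) (K : ℝ) : ∃ C θ : ℝ, 0 < C ∧ 0 < θ ∧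
    ∀ (γ : ℝ) (μ₀ lam : ℝ → ℝ) (ϱ : (Fin d → ℝ) → ℝ) (u : (Fin d → ℝ) → Fin d → ℝ),
      1 ≤ γ → IsViscosity d K μ₀ lam → IsSlice γ μ₀ lam ϱ u →
      (∀ (a : Fin d → ℝ) (l : ℝ), 0 < l →
        ∫ x in cube a l, |flux γ lam ϱ u x - avg (flux γ lam ϱ u) a l| ≤ C * l ^ d) ∧
      ∫ x, Real.exp (θ * |flux γ lam ϱ u x - avg (flux γ lam ϱ u) 0 1|) ∂torusMeasure d ≤ 6 := by
  obtain ⟨C, hC, hosc⟩ := exists_oscillation_le hd K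
  -- The factor 2 is the cost of replacing an arbitrary constant by the mean; the 1 makes `B`
  -- positive, as the exponential estimate requires.
  set B := 2 * C + 1 with hB
  have hB0 : 0 < B := by positivity
  have hden : 0 < 2 * B + 2 ^ d * B := by positivity
  -- The largest exponent allowed by the `3/2` condition.
  set θ := Real.log (3 / 2) / (2 * B + 2 ^ d * B) with hθ
  have hθ0 : 0 < θ := div_pos (Real.log_pos (by norm_num)) hden
  refine ⟨B, θ, hB0, hθ0, fun γ μ₀ lam ϱ u hγ hv h => ?_⟩
  obtain ⟨b, hb⟩ := h.exists_isBdd_flux hγ hv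
  obtain ⟨b', hb'⟩ := h.exists_isBdd_sphere hγ hv
  have hrel := (h.isDivFree hd hγ hv).weakRel (h.isBdd_shear hd hv) hb' h.vel_smooth
  rw [← flux_eq] at hrel
  have hO : ∀ (a : Fin d → ℝ) (l : ℝ), 0 < l →
      ∫ x in cube a l, |flux γ lam ϱ u x - avg (flux γ lam ϱ u) a l| ≤ B * l ^ d := by
    intro a l hl
    obtain ⟨c, hc⟩ := hosc b _ _ hb (h.isBdd_shear hd hv) hrel a l hl
    have h1 := pow_mul_abs_avg_sub_le hl (hb.integrableOn_cube a l) c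
    have hint : ∀ c, IntegrableOn (fun x => |flux γ lam ϱ u x - c|) (cube a l) := fun c =>
      ((hb.integrableOn_cube a l).sub (integrableOn_cube_const c a l)).abs
    calc _ ≤ ∫ x in cube a l, (|flux γ lam ϱ u x - c| + |avg (flux γ lam ϱ u) a l - c|) := by
          refine setIntegral_mono (hint _) ((hint c).add (integrableOn_cube_const _ _ _))
            fun x => ?_
          have := abs_sub_le (flux γ lam ϱ u x) c (avg (flux γ lam ϱ u) a l)
          rwa [abs_sub_comm c] at this
      _ = (∫ x in cube a l, |flux γ lam ϱ u x - c|) + l ^ d * |avg (flux γ lam ϱ u) a l - c| := by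
          rw [integral_add (hint c) (integrableOn_cube_const _ _ _), setIntegral_const,
            volume_real_cube _ hl.le, smul_eq_mul]
      _ ≤ B * l ^ d := by
          have : 0 < l ^ d := by positivity
          rw [hB]; nlinarith
  refine ⟨hO, ?_⟩
  have hexp : Real.exp (θ * (2 * B + 2 ^ d * B)) ≤ 3 / 2 := by
    rw [hθ, div_mul_cancel₀ _ hden.ne', Real.exp_log (by norm_num)]
  have := integral_exp_oscillation_le hb hB0 hO hθ0.le hexp 0 one_pos
  simpa [torusMeasure] using this

end PowerLawStokes

end

noncomputable section

namespace PowerLawStokes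

variable {d : ℕ}

/-! ### Functions of time and space -/

/-- Functions on `[0,T] × ℝ^d` that are jointly continuous. -/
def JointCont (T : ℝ) (g : ℝ → (Fin d → ℝ) → ℝ) : Prop :=
  ContinuousOn (fun q : ℝ × (Fin d → ℝ) => g q.1 q.2) (Icc 0 T ×ˢ univ)

theorem JointCont.slice {T : ℝ} {g : ℝ → (Fin d → ℝ) → ℝ} (hg : JointCont T g) {t : ℝ}
    (ht : t ∈ Icc 0 T) : Continuous (g t) := by
  rw [← continuousOn_univ]
  exact hg.comp (f := fun x : Fin d → ℝ => (t, x)) (by fun_prop) fun x _ => ⟨ht, mem_univ x⟩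

theorem JointCont.time {T : ℝ} {g : ℝ → (Fin d → ℝ) → ℝ} (hg : JointCont T g)
    (x : Fin d → ℝ) : ContinuousOn (fun t => g t x) (Icc 0 T) :=
  hg.comp (f := fun t : ℝ => (t, x)) (by fun_prop) fun _ ht => ⟨ht, mem_univ x⟩

theorem JointCont.exists_bound {T : ℝ} {g : ℝ → (Fin d → ℝ) → ℝ} (hg : JointCont T g) :
    ∃ C, 0 ≤ C ∧ ∀ t ∈ Icc 0 T, ∀ x ∈ cube (0 : Fin d → ℝ) 1, |g t x| ≤ C := by
  obtain ⟨C, hC⟩ := (isCompact_Icc.prod (isCompact_univ_pi fun _ : Fin d =>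
    isCompact_Icc (a := (0 : ℝ)) (b := 1))).exists_bound_of_continuousOn
      (hg.mono (prod_mono_right (subset_univ _)))
  refine ⟨|C|, abs_nonneg _, fun t ht x hx => (hC (t, x) ⟨ht, fun i hi => ?_⟩).trans
    (le_abs_self C)⟩
  have := hx i hi
  simp only [Pi.zero_apply, zero_add] at this
  exact Ico_subset_Icc_self this

theorem ae_torus_mem : ∀ᵐ x ∂torusMeasure d, x ∈ cube (0 : Fin d → ℝ) 1 :=
  ae_restrict_mem (measurableSet_cube _ _)

theorem JointCont.continuousOn_integral {T : ℝ} {g : ℝ → (Fin d → ℝ) → ℝ} (hg : JointCont T g) :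
    ContinuousOn (fun t => ∫ x, g t x ∂torusMeasure d) (Icc 0 T) := by
  obtain ⟨C, -, hC⟩ := hg.exists_bound
  intro t ht
  refine continuousWithinAt_of_dominated (bound := fun _ => C) ?_ ?_ (integrable_const _) ?_
  · filter_upwards [self_mem_nhdsWithin] with s hs using (hg.slice hs).aestronglyMeasurable
  · filter_upwards [self_mem_nhdsWithin] with s hs
    filter_upwards [ae_torus_mem] with x hx using hC s hs x hx
  · exact Eventually.of_forall fun x => hg.time x t ht

theorem JointCont.integrable {T : ℝ} {g : ℝ → (Fin d → ℝ) → ℝ} (hg : JointCont T g) {t : ℝ}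
    (ht : t ∈ Icc 0 T) : Integrable (g t) (torusMeasure d) :=
  integrable_torus_of_continuous (hg.slice ht)

theorem JointCont.mul {T : ℝ} {f g : ℝ → (Fin d → ℝ) → ℝ} (hf : JointCont T f)
    (hg : JointCont T g) : JointCont T fun t x => f t x * g t x := ContinuousOn.mul hf hg

theorem JointCont.add {T : ℝ} {f g : ℝ → (Fin d → ℝ) → ℝ} (hf : JointCont T f)
    (hg : JointCont T g) : JointCont T fun t x => f t x + g t x := ContinuousOn.add hf hg

theorem JointCont.sum {T : ℝ} {ι : Type*} [Fintype ι] {f : ι → ℝ → (Fin d → ℝ) → ℝ}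
    (hf : ∀ i, JointCont T (f i)) : JointCont T fun t x => ∑ i, f i t x :=
  continuousOn_finsetSum _ fun i _ => hf i

theorem JointCont.comp {T : ℝ} {f : ℝ → (Fin d → ℝ) → ℝ} (hf : JointCont T f) {b : ℝ → ℝ}
    (hb : Continuous b) : JointCont T fun t x => b (f t x) := hb.comp_continuousOn hf

/-- The momentum equation holds for almost every time only, while integrating differential
inequalities below uses every time. Continuity in time closes the gap. -/
theorem le_of_ae_le_Ioo {T C : ℝ} {f : ℝ → ℝ} (hf : ContinuousOn f (Icc 0 T))
    (h : ∀ᵐ t ∂volume.restrict (Ioo 0 T), f t ≤ C) : ∀ t ∈ Ioo 0 T, f t ≤ C := by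
  have h1 : EqOn (fun t => max (f t) C) (fun _ => C) (Ioo 0 T) := by
    refine Measure.eqOn_open_of_ae_eq (μ := volume) ?_ isOpen_Ioo
      ((hf.mono Ioo_subset_Icc_self).sup continuousOn_const) continuousOn_const
    filter_upwards [h] with t ht using max_eq_right ht
  intro t ht
  exact max_eq_right_iff.1 (h1 ht)

theorem le_add_mul_of_hasDerivAt {T C : ℝ} {f f' : ℝ → ℝ} (hf : ContinuousOn f (Icc 0 T))
    (hf' : ∀ t ∈ Ioo 0 T, HasDerivAt f (f' t) t) (hC : ∀ t ∈ Ioo 0 T, f' t ≤ C) {t : ℝ}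
    (ht : t ∈ Icc 0 T) : f t ≤ f 0 + C * t := by
  have := (convex_Icc 0 T).image_sub_le_mul_sub_of_deriv_le hf
    (fun s hs => by
      rw [interior_Icc] at hs; exact (hf' s hs).differentiableAt.differentiableWithinAt)
    (C := C) (fun s hs => by rw [interior_Icc] at hs; rw [(hf' s hs).deriv]; exact hC s hs)
    0 (left_mem_Icc.2 (ht.1.trans ht.2)) t ht ht.1
  linarith

/-! ### The continuity equation -/

section Solution

variable {γ T : ℝ} {μ₀ lam : ℝ → ℝ} {ϱ₀ : (Fin d → ℝ) → ℝ} {ϱ : ℝ → (Fin d → ℝ) → ℝ}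
  {u : ℝ → (Fin d → ℝ) → Fin d → ℝ}

theorem IsSmoothSolution.jointCont_density (hs : IsSmoothSolution γ T μ₀ lam ϱ₀ ϱ u) :
    JointCont T ϱ := hs.density_smooth.continuousOn

theorem IsSmoothSolution.jointCont_pd (hs : IsSmoothSolution γ T μ₀ lam ϱ₀ ϱ u) (i j : Fin d) :
    JointCont T fun t x => pd j (fun y => u t y i) x := (hs.velocity_smooth i).continuousOn_pd j

theorem IsSmoothSolution.jointCont_divg (hs : IsSmoothSolution γ T μ₀ lam ϱ₀ ϱ u) :
    JointCont T fun t x => divg (u t) x := JointCont.sum fun i => hs.jointCont_pd i i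

theorem pd_mul {f g : (Fin d → ℝ) → ℝ} (hf : ContDiff ℝ 1 f) (hg : ContDiff ℝ 1 g) (i : Fin d)
    (x : Fin d → ℝ) : pd i (fun y => f y * g y) x = f x * pd i g x + pd i f x * g x := by
  unfold pd
  rw [fderiv_fun_mul (hf.differentiable one_ne_zero x) (hg.differentiable one_ne_zero x)]
  simp [mul_comm]

theorem pd_comp {f : (Fin d → ℝ) → ℝ} {b : ℝ → ℝ} (hb : ContDiff ℝ 1 b) (hf : ContDiff ℝ 1 f)
    (i : Fin d) (x : Fin d → ℝ) : pd i (fun y => b (f y)) x = deriv b (f x) * pd i f x := by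
  have h := (hb.differentiable one_ne_zero (f x)).hasDerivAt.comp_hasFDerivAt x
    (hf.differentiable one_ne_zero x).hasFDerivAt
  unfold pd
  rw [show (fun y => b (f y)) = b ∘ f from rfl, h.fderiv]
  simp

theorem divg_smul {f : (Fin d → ℝ) → ℝ} {v : (Fin d → ℝ) → Fin d → ℝ} (hf : ContDiff ℝ 1 f)
    (hv : ∀ i, ContDiff ℝ 1 fun y => v y i) (x : Fin d → ℝ) :
    divg (fun y => f y • v y) x = f x * divg v x + ∑ i, pd i f x * v x i := by
  simp only [divg, Pi.smul_apply, smul_eq_mul, Finset.mul_sum, ← Finset.sum_add_distrib]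
  exact Finset.sum_congr rfl fun i _ => pd_mul hf (hv i) i x

/-- The renormalised continuity equation, integrated over the torus. -/
theorem IsSmoothSolution.hasDerivAt_integral (hs : IsSmoothSolution γ T μ₀ lam ϱ₀ ϱ u)
    {b : ℝ → ℝ} (hb : ContDiff ℝ 1 b) {t : ℝ} (ht : t ∈ Ioo 0 T) :
    HasDerivAt (fun s => ∫ x, b (ϱ s x) ∂torusMeasure d)
      (-∫ x, (deriv b (ϱ t x) * ϱ t x - b (ϱ t x)) * divg (u t) x ∂torusMeasure d) t := by
  have htI := Ioo_subset_Icc_self ht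
  have hb' : Continuous (deriv b) := hb.continuous_deriv le_rfl
  have hρ : ∀ s ∈ Icc 0 T, ContDiff ℝ 1 (ϱ s) := hs.density_smooth.contDiff
  have hu : ∀ s ∈ Icc 0 T, ∀ i, ContDiff ℝ 1 fun y => u s y i := fun s h i =>
    (hs.velocity_smooth i).contDiff s h
  have hJρ : ∀ i, JointCont T fun s x => pd i (ϱ s) x := hs.density_smooth.continuousOn_pd
  have hJu : ∀ i, JointCont T fun s x => u s x i := fun i => (hs.velocity_smooth i).continuousOn
  have hJ : JointCont T fun s x => deriv b (ϱ s x) *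
      -(ϱ s x * divg (u s) x + ∑ i, pd i (ϱ s) x * u s x i) :=
    (hs.jointCont_density.comp hb').mul (ContinuousOn.neg
      ((hs.jointCont_density.mul hs.jointCont_divg).add (JointCont.sum fun i =>
        (hJρ i).mul (hJu i))))
  obtain ⟨C, -, hC⟩ := hJ.exists_bound
  have hmain := (hasDerivAt_integral_of_dominated_loc_of_deriv_le (μ := torusMeasure d)
    (F := fun s x => b (ϱ s x)) (F' := fun s x => deriv b (ϱ s x) *
      -(ϱ s x * divg (u s) x + ∑ i, pd i (ϱ s) x * u s x i)) (bound := fun _ => C)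
    (s := Ioo 0 T) (x₀ := t) (Ioo_mem_nhds ht.1 ht.2) ?_ ?_ ?_ ?_ (integrable_const _) ?_).2
  · refine hmain.congr_deriv ?_
    rw [← integral_neg]
    have hsum : ∀ i, ContDiff ℝ 1 fun y => b (ϱ t y) * u t y i := fun i =>
      (hb.comp (hρ t htI)).mul (hu t htI i)
    have hper : ∀ i, IsPeriodic fun y => b (ϱ t y) * u t y i := fun i k x => by
      simp only [hs.density_smooth.periodic t htI k x]
      congr 1
      exact (hs.velocity_smooth i).periodic t htI k x
    have hzero : ∫ x, ∑ i, pd i (fun y => b (ϱ t y) * u t y i) x ∂torusMeasure d = 0 := by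
      rw [integral_finsetSum _ fun i _ => integrable_torus_of_continuous
        (continuous_pd (hsum i) i)]
      exact Finset.sum_eq_zero fun i _ => integral_pd_eq_zero (hsum i) (hper i) i
    -- The chain rule turns `-b'(ϱ) div (ϱu)` into `-(b'(ϱ)ϱ - b(ϱ)) div u - div (b(ϱ)u)`, whose
    -- last term integrates to zero.
    have hpt : ∀ x, deriv b (ϱ t x) * -(ϱ t x * divg (u t) x + ∑ i, pd i (ϱ t) x * u t x i)
        = -((deriv b (ϱ t x) * ϱ t x - b (ϱ t x)) * divg (u t) x)
          - ∑ i, pd i (fun y => b (ϱ t y) * u t y i) x := by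
      intro x
      have e : ∀ i, pd i (fun y => b (ϱ t y) * u t y i) x = b (ϱ t x) * pd i (fun y => u t y i) x
          + deriv b (ϱ t x) * (pd i (ϱ t) x * u t x i) := fun i => by
        rw [pd_mul (f := fun y => b (ϱ t y)) (hb.comp (hρ t htI)) (hu t htI i),
          pd_comp hb (hρ t htI), mul_assoc]
      simp only [e]
      rw [Finset.sum_add_distrib, ← Finset.mul_sum, ← Finset.mul_sum]
      rw [show ∑ i, pd i (fun y => u t y i) x = divg (u t) x from rfl]
      ring
    simp_rw [hpt]
    rw [integral_sub, hzero, sub_zero]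
    · refine integrable_torus_of_continuous (Continuous.neg ?_)
      have c1 := hs.jointCont_density.slice htI
      have c2 := hs.jointCont_divg.slice htI
      exact (((hb'.comp c1).mul c1).sub (hb.continuous.comp c1)).mul c2
    · exact integrable_finsetSum _ fun i _ => integrable_torus_of_continuous
        (continuous_pd (hsum i) i)
  · filter_upwards [Ioo_mem_nhds ht.1 ht.2] with s hs'
    exact ((hs.jointCont_density.comp hb.continuous).slice
      (Ioo_subset_Icc_self hs')).aestronglyMeasurable
  · exact (hs.jointCont_density.comp hb.continuous).integrable htI
  · exact (hJ.slice htI).aestronglyMeasurable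
  · filter_upwards [ae_torus_mem] with x hx s hs' using hC s (Ioo_subset_Icc_self hs') x hx
  · refine Eventually.of_forall fun x s hs' => ?_
    have h1 := hs.continuity s hs' x
    rw [divg_smul (hρ s (Ioo_subset_Icc_self hs')) (hu s (Ioo_subset_Icc_self hs'))] at h1
    exact (hb.differentiable one_ne_zero (ϱ s x)).hasDerivAt.comp s h1

theorem IsSmoothSolution.ae_isSlice (hs : IsSmoothSolution γ T μ₀ lam ϱ₀ ϱ u) :
    ∀ᵐ t ∂volume.restrict (Ioo 0 T), IsSlice γ μ₀ lam (ϱ t) (u t) := by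
  filter_upwards [hs.momentum, ae_restrict_mem measurableSet_Ioo] with t ht ht'
  have htI := Ioo_subset_Icc_self ht'
  exact ⟨(hs.density_smooth.contDiff t htI).continuous, hs.density_smooth.periodic t htI,
    hs.density_nonneg t htI, fun i => (hs.velocity_smooth i).contDiff t htI,
    fun i => (hs.velocity_smooth i).periodic t htI, ht⟩

theorem deriv_rpow_mul_sub {p : ℝ} (hp : 1 ≤ p) {s : ℝ} (hs : 0 ≤ s) :
    deriv (fun x : ℝ => x ^ p) s * s - s ^ p = (p - 1) * s ^ p := by
  rw [(Real.hasDerivAt_rpow_const (Or.inr hp)).deriv]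
  have : s ^ (p - 1) * s = s ^ p := by
    rcases hs.eq_or_lt with rfl | h
    · rw [mul_zero, Real.zero_rpow (by linarith)]
    · rw [← Real.rpow_add_one h.ne', sub_add_cancel]
  rw [mul_assoc, this]; ring

theorem contDiff_rpow {p : ℝ} (hp : 1 ≤ p) : ContDiff ℝ 1 fun x : ℝ => x ^ p := by
  have := Real.contDiff_rpow_const_of_le (p := p) (n := 1) (by simpa using hp)
  simpa using this

theorem IsSmoothSolution.hasDerivAt_integral_rpow (hs : IsSmoothSolution γ T μ₀ lam ϱ₀ ϱ u)
    {p : ℝ} (hp : 1 ≤ p) {t : ℝ} (ht : t ∈ Ioo 0 T) :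
    HasDerivAt (fun s => ∫ x, ϱ s x ^ p ∂torusMeasure d)
      (-((p - 1) * ∫ x, ϱ t x ^ p * divg (u t) x ∂torusMeasure d)) t := by
  refine (hs.hasDerivAt_integral (contDiff_rpow hp) ht).congr_deriv ?_
  rw [← integral_const_mul]
  congr 2; funext x
  rw [deriv_rpow_mul_sub hp (hs.density_nonneg t (Ioo_subset_Icc_self ht) x), mul_assoc]

theorem IsSmoothSolution.jointCont_rpow (hs : IsSmoothSolution γ T μ₀ lam ϱ₀ ϱ u)
    {p : ℝ} (hp : 1 ≤ p) : JointCont T fun t x => ϱ t x ^ p :=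
  hs.jointCont_density.comp (contDiff_rpow hp).continuous

theorem IsSmoothSolution.ae_initial_le (hs : IsSmoothSolution γ T μ₀ lam ϱ₀ ϱ u) (hT : 0 < T)
    {M : ℝ≥0} (hM : eLpNorm ϱ₀ ⊤ (torusMeasure d) ≤ M) :
    ∀ᵐ x ∂torusMeasure d, 0 ≤ ϱ 0 x ∧ ϱ 0 x ≤ M := by
  rw [eLpNorm_exponent_top] at hM
  filter_upwards [hs.initial, ae_le_eLpNormEssSup (f := ϱ₀) (μ := torusMeasure d)] with x h1 h2
  have h3 : ‖ϱ₀ x‖ₑ ≤ (M : ℝ≥0∞) := h2.trans hM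
  rw [enorm_eq_nnnorm, ENNReal.coe_le_coe, ← NNReal.coe_le_coe, coe_nnnorm] at h3
  refine ⟨hs.density_nonneg 0 (left_mem_Icc.2 hT.le) x, ?_⟩
  rw [h1]
  exact (le_abs_self _).trans h3

theorem IsSmoothSolution.integral_initial_le (hs : IsSmoothSolution γ T μ₀ lam ϱ₀ ϱ u)
    (hT : 0 < T) {M : ℝ≥0} (hM : eLpNorm ϱ₀ ⊤ (torusMeasure d) ≤ M) {p : ℝ} (hp : 1 ≤ p) :
    ∫ x, ϱ 0 x ^ p ∂torusMeasure d ≤ (M : ℝ) ^ p := by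
  calc _ ≤ ∫ _x, (M : ℝ) ^ p ∂torusMeasure d := by
        refine integral_mono_ae ((hs.jointCont_rpow hp).integrable (left_mem_Icc.2 hT.le))
          (integrable_const _) ?_
        filter_upwards [hs.ae_initial_le hT hM] with x hx
        exact Real.rpow_le_rpow hx.1 hx.2 (by linarith)
    _ = _ := by simp

variable {K : ℝ}

/-- The energy inequality bounds a nonnegative quantity by this integral at almost every time; the
integral is continuous in time. -/
theorem IsSmoothSolution.energy_nonneg (hd : 0 < d) (hγ : 1 ≤ γ) (hv : IsViscosity d K μ₀ lam)
    (hs : IsSmoothSolution γ T μ₀ lam ϱ₀ ϱ u) :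
    ∀ t ∈ Ioo 0 T, 0 ≤ ∫ x, ϱ t x ^ γ * divg (u t) x ∂torusMeasure d := by
  have hc := ((hs.jointCont_rpow hγ).mul hs.jointCont_divg).continuousOn_integral
  have h := le_of_ae_le_Ioo (C := 0) hc.neg (by
    filter_upwards [hs.ae_isSlice] with t ht
    have := (integral_nonneg fun x => ddot_self_nonneg (grad (u t) x)).trans (ht.energy hd hγ hv)
    simpa using this)
  intro t ht
  simpa using h t ht

/-- The time derivative is `-(γ - 1) ∫ ϱ^γ div u ≤ 0`. -/
theorem IsSmoothSolution.integral_rpow_le (hd : 0 < d) (hγ : 1 ≤ γ) (hv : IsViscosity d K μ₀ lam)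
    (hs : IsSmoothSolution γ T μ₀ lam ϱ₀ ϱ u) (hT : 0 < T) {M : ℝ≥0}
    (hM : eLpNorm ϱ₀ ⊤ (torusMeasure d) ≤ M) {t : ℝ} (ht : t ∈ Icc 0 T) :
    ∫ x, ϱ t x ^ γ ∂torusMeasure d ≤ (M : ℝ) ^ γ := by
  have h := le_add_mul_of_hasDerivAt (C := 0) (hs.jointCont_rpow hγ).continuousOn_integral
    (fun t ht => hs.hasDerivAt_integral_rpow hγ ht) (fun t ht => by
      have := mul_nonneg (sub_nonneg.2 hγ) (hs.energy_nonneg hd hγ hv t ht)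
      linarith) ht
  linarith [hs.integral_initial_le hT hM hγ]

/-- For `γ = 1` the power identity degenerates and `s log s` takes its place. Its regularisation is
smooth at vacuum, with an error in the renormalised source that is at most `δ` for `s ≥ 0`. -/
theorem log_profile_deriv {δ : ℝ} (hδ : 0 < δ) (s : ℝ) :
    deriv (fun s : ℝ => s * (Real.log (s ^ 2 + δ ^ 2) / 2)) s * s
      - s * (Real.log (s ^ 2 + δ ^ 2) / 2) = s - s * δ ^ 2 / (s ^ 2 + δ ^ 2) := by
  have hpos : 0 < s ^ 2 + δ ^ 2 := by positivity
  have h1 : HasDerivAt (fun s : ℝ => s ^ 2 + δ ^ 2) (2 * s) s := by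
    simpa using (hasDerivAt_pow 2 s).add_const (δ ^ 2)
  have h2 := (hasDerivAt_id s).mul ((h1.log hpos.ne').div_const 2)
  have h3 : deriv (fun s : ℝ => s * (Real.log (s ^ 2 + δ ^ 2) / 2)) s = _ := h2.deriv
  rw [h3]
  simp only [id]
  field_simp
  ring

/-- The total power of the pressure is bounded in terms of `γ` and the size of the initial
density. -/
theorem exists_energy_bound (hγ : 1 ≤ γ) (M : ℝ≥0) : ∃ C : ℝ, 0 ≤ C ∧
    ∀ (d : ℕ) (T : ℝ) (μ₀ lam : ℝ → ℝ) (ϱ₀ : (Fin d → ℝ) → ℝ) (ϱ : ℝ → (Fin d → ℝ) → ℝ)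
      (u : ℝ → (Fin d → ℝ) → Fin d → ℝ), 0 < T →
      eLpNorm ϱ₀ ⊤ (torusMeasure d) ≤ M → IsSmoothSolution γ T μ₀ lam ϱ₀ ϱ u →
      ∫ t in (0 : ℝ)..T, (∫ x, ϱ t x ^ γ * divg (u t) x ∂torusMeasure d) ≤ C := by
  rcases hγ.eq_or_lt with rfl | hγ1
  · refine ⟨M * (Real.log ((M : ℝ) ^ 2 + 1) / 2) + 1, ?_, fun d T μ₀ lam ϱ₀ ϱ u hT hM hs => ?_⟩
    · have : 0 ≤ Real.log ((M : ℝ) ^ 2 + 1) :=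
        Real.log_nonneg (by nlinarith [sq_nonneg (M : ℝ)])
      positivity
    obtain ⟨D, hD0, hD⟩ := hs.jointCont_divg.exists_bound
    simp only [Real.rpow_one]
    -- `D` depends on the solution, but it appears multiplied by `δ` and disappears as `δ → 0`.
    have key : ∀ δ ∈ Ioc (0 : ℝ) 1,
        ∫ t in (0 : ℝ)..T, (∫ x, ϱ t x * divg (u t) x ∂torusMeasure d)
          ≤ M * (Real.log ((M : ℝ) ^ 2 + 1) / 2) + 1 + δ * (D * T) := by
      intro δ hδ
      have hδ0 := hδ.1
      set b : ℝ → ℝ := fun s => s * (Real.log (s ^ 2 + δ ^ 2) / 2) with hb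
      have hbc : ContDiff ℝ 1 b := by
        refine contDiff_id.mul ((ContDiff.log (by fun_prop) fun s => ?_).div_const 2)
        positivity
      set r : ℝ → ℝ := fun s => s * δ ^ 2 / (s ^ 2 + δ ^ 2) with hr
      have hrc : Continuous r := by
        refine Continuous.div (by fun_prop) (by fun_prop) fun s => ?_
        positivity
      have hrle : ∀ s, 0 ≤ s → |r s| ≤ δ := fun s hs0 => by
        rw [abs_of_nonneg (by positivity), hr]
        simp only
        rw [div_le_iff₀ (by positivity)]
        nlinarith [sq_nonneg (s - δ), mul_nonneg hs0 hδ0.le, sq_nonneg s, sq_nonneg δ,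
          mul_pos hδ0 hδ0, mul_nonneg hδ0.le (sq_nonneg (s - δ))]
      have hJ1 : JointCont T fun t x => ϱ t x * divg (u t) x :=
        hs.jointCont_density.mul hs.jointCont_divg
      have hJ2 : JointCont T fun t x => r (ϱ t x) * divg (u t) x :=
        (hs.jointCont_density.comp hrc).mul hs.jointCont_divg
      have hJb := hs.jointCont_density.comp hbc.continuous
      have ii : ∀ {g : ℝ → (Fin d → ℝ) → ℝ}, JointCont T g → IntervalIntegrable
          (fun t => ∫ x, g t x ∂torusMeasure d) volume 0 T := fun hg =>
        ContinuousOn.intervalIntegrable (by rw [uIcc_of_le hT.le]; exact hg.continuousOn_integral)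
      have hder : ∀ t ∈ Ioo 0 T, HasDerivAt (fun s => ∫ x, b (ϱ s x) ∂torusMeasure d)
          ((∫ x, r (ϱ t x) * divg (u t) x ∂torusMeasure d)
            - ∫ x, ϱ t x * divg (u t) x ∂torusMeasure d) t := by
        intro t ht
        have htI := Ioo_subset_Icc_self ht
        refine (hs.hasDerivAt_integral hbc ht).congr_deriv ?_
        rw [← integral_sub (hJ2.integrable htI) (hJ1.integrable htI), ← integral_neg]
        congr 1; funext x
        rw [hb, log_profile_deriv hδ0]
        simp only [hr]; ring
      have hftc := intervalIntegral.integral_eq_sub_of_hasDerivAt_of_le hT.le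
        hJb.continuousOn_integral hder ((ii hJ2).sub (ii hJ1))
      rw [intervalIntegral.integral_sub (ii hJ2) (ii hJ1)] at hftc
      have h0 : ∫ x, b (ϱ 0 x) ∂torusMeasure d ≤ M * (Real.log ((M : ℝ) ^ 2 + 1) / 2) := by
        calc _ ≤ ∫ _x, (M : ℝ) * (Real.log ((M : ℝ) ^ 2 + 1) / 2) ∂torusMeasure d := by
              refine integral_mono_ae (hJb.integrable (left_mem_Icc.2 hT.le))
                (integrable_const _) ?_
              filter_upwards [hs.ae_initial_le hT hM] with x hx
              simp only [hb]
              have hle : Real.log (ϱ 0 x ^ 2 + δ ^ 2) ≤ Real.log ((M : ℝ) ^ 2 + 1) := by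
                refine Real.log_le_log (by positivity) (add_le_add
                  (pow_le_pow_left₀ hx.1 hx.2 2) ?_)
                nlinarith [hδ.2]
              have hnn : 0 ≤ Real.log ((M : ℝ) ^ 2 + 1) :=
                Real.log_nonneg (by nlinarith [sq_nonneg (M : ℝ)])
              exact (mul_le_mul_of_nonneg_left (by linarith) hx.1).trans
                (mul_le_mul_of_nonneg_right hx.2 (by positivity))
          _ = _ := by simp
      -- From `s log s ≥ s - 1 ≥ -1`, the regularisation only increasing the logarithm.
      have hT1 : -1 ≤ ∫ x, b (ϱ T x) ∂torusMeasure d := by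
        calc (-1 : ℝ) = ∫ _x, (-1 : ℝ) ∂torusMeasure d := by simp
          _ ≤ _ := by
              refine integral_mono (integrable_const _) (hJb.integrable (right_mem_Icc.2 hT.le))
                fun x => ?_
              have hx := hs.density_nonneg T (right_mem_Icc.2 hT.le) x
              simp only [hb]
              rcases hx.eq_or_lt with h | h
              · rw [← h]; norm_num
              · have h1 : Real.log (ϱ T x ^ 2) ≤ Real.log (ϱ T x ^ 2 + δ ^ 2) :=
                  Real.log_le_log (by positivity) (by linarith [sq_nonneg δ])
                rw [Real.log_pow] at h1
                have h2 := Real.one_sub_inv_le_log_of_pos h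
                have h3 : ϱ T x * (1 - (ϱ T x)⁻¹) = ϱ T x - 1 := by field_simp
                have h4 := mul_le_mul_of_nonneg_left h2 hx
                push_cast at h1
                nlinarith [mul_le_mul_of_nonneg_left h1 hx]
      have hrem : ∫ t in (0 : ℝ)..T, (∫ x, r (ϱ t x) * divg (u t) x ∂torusMeasure d)
          ≤ δ * (D * T) := by
        calc _ ≤ ∫ _t in (0 : ℝ)..T, δ * D := by
              refine intervalIntegral.integral_mono_on hT.le (ii hJ2)
                intervalIntegrable_const fun t ht => ?_
              calc _ ≤ ∫ _x, δ * D ∂torusMeasure d := by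
                    refine integral_mono_ae (hJ2.integrable ht) (integrable_const _) ?_
                    filter_upwards [ae_torus_mem] with x hx
                    refine (le_abs_self _).trans ?_
                    rw [abs_mul]
                    exact mul_le_mul (hrle _ (hs.density_nonneg t ht x)) (hD t ht x hx)
                      (abs_nonneg _) hδ0.le
                _ = _ := by simp
          _ = _ := by rw [intervalIntegral.integral_const, smul_eq_mul]; ring
      linarith
    have hlim : Tendsto (fun δ : ℝ => M * (Real.log ((M : ℝ) ^ 2 + 1) / 2) + 1 + δ * (D * T))
        (𝓝[>] 0) (𝓝 (M * (Real.log ((M : ℝ) ^ 2 + 1) / 2) + 1 + 0 * (D * T))) :=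
      ((continuous_const.add (continuous_id.mul continuous_const)).tendsto 0).mono_left
        nhdsWithin_le_nhds
    rw [zero_mul, add_zero] at hlim
    refine ge_of_tendsto hlim ?_
    filter_upwards [Ioc_mem_nhdsGT one_pos] with δ hδ using key δ hδ
  · refine ⟨(M : ℝ) ^ γ / (γ - 1), by
      have := sub_pos.2 hγ1; positivity, fun d T μ₀ lam ϱ₀ ϱ u hT hM hs => ?_⟩
    have hg : 0 < γ - 1 := sub_pos.2 hγ1
    have hJ : JointCont T fun t x => ϱ t x ^ γ * divg (u t) x :=
      (hs.jointCont_rpow hγ).mul hs.jointCont_divg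
    have ii : IntervalIntegrable
        (fun t => ∫ x, ϱ t x ^ γ * divg (u t) x ∂torusMeasure d) volume 0 T :=
      ContinuousOn.intervalIntegrable (by rw [uIcc_of_le hT.le]; exact hJ.continuousOn_integral)
    -- Here the energy identity suffices: `(γ - 1)` times the total power is the decrease of `∫
    -- ϱ^γ`.
    have hftc := intervalIntegral.integral_eq_sub_of_hasDerivAt_of_le hT.le
      (hs.jointCont_rpow hγ).continuousOn_integral
      (fun t ht => hs.hasDerivAt_integral_rpow hγ ht) (ii.const_mul _).neg
    rw [intervalIntegral.integral_neg, intervalIntegral.integral_const_mul] at hftc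
    have h0 := hs.integral_initial_le hT hM hγ
    have h1 : 0 ≤ ∫ x, ϱ T x ^ γ ∂torusMeasure d := integral_nonneg fun x =>
      Real.rpow_nonneg (hs.density_nonneg T (right_mem_Icc.2 hT.le) x) _
    rw [le_div_iff₀ hg]
    linarith

end Solution

end PowerLawStokes

end

noncomputable section

namespace PowerLawStokes

variable {d : ℕ}

/-! ### Norms -/

/-- The crude inequality `(1 + Z)^{1/p} ≤ 1 + Z` keeps roots out of the constants. -/
theorem eLpNorm_le_of_lintegral_le {α : Type*} [MeasurableSpace α] {μ : Measure α} {f : α → ℝ}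
    {p Z : ℝ} (hp : 1 ≤ p) (hZ : 0 ≤ Z)
    (h : ∫⁻ x, ENNReal.ofReal (|f x| ^ p) ∂μ ≤ ENNReal.ofReal Z) :
    eLpNorm f (ENNReal.ofReal p) μ ≤ ENNReal.ofReal (1 + Z) := by
  have hp0 : 0 < p := by linarith
  rw [eLpNorm_eq_lintegral_rpow_enorm_toReal (by simpa using hp0) ENNReal.ofReal_ne_top,
    ENNReal.toReal_ofReal hp0.le]
  have e : ∀ x, ‖f x‖ₑ ^ p = ENNReal.ofReal (|f x| ^ p) := fun x => by
    rw [Real.enorm_eq_ofReal_abs, ENNReal.ofReal_rpow_of_nonneg (abs_nonneg _) hp0.le]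
  simp_rw [e]
  have h1 : (1 : ℝ≥0∞) ≤ ENNReal.ofReal (1 + Z) := by
    rw [← ENNReal.ofReal_one]; exact ENNReal.ofReal_le_ofReal (by linarith)
  calc _ ≤ ENNReal.ofReal (1 + Z) ^ (1 / p) :=
        ENNReal.rpow_le_rpow (h.trans (ENNReal.ofReal_le_ofReal (by linarith))) (by positivity)
    _ ≤ ENNReal.ofReal (1 + Z) ^ (1 : ℝ) :=
        ENNReal.rpow_le_rpow_of_exponent_le h1 (by rw [div_le_one hp0]; exact hp)
    _ = _ := ENNReal.rpow_one _

theorem eLpNorm_le_of_integral_le {f : (Fin d → ℝ) → ℝ} {p Z : ℝ} (hp : 1 ≤ p)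
    (hf : Integrable (fun x => |f x| ^ p) (torusMeasure d))
    (h : ∫ x, |f x| ^ p ∂torusMeasure d ≤ Z) :
    eLpNorm f (ENNReal.ofReal p) (torusMeasure d) ≤ ENNReal.ofReal (1 + Z) := by
  have h0 : ∀ x, 0 ≤ |f x| ^ p := fun x => Real.rpow_nonneg (abs_nonneg _) _
  refine eLpNorm_le_of_lintegral_le hp ((integral_nonneg h0).trans h) ?_
  rw [← ofReal_integral_eq_lintegral_ofReal hf (Eventually.of_forall h0)]
  exact ENNReal.ofReal_le_ofReal h

theorem bmoSeminorm_le {f : (Fin d → ℝ) → ℝ} {b C : ℝ} (hC : 0 ≤ C) (hf : IsBdd b f)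
    (h : ∀ a l, 0 < l → ∫ x in cube a l, |f x - avg f a l| ≤ C * l ^ d) :
    bmoSeminorm f ≤ ENNReal.ofReal C := by
  refine iSup_le fun a => iSup_le fun l => iSup_le fun hl => ?_
  have hint : Integrable (fun x => f x - avg f a l) (volume.restrict (cube a l)) :=
    (hf.integrableOn_cube a l).sub (integrableOn_cube_const _ _ _)
  have e : ∫⁻ x in cube a l, ‖f x - ⨍ y in cube a l, f y‖ₑ
      ≤ ENNReal.ofReal C * ENNReal.ofReal l ^ d := by
    refine (ofReal_integral_norm_eq_lintegral_enorm hint).symm.le.trans ?_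
    rw [← ENNReal.ofReal_pow hl.1.le, ← ENNReal.ofReal_mul hC]
    exact ENNReal.ofReal_le_ofReal (h a l hl.1)
  rw [volume_cube]
  have h0 : ENNReal.ofReal l ^ d ≠ 0 := pow_ne_zero _ (by simpa using hl.1)
  have ht : ENNReal.ofReal l ^ d ≠ ⊤ := ENNReal.pow_ne_top ENNReal.ofReal_ne_top
  calc _ ≤ (ENNReal.ofReal l ^ d)⁻¹ * (ENNReal.ofReal C * ENNReal.ofReal l ^ d) := by gcongr
    _ = ENNReal.ofReal C := by
        rw [mul_comm (ENNReal.ofReal C), ← mul_assoc, ENNReal.inv_mul_cancel h0 ht, one_mul]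

/-- Oscillation on the unit cube plus the mean controls the `L¹` norm by `C + m`; the second `C` is
the seminorm. -/
theorem bmoNorm_le {f : (Fin d → ℝ) → ℝ} {b C m : ℝ} (hC : 0 ≤ C) (hf : IsBdd b f)
    (h : ∀ a l, 0 < l → ∫ x in cube a l, |f x - avg f a l| ≤ C * l ^ d) (hm : |avg f 0 1| ≤ m) :
    bmoNorm f ≤ ENNReal.ofReal (2 * C + m) := by
  have hm0 : 0 ≤ m := (abs_nonneg _).trans hm
  have h1 : ∫ x, |f x| ∂torusMeasure d ≤ C + m := by
    have h2 := h 0 1 one_pos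
    rw [one_pow, mul_one] at h2
    have i1 : Integrable (fun x => |f x - avg f 0 1|) (torusMeasure d) :=
      (hf.integrable_torus.sub (integrable_const _)).abs
    calc _ ≤ ∫ x, (|f x - avg f 0 1| + m) ∂torusMeasure d := by
          refine integral_mono hf.integrable_torus.abs (i1.add (integrable_const _)) fun x => ?_
          have := abs_add_le (f x - avg f 0 1) (avg f 0 1)
          rw [sub_add_cancel] at this
          exact this.trans (by linarith)
      _ = (∫ x, |f x - avg f 0 1| ∂torusMeasure d) + m := by
          rw [integral_add i1 (integrable_const _)]; simp
      _ ≤ _ := by rw [torusMeasure]; linarith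
  have h3 : eLpNorm f 1 (torusMeasure d) ≤ ENNReal.ofReal (C + m) := by
    rw [eLpNorm_one_eq_lintegral_enorm, ← ofReal_integral_norm_eq_lintegral_enorm
      hf.integrable_torus]
    exact ENNReal.ofReal_le_ofReal h1
  calc bmoNorm f ≤ ENNReal.ofReal (C + m) + ENNReal.ofReal C :=
        add_le_add h3 (bmoSeminorm_le hC hf h)
    _ = _ := by rw [← ENNReal.ofReal_add (by positivity) hC]; congr 1; ring

/-! ### Moments of the flux, the density and the divergence -/

/-- Apply `s ≤ e^s` to `s = θ y / r` and raise to the power `r`. -/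
theorem rpow_le_mul_exp {r θ y : ℝ} (hr : 0 < r) (hθ : 0 < θ) (hy : 0 ≤ y) :
    y ^ r ≤ (r / θ) ^ r * Real.exp (θ * y) := by
  have h1 : y ≤ r / θ * Real.exp (θ * y / r) := by
    have := (lt_add_one _).le.trans (Real.add_one_le_exp (θ * y / r))
    calc y = r / θ * (θ * y / r) := by field_simp
      _ ≤ _ := by gcongr
  calc y ^ r ≤ (r / θ * Real.exp (θ * y / r)) ^ r := Real.rpow_le_rpow hy h1 hr.le
    _ = _ := by
        rw [Real.mul_rpow (by positivity) (Real.exp_nonneg _), ← Real.exp_mul,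
          div_mul_cancel₀ _ hr.ne']

/-- The bound for the moment of order `r` of the flux. -/
def fluxMoment (θ K m r : ℝ) : ℝ := (r / θ) ^ r * (Real.exp (θ * (K + m)) * 6)

theorem fluxMoment_nonneg {θ K m r : ℝ} (hθ : 0 < θ) (hr : 0 < r) : 0 ≤ fluxMoment θ K m r := by
  unfold fluxMoment; positivity

theorem IsBdd.integral_rpow_le {f : (Fin d → ℝ) → ℝ} {b θ K m r : ℝ} (hf : IsBdd b f)
    (hθ : 0 < θ) (hr : 0 < r) (hK : 0 ≤ K) (hm : |avg f 0 1| ≤ m)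
    (h : ∫ x, Real.exp (θ * |f x - avg f 0 1|) ∂torusMeasure d ≤ 6) :
    Integrable (fun x => (|f x| + K) ^ r) (torusMeasure d) ∧
      ∫ x, (|f x| + K) ^ r ∂torusMeasure d ≤ fluxMoment θ K m r := by
  have i1 : IsBdd ((b + K) ^ r) fun x => (|f x| + K) ^ r := by
    refine ⟨by have := hf.meas; fun_prop, fun x => ?_⟩
    rw [abs_of_nonneg (Real.rpow_nonneg (by positivity) _)]
    exact Real.rpow_le_rpow (by positivity) (by linarith [hf.le x]) hr.le
  have i2 : IsBdd (Real.exp (θ * (b + |avg f 0 1|))) fun x => Real.exp (θ * |f x - avg f 0 1|) := by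
    refine ⟨by have := hf.meas; fun_prop, fun x => ?_⟩
    rw [Real.abs_exp]
    gcongr
    exact (abs_sub _ _).trans (by linarith [hf.le x])
  refine ⟨i1.integrable_torus, ?_⟩
  calc _ ≤ ∫ x, (r / θ) ^ r * (Real.exp (θ * (K + m)) *
        Real.exp (θ * |f x - avg f 0 1|)) ∂torusMeasure d := by
        refine integral_mono i1.integrable_torus ((i2.integrable_torus.const_mul _).const_mul _)
          fun x => ?_
        refine (rpow_le_mul_exp hr hθ (by positivity)).trans ?_
        rw [← Real.exp_add, ← mul_add]
        refine mul_le_mul_of_nonneg_left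
          (Real.exp_le_exp.2 (mul_le_mul_of_nonneg_left ?_ hθ.le)) (by positivity)
        have := abs_add_le (f x - avg f 0 1) (avg f 0 1)
        rw [sub_add_cancel] at this
        linarith
    _ ≤ _ := by
        rw [integral_const_mul, integral_const_mul, fluxMoment]
        gcongr

theorem IsViscosity.two_mul_divg {γ : ℝ} {lam : ℝ → ℝ} (ϱ : (Fin d → ℝ) → ℝ)
    (u : (Fin d → ℝ) → Fin d → ℝ) (x : Fin d → ℝ) :
    2 * divg u x = flux γ lam ϱ u x - lam |divg u x| * divg u x + ϱ x ^ γ := by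
  simp only [flux]; ring

/-- The damping effect of the pressure on the density. -/
theorem IsViscosity.neg_rpow_mul_divg_le {γ K : ℝ} {μ₀ lam : ℝ → ℝ} (hγ : 1 ≤ γ)
    (hv : IsViscosity d K μ₀ lam) {ϱ : (Fin d → ℝ) → ℝ} {u : (Fin d → ℝ) → Fin d → ℝ} {p : ℝ}
    (hp : 1 ≤ p) {x : Fin d → ℝ} (hx : 0 ≤ ϱ x) :
    -(ϱ x ^ p * divg u x) ≤ (|flux γ lam ϱ u x| + K) ^ ((p + γ) / γ) := by
  have hγ0 : 0 < γ := by linarith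
  set X := |flux γ lam ϱ u x| + K with hX
  have hX0 : 0 ≤ X := add_nonneg (abs_nonneg _) hv.nonneg
  have h1 : -divg u x ≤ 1 / 2 * (X - ϱ x ^ γ) := by
    have e := IsViscosity.two_mul_divg (γ := γ) (lam := lam) ϱ u x
    have e1 := (abs_le.1 (hv.abs_bulk_mul_le (divg u x))).2
    have e2 := neg_abs_le (flux γ lam ϱ u x)
    linarith
  have hp0 : 0 ≤ ϱ x ^ p := Real.rpow_nonneg hx _
  have h2 : -(ϱ x ^ p * divg u x) ≤ ϱ x ^ p * (1 / 2 * (X - ϱ x ^ γ)) := by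
    rw [← mul_neg]; exact mul_le_mul_of_nonneg_left h1 hp0
  refine h2.trans ?_
  -- Either the pressure dominates and the expression is nonpositive, or `ϱ^p ≤ X^{p/γ}`.
  rcases le_total X (ϱ x ^ γ) with hle | hle
  · exact (mul_nonpos_of_nonneg_of_nonpos hp0 (by linarith)).trans (Real.rpow_nonneg hX0 _)
  · have h3 : ϱ x ^ p ≤ X ^ (p / γ) := by
      calc ϱ x ^ p = (ϱ x ^ γ) ^ (p / γ) := by
            rw [← Real.rpow_mul hx, mul_div_cancel₀ _ hγ0.ne']
        _ ≤ _ := Real.rpow_le_rpow (Real.rpow_nonneg hx _) hle (by positivity)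
    have h4 : 1 / 2 * (X - ϱ x ^ γ) ≤ X := by
      have := Real.rpow_nonneg hx γ
      linarith
    calc _ ≤ X ^ (p / γ) * X :=
          mul_le_mul h3 h4 (by linarith) (Real.rpow_nonneg hX0 _)
      _ = X ^ ((p + γ) / γ) := by
          rw [add_div, div_self hγ0.ne', Real.rpow_add_one' hX0 (by positivity)]

theorem IsViscosity.abs_divg_le {γ K : ℝ} {μ₀ lam : ℝ → ℝ}
    (hv : IsViscosity d K μ₀ lam) {ϱ : (Fin d → ℝ) → ℝ} {u : (Fin d → ℝ) → Fin d → ℝ}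
    {x : Fin d → ℝ} (hx : 0 ≤ ϱ x) :
    |divg u x| ≤ (|flux γ lam ϱ u x| + K) + ϱ x ^ γ := by
  have e := IsViscosity.two_mul_divg (γ := γ) (lam := lam) ϱ u x
  have e1 := abs_le.1 (hv.abs_bulk_mul_le (divg u x))
  have e2 := neg_abs_le (flux γ lam ϱ u x)
  have e3 := le_abs_self (flux γ lam ϱ u x)
  have e4 := Real.rpow_nonneg hx γ
  have e5 := hv.nonneg
  rw [abs_le]
  constructor <;> linarith

theorem add_rpow_le {p a b : ℝ} (hp : 0 ≤ p) (ha : 0 ≤ a) (hb : 0 ≤ b) :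
    (a + b) ^ p ≤ 2 ^ p * (a ^ p + b ^ p) := by
  have h1 : a + b ≤ 2 * max a b := by linarith [le_max_left a b, le_max_right a b]
  have hm : 0 ≤ max a b := ha.trans (le_max_left _ _)
  calc (a + b) ^ p ≤ (2 * max a b) ^ p := Real.rpow_le_rpow (by positivity) h1 hp
    _ = 2 ^ p * max a b ^ p := Real.mul_rpow zero_le_two hm
    _ ≤ _ := by
        gcongr
        rcases max_choice a b with h | h <;> rw [h]
        · linarith [Real.rpow_nonneg hb p]
        · linarith [Real.rpow_nonneg ha p]

/-- The bound for the moment of order `p` of the density. -/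
def densityMoment (γ θ K M T p : ℝ) : ℝ :=
  M ^ p + (p - 1) * fluxMoment θ K (K + M ^ γ) ((p + γ) / γ) * T

/-- The bound for the moment of order `p` of the divergence. -/
def divgMoment (γ θ K M T p : ℝ) : ℝ :=
  2 ^ p * (fluxMoment θ K (K + M ^ γ) p + densityMoment γ θ K M T (γ * p))

section Solution

variable {γ T K θ B : ℝ} {μ₀ lam : ℝ → ℝ} {ϱ₀ : (Fin d → ℝ) → ℝ} {ϱ : ℝ → (Fin d → ℝ) → ℝ}
  {u : ℝ → (Fin d → ℝ) → Fin d → ℝ} {M : ℝ≥0}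

theorem IsSmoothSolution.ae_flux_moment (hd : 0 < d) (hγ : 1 ≤ γ)
    (hv : IsViscosity d K μ₀ lam) (hs : IsSmoothSolution γ T μ₀ lam ϱ₀ ϱ u) (hT : 0 < T)
    (hM : eLpNorm ϱ₀ ⊤ (torusMeasure d) ≤ M) (hθ : 0 < θ)
    (hexp : ∀ t, IsSlice γ μ₀ lam (ϱ t) (u t) → ∫ x, Real.exp (θ *
      |flux γ lam (ϱ t) (u t) x - avg (flux γ lam (ϱ t) (u t)) 0 1|) ∂torusMeasure d ≤ 6) :
    ∀ᵐ t ∂volume.restrict (Ioo 0 T), ∀ r : ℝ, 0 < r →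
      Integrable (fun x => (|flux γ lam (ϱ t) (u t) x| + K) ^ r) (torusMeasure d) ∧
      ∫ x, (|flux γ lam (ϱ t) (u t) x| + K) ^ r ∂torusMeasure d
        ≤ fluxMoment θ K (K + (M : ℝ) ^ γ) r := by
  filter_upwards [hs.ae_isSlice, ae_restrict_mem measurableSet_Ioo] with t ht htI r hr
  obtain ⟨b, hb⟩ := ht.exists_isBdd_flux hγ hv
  refine hb.integral_rpow_le hθ hr hv.nonneg ?_ (hexp t ht)
  have h1 := ht.abs_avg_flux_le hγ hv
  have h2 := hs.integral_rpow_le hd hγ hv hT hM (Ioo_subset_Icc_self htI)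
  linarith

/-- The pointwise damping bound makes the time derivative of `∫ ϱ^p` at most a constant multiple of
a flux moment, with no density left on the right. Growth is thus linear in time and no Gronwall
argument is needed. -/
theorem IsSmoothSolution.integral_density_le (hd : 0 < d) (hγ : 1 ≤ γ)
    (hv : IsViscosity d K μ₀ lam) (hs : IsSmoothSolution γ T μ₀ lam ϱ₀ ϱ u) (hT : 0 < T)
    (hM : eLpNorm ϱ₀ ⊤ (torusMeasure d) ≤ M) (hθ : 0 < θ)
    (hexp : ∀ t, IsSlice γ μ₀ lam (ϱ t) (u t) → ∫ x, Real.exp (θ *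
      |flux γ lam (ϱ t) (u t) x - avg (flux γ lam (ϱ t) (u t)) 0 1|) ∂torusMeasure d ≤ 6)
    {p : ℝ} (hp : 1 ≤ p) {t : ℝ} (ht : t ∈ Icc 0 T) :
    ∫ x, ϱ t x ^ p ∂torusMeasure d ≤ densityMoment γ θ K M T p := by
  have hr : 0 < (p + γ) / γ := by positivity
  have hJ : JointCont T fun t x => ϱ t x ^ p * divg (u t) x :=
    (hs.jointCont_rpow hp).mul hs.jointCont_divg
  set E := fluxMoment θ K (K + (M : ℝ) ^ γ) ((p + γ) / γ) with hE
  have hE0 : 0 ≤ E := fluxMoment_nonneg hθ hr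
  have hp1 : 0 ≤ p - 1 := sub_nonneg.2 hp
  have hC : ∀ t ∈ Ioo 0 T, -((p - 1) * ∫ x, ϱ t x ^ p * divg (u t) x ∂torusMeasure d)
      ≤ (p - 1) * E := by
    refine le_of_ae_le_Ioo (continuousOn_const.mul hJ.continuousOn_integral).neg ?_
    filter_upwards [hs.ae_flux_moment hd hγ hv hT hM hθ hexp,
      ae_restrict_mem measurableSet_Ioo] with t h1 htI
    have htI' := Ioo_subset_Icc_self htI
    obtain ⟨i1, h2⟩ := h1 _ hr
    rw [← mul_neg]
    refine mul_le_mul_of_nonneg_left (le_trans ?_ h2) hp1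
    rw [← integral_neg]
    exact integral_mono (hJ.integrable htI').neg i1 fun x =>
      hv.neg_rpow_mul_divg_le hγ hp (hs.density_nonneg t htI' x)
  have h := le_add_mul_of_hasDerivAt (hs.jointCont_rpow hp).continuousOn_integral
    (fun t ht => hs.hasDerivAt_integral_rpow hp ht) hC ht
  have h0 := hs.integral_initial_le hT hM hp
  have h3 : (p - 1) * E * t ≤ (p - 1) * E * T :=
    mul_le_mul_of_nonneg_left ht.2 (mul_nonneg hp1 hE0)
  rw [densityMoment]
  linarith

theorem IsSmoothSolution.normGradL2_le (hd : 0 < d) (hγ : 1 ≤ γ) (hv : IsViscosity d K μ₀ lam)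
    (hs : IsSmoothSolution γ T μ₀ lam ϱ₀ ϱ u) (hT : 0 < T) {C : ℝ} (hC : 0 ≤ C)
    (h : ∫ t in (0 : ℝ)..T, (∫ x, ϱ t x ^ γ * divg (u t) x ∂torusMeasure d) ≤ C) :
    normGradL2 T u ≤ ENNReal.ofReal (1 + C) := by
  have hJ : JointCont T fun t x => ddot (grad (u t) x) (grad (u t) x) :=
    JointCont.sum fun i => JointCont.sum fun j => (hs.jointCont_pd i j).mul (hs.jointCont_pd i j)
  have hJ2 : JointCont T fun t x => ϱ t x ^ γ * divg (u t) x :=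
    (hs.jointCont_rpow hγ).mul hs.jointCont_divg
  have e2 : (2 : ℝ≥0∞) = ENNReal.ofReal 2 := by simp
  rw [normGradL2, e2]
  refine eLpNorm_le_of_lintegral_le one_le_two hC ?_
  have e3 : ∀ q : ℝ × (Fin d → ℝ), |frob (grad (u q.1) q.2)| ^ (2 : ℝ)
      = ddot (grad (u q.1) q.2) (grad (u q.1) q.2) := fun q => by
    rw [Real.rpow_two, sq_abs, frob, Real.sq_sqrt (ddot_self_nonneg _)]
  simp_rw [e3]
  have hmeas : AEMeasurable (fun q : ℝ × (Fin d → ℝ) =>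
      ENNReal.ofReal (ddot (grad (u q.1) q.2) (grad (u q.1) q.2)))
      ((volume.restrict (Ioo 0 T)).prod (torusMeasure d)) := by
    rw [torusMeasure, Measure.prod_restrict]
    exact ((ContinuousOn.mono hJ (prod_mono Ioo_subset_Icc_self (subset_univ _))).aemeasurable
      (measurableSet_Ioo.prod (measurableSet_cube _ _))).ennreal_ofReal
  rw [lintegral_prod _ hmeas]
  calc _ ≤ ∫⁻ t in Ioo 0 T, ENNReal.ofReal (∫ x, ϱ t x ^ γ * divg (u t) x ∂torusMeasure d) := by
        refine lintegral_mono_ae ?_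
        filter_upwards [hs.ae_isSlice, ae_restrict_mem measurableSet_Ioo] with t ht htI
        rw [← ofReal_integral_eq_lintegral_ofReal (hJ.integrable (Ioo_subset_Icc_self htI))
          (Eventually.of_forall fun x => ddot_self_nonneg _)]
        exact ENNReal.ofReal_le_ofReal (ht.energy hd hγ hv)
    _ = ENNReal.ofReal (∫ t in Ioo 0 T, (∫ x, ϱ t x ^ γ * divg (u t) x ∂torusMeasure d)) := by
        rw [← ofReal_integral_eq_lintegral_ofReal]
        · exact (hJ2.continuousOn_integral.integrableOn_compact isCompact_Icc).mono_set
            Ioo_subset_Icc_self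
        · filter_upwards [ae_restrict_mem measurableSet_Ioo] with t ht
          exact hs.energy_nonneg hd hγ hv t ht
    _ ≤ _ := by
        refine ENNReal.ofReal_le_ofReal ?_
        rwa [intervalIntegral.integral_of_le hT.le, integral_Ioc_eq_integral_Ioo] at h

theorem IsSmoothSolution.normLinftyLp_density_le (hs : IsSmoothSolution γ T μ₀ lam ϱ₀ ϱ u)
    {p Z : ℝ} (hp : 1 ≤ p) (h : ∀ t ∈ Icc 0 T, ∫ x, ϱ t x ^ p ∂torusMeasure d ≤ Z) :
    normLinftyLp T p ϱ ≤ ENNReal.ofReal (1 + Z) := by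
  refine essSup_le_of_ae_le _ ?_
  filter_upwards [ae_restrict_mem measurableSet_Ioo] with t ht
  have htI := Ioo_subset_Icc_self ht
  have e : ∀ x, |ϱ t x| ^ p = ϱ t x ^ p := fun x => by
    rw [abs_of_nonneg (hs.density_nonneg t htI x)]
  refine eLpNorm_le_of_integral_le hp ?_ ?_
  · simp_rw [e]; exact (hs.jointCont_rpow hp).integrable htI
  · simp_rw [e]; exact h t htI

/-- Since `|div u| ≤ (|F| + K) + ϱ^γ`, the moment of order `p` costs the density moment of order `γ
p`. -/
theorem IsSmoothSolution.normLinftyLp_divg_le (hd : 0 < d) (hγ : 1 ≤ γ)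
    (hv : IsViscosity d K μ₀ lam) (hs : IsSmoothSolution γ T μ₀ lam ϱ₀ ϱ u) (hT : 0 < T)
    (hM : eLpNorm ϱ₀ ⊤ (torusMeasure d) ≤ M) (hθ : 0 < θ)
    (hexp : ∀ t, IsSlice γ μ₀ lam (ϱ t) (u t) → ∫ x, Real.exp (θ *
      |flux γ lam (ϱ t) (u t) x - avg (flux γ lam (ϱ t) (u t)) 0 1|) ∂torusMeasure d ≤ 6)
    {p : ℝ} (hp : 1 ≤ p) :
    normLinftyLp T p (fun t x => divg (u t) x)
      ≤ ENNReal.ofReal (1 + divgMoment γ θ K M T p) := by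
  have hp0 : 0 < p := by linarith
  have hγp : 1 ≤ γ * p := by nlinarith
  refine essSup_le_of_ae_le _ ?_
  filter_upwards [ae_restrict_mem measurableSet_Ioo, hs.ae_flux_moment hd hγ hv hT hM hθ hexp]
    with t ht h1
  have htI := Ioo_subset_Icc_self ht
  obtain ⟨i1, h2⟩ := h1 p hp0
  have h3 := hs.integral_density_le hd hγ hv hT hM hθ hexp hγp htI
  have i2 := (hs.jointCont_rpow hγp).integrable htI
  have i0 : Integrable (fun x => |divg (u t) x| ^ p) (torusMeasure d) :=
    integrable_torus_of_continuous ((hs.jointCont_divg.slice htI).abs.rpow_const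
      fun _ => Or.inr hp0.le)
  refine eLpNorm_le_of_integral_le hp i0 ?_
  calc _ ≤ ∫ x, 2 ^ p * ((|flux γ lam (ϱ t) (u t) x| + K) ^ p + ϱ t x ^ (γ * p))
          ∂torusMeasure d := by
        refine integral_mono i0 ((i1.add i2).const_mul _) fun x => ?_
        have hx := hs.density_nonneg t htI x
        dsimp only
        rw [Real.rpow_mul hx]
        exact (Real.rpow_le_rpow (abs_nonneg _) (hv.abs_divg_le hx) hp0.le).trans
          (add_rpow_le hp0.le (add_nonneg (abs_nonneg _) hv.nonneg) (Real.rpow_nonneg hx _))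
    _ ≤ _ := by
        rw [integral_const_mul, integral_add i1 i2, divgMoment]
        gcongr

theorem IsSmoothSolution.normLinftyBMO_flux_le (hd : 0 < d) (hγ : 1 ≤ γ)
    (hv : IsViscosity d K μ₀ lam) (hs : IsSmoothSolution γ T μ₀ lam ϱ₀ ϱ u) (hT : 0 < T)
    (hM : eLpNorm ϱ₀ ⊤ (torusMeasure d) ≤ M) (hB : 0 ≤ B)
    (hosc : ∀ t, IsSlice γ μ₀ lam (ϱ t) (u t) → ∀ (a : Fin d → ℝ) (l : ℝ), 0 < l →
      ∫ x in cube a l, |flux γ lam (ϱ t) (u t) x - avg (flux γ lam (ϱ t) (u t)) a l|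
        ≤ B * l ^ d) :
    normLinftyBMO T (fun t x => flux γ lam (ϱ t) (u t) x)
      ≤ ENNReal.ofReal (2 * B + (K + (M : ℝ) ^ γ)) := by
  refine essSup_le_of_ae_le _ ?_
  filter_upwards [hs.ae_isSlice, ae_restrict_mem measurableSet_Ioo] with t ht htI
  obtain ⟨b, hb⟩ := ht.exists_isBdd_flux hγ hv
  refine bmoNorm_le hB hb (hosc t ht) ?_
  have h1 := ht.abs_avg_flux_le hγ hv
  have h2 := hs.integral_rpow_le hd hγ hv hT hM (Ioo_subset_Icc_self htI)
  linarith

end Solution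

end PowerLawStokes

end

/-! ### Assembly of the constants -/

open PowerLawStokes in
theorem lemma2p1 (d : ℕ) (hd : 0 < d) (γ : ℝ) (hγ : 1 ≤ γ) (K : ℝ) (M : ℝ≥0) :
    ∃ (C : ℝ≥0) (Cp : ℝ → ℝ → ℝ≥0),
      (∀ T, 0 < T → Tendsto (fun p => Cp p T) atTop atTop) ∧
      (∀ p, 1 ≤ p → Tendsto (fun T => Cp p T) atTop atTop) ∧
      ∀ (μ₀ lam : ℝ → ℝ), PowerLawStokes.IsViscosity d K μ₀ lam →
      ∀ (T : ℝ), 0 < T →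
      ∀ (ϱ₀ : (Fin d → ℝ) → ℝ) (ϱ : ℝ → (Fin d → ℝ) → ℝ) (u : ℝ → (Fin d → ℝ) → Fin d → ℝ),
        eLpNorm ϱ₀ (⊤ : ℝ≥0∞) (PowerLawStokes.torusMeasure d) ≤ M →
        PowerLawStokes.IsSmoothSolution γ T μ₀ lam ϱ₀ ϱ u →
        PowerLawStokes.normGradL2 T u + PowerLawStokes.normLinftyLp T γ ϱ ≤ C ∧
        PowerLawStokes.normLinftyBMO T (fun t x =>
          (2 + lam |PowerLawStokes.divg (u t) x|) * PowerLawStokes.divg (u t) x - ϱ t x ^ γ) ≤ C ∧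
        ∀ p : ℝ, 1 ≤ p →
          PowerLawStokes.normLinftyLp T p (fun t x => PowerLawStokes.divg (u t) x)
            + PowerLawStokes.normLinftyLp T p ϱ ≤ Cp p T := by
  obtain ⟨B, θ, hB, hθ, hflux⟩ := exists_flux_bounds hd K
  obtain ⟨E, hE, henergy⟩ := exists_energy_bound hγ M
  have hMγ : 0 ≤ (M : ℝ) ^ γ := Real.rpow_nonneg M.2 _
  have hsum : ∀ p T : ℝ, |p| ≤ 2 + |divgMoment γ θ K M T p| + |densityMoment γ θ K M T p|
      + |p| + |T| ∧ |T| ≤ 2 + |divgMoment γ θ K M T p| + |densityMoment γ θ K M T p|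
      + |p| + |T| := fun p T => by
    have h1 := abs_nonneg (divgMoment γ θ K M T p)
    have h2 := abs_nonneg (densityMoment γ θ K M T p)
    have h3 := abs_nonneg p
    have h4 := abs_nonneg T
    constructor <;> linarith
  -- The summands `|p|` and `|T|` force divergence as `p` or `T` tends to infinity, and 2 collects
  -- the two units lost in passing from moments to norms. In `C`, `|K|` stands for `K`, whose sign
  -- is known only once a viscosity is given.
  refine ⟨Real.toNNReal (1 + E + (1 + (M : ℝ) ^ γ) + (2 * B + (|K| + (M : ℝ) ^ γ))),
    fun p T => Real.toNNReal (2 + |divgMoment γ θ K M T p| + |densityMoment γ θ K M T p|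
      + |p| + |T|), fun T _ => ?_, fun p _ => ?_, fun μ₀ lam hv T hT ϱ₀ ϱ u hM hs => ?_⟩
  · exact tendsto_real_toNNReal_atTop.comp
      (tendsto_atTop_mono (fun p => (hsum p T).1) tendsto_abs_atTop_atTop)
  · exact tendsto_real_toNNReal_atTop.comp
      (tendsto_atTop_mono (fun T => (hsum p T).2) tendsto_abs_atTop_atTop)
  have hosc := fun t h => (hflux γ μ₀ lam (ϱ t) (u t) hγ hv h).1
  have hexp := fun t h => (hflux γ μ₀ lam (ϱ t) (u t) hγ hv h).2
  have hK : |K| = K := abs_of_nonneg hv.nonneg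
  refine ⟨?_, ?_, fun p hp => ?_⟩
  · refine (add_le_add
      (hs.normGradL2_le hd hγ hv hT hE (henergy d T μ₀ lam ϱ₀ ϱ u hT hM hs))
      (hs.normLinftyLp_density_le hγ fun t ht => hs.integral_rpow_le hd hγ hv hT hM ht)).trans ?_
    rw [← ENNReal.ofReal_add (by positivity) (by positivity)]
    exact ENNReal.ofReal_le_ofReal (le_add_of_nonneg_right (by positivity))
  · refine (hs.normLinftyBMO_flux_le hd hγ hv hT hM hB.le hosc).trans ?_
    refine ENNReal.ofReal_le_ofReal ?_
    rw [hK]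
    linarith
  · have h1 := hs.normLinftyLp_divg_le hd hγ hv hT hM hθ hexp hp
    have h2 := hs.normLinftyLp_density_le hp
      fun t ht => hs.integral_density_le hd hγ hv hT hM hθ hexp hp ht
    have a1 := le_abs_self (divgMoment γ θ K M T p)
    have a2 := le_abs_self (densityMoment γ θ K M T p)
    have h3 := h1.trans (ENNReal.ofReal_le_ofReal (add_le_add (le_refl (1 : ℝ)) a1))
    have h4 := h2.trans (ENNReal.ofReal_le_ofReal (add_le_add (le_refl (1 : ℝ)) a2))
    refine (add_le_add h3 h4).trans ?_
    rw [← ENNReal.ofReal_add (by positivity) (by positivity)]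
    refine ENNReal.ofReal_le_ofReal ?_
    have h5 := abs_nonneg p
    have h6 := abs_nonneg T
    linarith
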